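/- **Diagrams.** An $n$-component virtual link diagram $D$ is the image of a smooth immersion of $n$ ordered, oriented circles into the plane whose only singularities are finitely many transverse double points, each of which is marked either as a classical crossing (with over/under information) or as a virtual crossing. Welded isotopy is the equivalence relation on such diagrams generated by plane isotopy, the Reidemeister moves R1–R3, the virtual moves V1–V4 and the over-crossings commute move OC; an $n$-component welded link is an equivalence class. A self-crossing virtualization replaces a classical crossing between two strands of the same component by a virtual crossing. **Milnor numbers.** Let $\mathbf p=(p_1,\dots,p_n)$ be a base point system of $D$: a point $p_i$ on each component, not on a crossing. The base points and the classical under-crossings divide the $i$th component into arcs $a_{i1},\dots,a_{i\,m_i+1}$, numbered from $p_i$ along the orientation. Let $u_{ij}$ be the over-arc at the classical crossing separating $a_{ij}$ from $a_{i\,j+1}$, let $\varepsilon_{ij}$ be its sign, and put $v_{ij}=u_{i1}^{\varepsilon_{i1}}\cdots u_{ij}^{\varepsilon_{ij}}$ and $l_i=a_{i1}^{-w_i}v_{im_i}$, where $w_i$ is the sum of the signs of the classical self-crossings of the $i$th component. Let $A$ be the free group on $\alpha_1,\dots,\alpha_n$. Homomorphisms $\eta_q$ $(q\ge 1)$ from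 the free group on the arcs to $A$ are defined by $\eta_1(a_{ij})=\alpha_i$, $\eta_{q+1}(a_{i1})=\alpha_i$ and $\eta_{q+1}(a_{ij})=\eta_q(v_{i\,j-1})^{-1}\alpha_i\,\eta_q(v_{i\,j-1})$ for $j\ge 2$. Let $E$ be the Magnus expansion, the homomorphism from $A$ to the units of $\mathbb Z\langle\langle X_1,\dots,X_n\rangle\rangle$ with $E(\alpha_i)=1+X_i$. For a sequence $j_1\dots j_s i$ of indices in $\{1,\dots,n\}$ with $s\ge1$, the Milnor number $\mu_{(D,\mathbf p)}(j_1\dots j_s i)$ is the coefficient of $X_{j_1}\cdots X_{j_s}$ in $E(\eta_q(l_i))$ for $q>s$ (it is the same for all $q>s$). For a sequence $I$ of length $r\ge 2$, the indeterminacy $\Delta_{(D,\mathbf p)}(I)$ is the greatest common divisor of all $\mu_{(D,\mathbf p)}(J)$, where $J$ has length $s$ with $2\le s<r$ and is obtained from $I$ by removing at least one index and permuting the remaining indices cyclically (it is $0$ if there is no such $J$). For a welded link $L$, $\overline\mu_L(I)$ is the residue class of $\mu_{(D,\mathbf p)}(I)$ modulo $\Delta_{(D,\mathbf p)}(I)$,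 for any virtual diagram $D$ of $L$ and any base point system $\mathbf p$ of $D$. **Theorem.** Let $L$ and $L'$ be $n$-component welded links with virtual link diagrams $D$ and $D'$, respectively. If $D$ and $D'$ are related by a finite sequence of self-crossing virtualizations (and their inverses) and welded isotopies, then for every sequence $I$ of length at least $2$ of pairwise distinct indices in $\{1,\dots,n\}$ the residue classes $\overline\mu_L(I)$ and $\overline\mu_{L'}(I)$ are well defined (they depend neither on the choice of the diagram of the link nor on the base point system) and $$\overline\mu_L(I)=\overline\mu_{L'}(I);$$ that is, the moduli agree and the Milnor numbers are congruent modulo them. -/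

import Mathlib

open scoped ContDiff

namespace WeldedMilnor

/-! ### Virtual link diagrams

A component of an `n`-component diagram is a `1`-periodic smooth immersion `ℝ → ℝ²`,
that is, an immersed oriented circle `ℝ/ℤ → ℝ²`. -/

abbrev Plane : Type := ℝ × ℝ

/-- The determinant of a pair of plane vectors. -/
def cross (v w : Plane) : ℝ := v.1 * w.2 - v.2 * w.1

/-- A parameter value on one of the `n` components. -/
abbrev Param (n : ℕ) : Type := Fin n × ℝ

/-- Two parameters describe the same point of the disjoint union of `n` circles `ℝ/ℤ`. -/
def SamePoint {n : ℕ} (x y : Param n) : Prop := x.1 = y.1 ∧ ∃ k : ℤ, y.2 = x.2 + k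

/-- Two different points of the circles have the same image. -/
def Meets {n : ℕ} (curve : Fin n → ℝ → Plane) (x y : Param n) : Prop :=
  curve x.1 x.2 = curve y.1 y.2 ∧ ¬ SamePoint x y

/-- An `n`-component virtual link diagram: `n` ordered oriented circles immersed in the plane,
whose only singularities are finitely many transverse double points. `IsOver x y` says that `x`
and `y` are the two preimages of a classical crossing and that the strand through `x` is the
over-strand there; the other double points are the virtual crossings. -/
structure VirtualLinkDiagram (n : ℕ) where
  curve : Fin n → ℝ → Plane
  periodic : ∀ i, Function.Periodic (curve i) 1
  smooth : ∀ i, ContDiff ℝ ∞ (curve i)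
  immersive : ∀ i t, deriv (curve i) t ≠ 0
  double : ∀ x y z, Meets curve x y → Meets curve x z → SamePoint y z
  transverse : ∀ x y, Meets curve x y → cross (deriv (curve x.1) x.2) (deriv (curve y.1) y.2) ≠ 0
  finite : ∀ i a b, {t : ℝ | t ∈ Set.Icc a b ∧ ∃ y, Meets curve (i, t) y}.Finite
  IsOver : Param n → Param n → Prop
  over_meets : ∀ x y, IsOver x y → Meets curve x y
  over_asymm : ∀ x y, IsOver x y → ¬ IsOver y x
  over_congr : ∀ x y z w, SamePoint x z → SamePoint y w → IsOver x y → IsOver z w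

/-- A base point on each component, disjoint from all crossings (classical and virtual). -/
structure BasePointSystem {n : ℕ} (D : VirtualLinkDiagram n) where
  point : Fin n → ℝ
  not_crossing : ∀ i y, ¬ Meets D.curve (i, point i) y

instance {n : ℕ} (D : VirtualLinkDiagram n) : Nonempty (BasePointSystem D) := by
  have h : ∀ i, ∃ t : ℝ, ∀ y, ¬ Meets D.curve (i, t) y := by
    intro i
    obtain ⟨t, ht, hn⟩ := (Set.Icc_infinite (zero_lt_one' ℝ)).exists_notMem_finite
      (D.finite i 0 1)
    exact ⟨t, fun y hy => hn ⟨ht, y, hy⟩⟩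
  choose f hf using h
  exact ⟨⟨f, hf⟩⟩

namespace VirtualLinkDiagram

variable {n : ℕ}

/-- The image point of a parameter. -/
def pt (D : VirtualLinkDiagram n) (x : Param n) : Plane := D.curve x.1 x.2

/-- The velocity vector at a parameter. -/
noncomputable def vel (D : VirtualLinkDiagram n) (x : Param n) : Plane := deriv (D.curve x.1) x.2

/-- `x` and `y` are the two preimages of a virtual crossing. -/
def IsVirtual (D : VirtualLinkDiagram n) (x y : Param n) : Prop :=
  Meets D.curve x y ∧ ¬ D.IsOver x y ∧ ¬ D.IsOver y x

end VirtualLinkDiagram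

/-! ### The combinatorial data of a diagram with base points, and the homomorphisms `η_q` -/

/-- The `i`-th component, traversed from its base point, consists of the arcs
`a_{i,0}, …, a_{i,m i}`; the arc `overArc i j` separates `a_{i,j}` from `a_{i,j+1}`, and
`sign i j` is the sign of the crossing between them. -/
structure ArcData (n : ℕ) where
  m : Fin n → ℕ
  overArc : (i : Fin n) → Fin (m i) → (k : Fin n) × Fin (m k + 1)
  sign : (i : Fin n) → Fin (m i) → ℤ

namespace ArcData

variable {n : ℕ}

/-- The set of arcs. -/
abbrev Arc (G : ArcData n) : Type := (k : Fin n) × Fin (G.m k + 1)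

/-- The partial longitude, the product of the letters `overArc i h ^ sign i h` over `h < j`. -/
def partialLongitude (G : ArcData n) (i : Fin n) (j : ℕ) : FreeGroup G.Arc :=
  ((List.ofFn fun h : Fin (G.m i) => FreeGroup.of (G.overArc i h) ^ G.sign i h).take j).prod

/-- The sum of the signs of the classical self-crossings of the `i`-th component. -/
def selfWrithe (G : ArcData n) (i : Fin n) : ℤ :=
  ∑ j : Fin (G.m i), if (G.overArc i j).1 = i then G.sign i j else 0

/-- The `i`-th preferred longitude. -/
def longitude (G : ArcData n) (i : Fin n) : FreeGroup G.Arc :=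
  FreeGroup.of ⟨i, 0⟩ ^ (-G.selfWrithe i) * G.partialLongitude i (G.m i)

/-- The homomorphism `η_q`, for `q ≥ 1` (the value at `q = 0` is not used). -/
def eta (G : ArcData n) : ℕ → (FreeGroup G.Arc →* FreeGroup (Fin n))
  | 0 => 1
  | 1 => FreeGroup.lift fun a => FreeGroup.of a.1
  | q + 2 => FreeGroup.lift fun a =>
      (G.eta (q + 1) (G.partialLongitude a.1 a.2))⁻¹ * FreeGroup.of a.1 *
        G.eta (q + 1) (G.partialLongitude a.1 a.2)

end ArcData

/-! ### Reading the arc data off a diagram with base points -/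

namespace VirtualLinkDiagram

variable {n : ℕ}

theorem finite_under (D : VirtualLinkDiagram n) (p : BasePointSystem D) (i : Fin n) :
    {t : ℝ | t ∈ Set.Ioo (p.point i) (p.point i + 1) ∧ ∃ y, D.IsOver y (i, t)}.Finite := by
  refine (D.finite i (p.point i) (p.point i + 1)).subset ?_
  rintro t ⟨ht, y, hy⟩
  obtain ⟨h1, h2⟩ := D.over_meets _ _ hy
  refine ⟨Set.Ioo_subset_Icc_self ht, y, h1.symm, ?_⟩
  rintro ⟨h3, k, hk⟩
  exact h2 ⟨h3.symm, -k, by push_cast; linarith⟩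

/-- The under-crossings met when the `i`-th component is traversed once from its base point. -/
noncomputable def underParams (D : VirtualLinkDiagram n) (p : BasePointSystem D) (i : Fin n) :
    Finset ℝ :=
  (D.finite_under p i).toFinset

/-- The `j`-th under-crossing after the base point on the `i`-th component (starting at `0`). -/
noncomputable def underParam (D : VirtualLinkDiagram n) (p : BasePointSystem D) (i : Fin n)
    (j : Fin (D.underParams p i).card) : ℝ :=
  (D.underParams p i).orderEmbOfFin rfl j

theorem exists_over (D : VirtualLinkDiagram n) (p : BasePointSystem D) (i : Fin n)
    (j : Fin (D.underParams p i).card) : ∃ y, D.IsOver y (i, D.underParam p i j) :=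
  ((D.finite_under p i).mem_toFinset.mp ((D.underParams p i).orderEmbOfFin_mem rfl j)).2

/-- The preimage, on the over-strand, of the `j`-th under-crossing of the `i`-th component. -/
noncomputable def overParam (D : VirtualLinkDiagram n) (p : BasePointSystem D) (i : Fin n)
    (j : Fin (D.underParams p i).card) : Param n :=
  (D.exists_over p i j).choose

/-- The arc containing a given point: the number of under-crossings between the base point
and that point is the index of the arc. -/
noncomputable def arcAt (D : VirtualLinkDiagram n) (p : BasePointSystem D) (x : Param n) :
    (k : Fin n) × Fin ((D.underParams p k).card + 1) :=
  ⟨x.1, ⟨{t ∈ D.underParams p x.1 | t < toIcoMod one_pos (p.point x.1) x.2}.card,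
    Nat.lt_succ_of_le (Finset.card_filter_le _ _)⟩⟩

/-- The arcs of `(D, p)`, with the over-arc and the sign of each classical crossing. -/
noncomputable def arcData (D : VirtualLinkDiagram n) (p : BasePointSystem D) : ArcData n where
  m i := (D.underParams p i).card
  overArc i j := D.arcAt p (D.overParam p i j)
  sign i j :=
    SignType.sign (cross (D.vel (D.overParam p i j)) (D.vel (i, D.underParam p i j)))

end VirtualLinkDiagram

/-! ### Formal power series in non-commuting variables and the Magnus expansion -/

/-- Formal power series with integer coefficients in the non-commuting variables `X_i`, `i : ι`;
the word `X_{i₁} ⋯ X_{iₛ}` is the list `[i₁, …, iₛ]`. -/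
@[ext] structure NCSeries (ι : Type) where
  coeff : List ι → ℤ

namespace NCSeries

variable {ι : Type}

instance : Zero (NCSeries ι) := ⟨⟨fun _ => 0⟩⟩

instance : One (NCSeries ι) := ⟨⟨fun w => if w.isEmpty then 1 else 0⟩⟩

instance : Add (NCSeries ι) := ⟨fun f g => ⟨fun w => f.coeff w + g.coeff w⟩⟩

instance : Neg (NCSeries ι) := ⟨fun f => ⟨fun w => -f.coeff w⟩⟩

instance : Mul (NCSeries ι) :=
  ⟨fun f g => ⟨fun w =>
    ∑ k ∈ Finset.range (w.length + 1), f.coeff (w.take k) * g.coeff (w.drop k)⟩⟩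

theorem coeff_zero (w : List ι) : (0 : NCSeries ι).coeff w = 0 := rfl

theorem coeff_one (w : List ι) : (1 : NCSeries ι).coeff w = if w.isEmpty then 1 else 0 := rfl

theorem coeff_add (f g : NCSeries ι) (w : List ι) :
    (f + g).coeff w = f.coeff w + g.coeff w := rfl

theorem coeff_neg (f : NCSeries ι) (w : List ι) : (-f).coeff w = -f.coeff w := rfl

theorem coeff_mul (f g : NCSeries ι) (w : List ι) : (f * g).coeff w =
    ∑ k ∈ Finset.range (w.length + 1), f.coeff (w.take k) * g.coeff (w.drop k) := rfl

/-- The series whose coefficient at `w` is that of `f` at `x w`. -/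
def shift (x : ι) (f : NCSeries ι) : NCSeries ι := ⟨fun w => f.coeff (x :: w)⟩

theorem coeff_mul_nil (f g : NCSeries ι) : (f * g).coeff [] = f.coeff [] * g.coeff [] := by
  simp [coeff_mul]

theorem coeff_mul_cons (f g : NCSeries ι) (x : ι) (w : List ι) :
    (f * g).coeff (x :: w) = f.coeff [] * g.coeff (x :: w) + (shift x f * g).coeff w := by
  simp only [coeff_mul, shift, List.length_cons]
  rw [Finset.sum_range_succ' _ (w.length + 1)]
  simp [add_comm]

theorem add_mul_coeff (f g h : NCSeries ι) (w : List ι) :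
    ((f + g) * h).coeff w = (f * h).coeff w + (g * h).coeff w := by
  simp only [coeff_mul, coeff_add, add_mul, Finset.sum_add_distrib]

theorem assoc_coeff (w : List ι) : ∀ f g h : NCSeries ι,
    (f * g * h).coeff w = (f * (g * h)).coeff w := by
  induction w with
  | nil => intro f g h; simp only [coeff_mul_nil, mul_assoc]
  | cons x w ih =>
    intro f g h
    have key : shift x (f * g) = ⟨fun v => f.coeff [] * (shift x g).coeff v⟩ + shift x f * g := by
      ext v
      exact coeff_mul_cons f g x v
    have scal : ((⟨fun v => f.coeff [] * (shift x g).coeff v⟩ : NCSeries ι) * h).coeff w =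
        f.coeff [] * (shift x g * h).coeff w := by
      simp only [coeff_mul, Finset.mul_sum, mul_assoc]
    rw [coeff_mul_cons, coeff_mul_cons f, coeff_mul_cons g, coeff_mul_nil, key, add_mul_coeff,
      scal, ih]
    ring

instance : Ring (NCSeries ι) where
  zsmul := zsmulRec
  nsmul := nsmulRec
  add_assoc _ _ _ := by ext; simp only [coeff_add, add_assoc]
  zero_add _ := by ext; simp only [coeff_add, coeff_zero, zero_add]
  add_zero _ := by ext; simp only [coeff_add, coeff_zero, add_zero]
  add_comm _ _ := by ext; simp only [coeff_add, add_comm]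
  neg_add_cancel _ := by ext; simp only [coeff_add, coeff_neg, coeff_zero, neg_add_cancel]
  left_distrib _ _ _ := by
    ext; simp only [coeff_mul, coeff_add, mul_add, Finset.sum_add_distrib]
  right_distrib f g h := by ext w; exact add_mul_coeff f g h w
  zero_mul _ := by ext; simp only [coeff_mul, coeff_zero, zero_mul, Finset.sum_const_zero]
  mul_zero _ := by ext; simp only [coeff_mul, coeff_zero, mul_zero, Finset.sum_const_zero]
  mul_assoc f g h := by ext w; exact assoc_coeff w f g h
  one_mul f := by
    ext w
    cases w with
    | nil => simp [coeff_mul_nil, coeff_one]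
    | cons x w =>
      have h0 : shift x (1 : NCSeries ι) = ⟨fun _ => 0⟩ := by ext v; simp [shift, coeff_one]
      rw [coeff_mul_cons, h0]
      simp [coeff_one, coeff_mul]
  mul_one f := by
    ext w
    induction w generalizing f with
    | nil => simp [coeff_mul_nil, coeff_one]
    | cons x w ih => rw [coeff_mul_cons, ih]; simp [coeff_one, shift]

variable [DecidableEq ι]

/-- The variable `X_i`. -/
def X (i : ι) : NCSeries ι := ⟨fun w => if w = [i] then 1 else 0⟩

/-- The series `1 - X_i + X_i ^ 2 - X_i ^ 3 + ⋯`. -/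
def altGeom (i : ι) : NCSeries ι :=
  ⟨fun w => if w = List.replicate w.length i then (-1) ^ w.length else 0⟩

theorem shift_altGeom (x i : ι) :
    shift x (altGeom i) = if x = i then -altGeom i else 0 := by
  ext w
  by_cases hx : x = i
  · subst hx
    by_cases hw : w = List.replicate w.length x
    · simp only [shift, altGeom, coeff_neg, List.length_cons, List.replicate_succ, if_true,
        List.cons.injEq, true_and, if_pos hw, pow_succ, mul_neg, mul_one]
    · simp only [shift, altGeom, coeff_neg, List.length_cons, List.replicate_succ, if_true,
        List.cons.injEq, true_and, if_neg hw, neg_zero]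
  · simp [shift, altGeom, coeff_zero, List.replicate_succ, hx]

theorem shift_one_add_X (x i : ι) : shift x (1 + X i) = if x = i then 1 else 0 := by
  ext w
  by_cases hx : x = i
  · subst hx
    cases w <;> simp [shift, X, coeff_add, coeff_one]
  · simp [shift, X, coeff_add, coeff_one, coeff_zero, hx]

theorem one_add_X_mul_altGeom (i : ι) : (1 + X i) * altGeom i = 1 := by
  ext w
  cases w with
  | nil => simp [coeff_mul_nil, coeff_add, coeff_one, X, altGeom]
  | cons x w =>
    have h : (altGeom i).coeff (x :: w) = (shift x (altGeom i)).coeff w := rfl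
    rw [coeff_mul_cons, shift_one_add_X, h, shift_altGeom]
    by_cases hx : x = i <;> simp [hx, coeff_add, coeff_one, X, coeff_neg, coeff_zero]

theorem altGeom_mul_one_add_X (i : ι) : altGeom i * (1 + X i) = 1 := by
  have aux : ∀ w : List ι, (altGeom i * (1 + X i)).coeff w = (1 : NCSeries ι).coeff w := by
    intro w
    induction w with
    | nil => simp [coeff_mul_nil, coeff_add, coeff_one, X, altGeom]
    | cons x w ih =>
      rw [coeff_mul_cons, shift_altGeom]
      by_cases hx : x = i
      · subst hx
        rw [if_pos rfl, neg_mul, coeff_neg, ih]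
        cases w <;> simp [coeff_add, coeff_one, X, altGeom]
      · simp [hx, coeff_add, coeff_one, X, altGeom, coeff_zero]
  ext w
  exact aux w

/-- The unit `1 + X_i`. -/
def unitX (i : ι) : (NCSeries ι)ˣ :=
  ⟨1 + X i, altGeom i, one_add_X_mul_altGeom i, altGeom_mul_one_add_X i⟩

/-- The Magnus expansion, `α_i ↦ 1 + X_i` and `α_i⁻¹ ↦ 1 - X_i + X_i ^ 2 - ⋯`. -/
def magnus : FreeGroup ι →* (NCSeries ι)ˣ := FreeGroup.lift unitX

end NCSeries

/-! ### Milnor numbers, indeterminacies and residue classes -/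

namespace ArcData

variable {n : ℕ}

/-- For a sequence `I = j₁ ⋯ jₛ i`, the coefficient of `X_{j₁} ⋯ X_{jₛ}` in the Magnus expansion
of the image under `η_q` of the `i`-th preferred longitude (`0` for the empty sequence). -/
def milnorNumberAt (G : ArcData n) (q : ℕ) (I : List (Fin n)) : ℤ :=
  match I.getLast? with
  | none => 0
  | some i => (NCSeries.magnus (G.eta q (G.longitude i))).val.coeff I.dropLast

/-- The Milnor number `μ(j₁ ⋯ jₛ i)`. The coefficient above is the same for all `q > s`;
we take `q = s + 1`. -/
def milnorNumber (G : ArcData n) (I : List (Fin n)) : ℤ := G.milnorNumberAt I.length I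

end ArcData

/-- The sequences of length at least `2` obtained from `I` by removing at least one index and
permuting the remaining indices cyclically. -/
def properCyclic {n : ℕ} (I : List (Fin n)) : Finset (List (Fin n)) :=
  ((I.sublists.filter fun K => 2 ≤ K.length ∧ K.length < I.length).flatMap
    List.cyclicPermutations).toFinset

namespace ArcData

variable {n : ℕ}

/-- The indeterminacy `Δ(I)` (the greatest common divisor of the empty family is `0`). -/
def indeterminacy (G : ArcData n) (I : List (Fin n)) : ℤ :=
  (properCyclic I).gcd G.milnorNumber

end ArcData

namespace VirtualLinkDiagram

variable {n : ℕ}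

/-- The Milnor number `μ_{(D, p)}(I)`. -/
noncomputable def milnorNumber (D : VirtualLinkDiagram n) (p : BasePointSystem D)
    (I : List (Fin n)) : ℤ :=
  (D.arcData p).milnorNumber I

/-- The indeterminacy `Δ_{(D, p)}(I)`. -/
noncomputable def indeterminacy (D : VirtualLinkDiagram n) (p : BasePointSystem D)
    (I : List (Fin n)) : ℤ :=
  (D.arcData p).indeterminacy I

/-- The residue class of `μ_{(D, p)}(I)` modulo `Δ_{(D, p)}(I)`, as a coset in `ℤ`. Two such
cosets are equal iff the moduli are equal and the Milnor numbers are congruent. -/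
def milnorClass (D : VirtualLinkDiagram n) (p : BasePointSystem D) (I : List (Fin n)) : Set ℤ :=
  {k | k ≡ D.milnorNumber p I [ZMOD D.indeterminacy p I]}

end VirtualLinkDiagram

/-! ### Welded Reidemeister moves -/

/-- `D` and `D'` differ by an orientation-preserving diffeomorphism of the plane (equivalently,
by an ambient isotopy of the plane) and by orientation-preserving changes of parameter of the
circles. -/
def PlaneIsotopic {n : ℕ} (D D' : VirtualLinkDiagram n) : Prop :=
  ∃ (h : Plane ≃ₜ Plane) (φ : Fin n → ℝ → ℝ),
    ContDiff ℝ ∞ h ∧ ContDiff ℝ ∞ h.symm ∧ (∀ v, 0 < (fderiv ℝ h v).det) ∧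
    (∀ i, ContDiff ℝ ∞ (φ i)) ∧ (∀ i t, 0 < deriv (φ i) t) ∧ (∀ i t, φ i (t + 1) = φ i t + 1) ∧
    (∀ i t, D'.curve i t = h (D.curve i (φ i t))) ∧
    ∀ x y, D'.IsOver x y ↔ D.IsOver (x.1, φ x.1 x.2) (y.1, φ y.1 y.2)

/-- `k` strands: the `s`-th one is the part of the component `comp s` with parameters from
`lo s` to `hi s`. -/
structure Strands (n k : ℕ) where
  comp : Fin k → Fin n
  lo : Fin k → ℝ
  hi : Fin k → ℝ
  lo_lt : ∀ s, lo s < hi s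
  hi_lt : ∀ s, hi s < lo s + 1
  disjoint : ∀ s s' t t', t ∈ Set.Icc (lo s) (hi s) → t' ∈ Set.Icc (lo s') (hi s') →
    SamePoint (comp s, t) (comp s', t') → s = s'

namespace Strands

variable {n k : ℕ}

/-- The point with parameter `t` on the strand `s`. -/
def param (S : Strands n k) (s : Fin k) (t : ℝ) : Param n := (S.comp s, t)

/-- `t` is the parameter of an interior point of the strand `s`. -/
def Inside (S : Strands n k) (s : Fin k) (t : ℝ) : Prop := t ∈ Set.Ioo (S.lo s) (S.hi s)

/-- The point `x` lies on one of the strands. -/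
def Contains (S : Strands n k) (x : Param n) : Prop :=
  ∃ s t, t ∈ Set.Icc (S.lo s) (S.hi s) ∧ SamePoint x (S.param s t)

end Strands

/-- `δ` is a closed disk in the plane. -/
def IsDisk (δ : Set Plane) : Prop :=
  ∃ e : Plane ≃ₜ Plane, δ = e '' Metric.closedBall 0 1

/-- `D` and `D'` are identical outside the disk `δ`, and each of them meets `δ` exactly in
the given strands. -/
structure LocalChange {n k : ℕ} (D D' : VirtualLinkDiagram n) (δ : Set Plane)
    (S : Strands n k) : Prop where
  disk : IsDisk δ
  left : ∀ x, D.pt x ∈ δ ↔ S.Contains x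
  right : ∀ x, D'.pt x ∈ δ ↔ S.Contains x
  same_curve : ∀ x, ¬ S.Contains x → D.pt x = D'.pt x
  same_crossings : ∀ x y, ¬ S.Contains x → ¬ S.Contains y → (D.IsOver x y ↔ D'.IsOver x y)

/-- The crossings of `D` in `δ` are exactly those whose pairs of preimages are listed in `l`. -/
def CrossingsIn {n : ℕ} (D : VirtualLinkDiagram n) (δ : Set Plane)
    (l : List (Param n × Param n)) : Prop :=
  (∀ z ∈ l, Meets D.curve z.1 z.2) ∧
  ∀ x y, Meets D.curve x y → D.pt x ∈ δ →
    ∃ z ∈ l, (SamePoint x z.1 ∧ SamePoint y z.2) ∨ (SamePoint x z.2 ∧ SamePoint y z.1)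

/-- The type of a crossing between a first and a second strand of a local picture. -/
inductive CrossingType
  | classical
  | virtual

/-- The crossing with preimages `x` and `y` has the given type; for `classical`, the strand of `x`
passes over the strand of `y`. -/
def HasType {n : ℕ} (D : VirtualLinkDiagram n) (x y : Param n) : CrossingType → Prop
  | .classical => D.IsOver x y
  | .virtual => D.IsVirtual x y

/-- Creation of a kink on a strand. -/
def KinkMove {n : ℕ} (c : CrossingType) (D D' : VirtualLinkDiagram n) : Prop :=
  ∃ (δ : Set Plane) (S : Strands n 1), LocalChange D D' δ S ∧ CrossingsIn D δ [] ∧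
    ∃ t u : ℝ, S.Inside 0 t ∧ S.Inside 0 u ∧
      CrossingsIn D' δ [(S.param 0 t, S.param 0 u)] ∧ HasType D' (S.param 0 t) (S.param 0 u) c

/-- Creation of a bigon between two strands: the strand `0` crosses the strand `1` twice, in
opposite directions, and both crossings have the same type. -/
def BigonMove {n : ℕ} (c : CrossingType) (D D' : VirtualLinkDiagram n) : Prop :=
  ∃ (δ : Set Plane) (S : Strands n 2), LocalChange D D' δ S ∧ CrossingsIn D δ [] ∧
    ∃ t₁ t₂ u₁ u₂ : ℝ, S.Inside 0 t₁ ∧ S.Inside 0 t₂ ∧ S.Inside 1 u₁ ∧ S.Inside 1 u₂ ∧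
      t₁ ≠ t₂ ∧ u₁ ≠ u₂ ∧
      CrossingsIn D' δ [(S.param 0 t₁, S.param 1 u₁), (S.param 0 t₂, S.param 1 u₂)] ∧
      HasType D' (S.param 0 t₁) (S.param 1 u₁) c ∧ HasType D' (S.param 0 t₂) (S.param 1 u₂) c ∧
      cross (D'.vel (S.param 0 t₁)) (D'.vel (S.param 1 u₁)) *
        cross (D'.vel (S.param 0 t₂)) (D'.vel (S.param 1 u₂)) < 0

/-- Three strands form a triangle in `δ`: they cross pairwise exactly once, and `τ i j` is the
parameter on the strand `i` of its crossing with the strand `j`. The crossings `01`, `02`, `12`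
have the types `c₀₁`, `c₀₂`, `c₁₂`. The sign `κ` distinguishes the two ways in which three
strands with given directions can form a triangle: for straight strands with direction vectors
`v₀, v₁, v₂`, the displacements along the sides of the triangle are proportional to
`cross v₁ v₂ • v₀`, `cross v₂ v₀ • v₁`, `cross v₀ v₁ • v₂`, and `κ` is the sign of the factor. -/
structure Triangle {n : ℕ} (D : VirtualLinkDiagram n) (δ : Set Plane) (S : Strands n 3)
    (c₀₁ c₀₂ c₁₂ : CrossingType) (κ : ℝ) (τ : Fin 3 → Fin 3 → ℝ) : Prop where
  inside : ∀ i j, i ≠ j → S.Inside i (τ i j)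
  crossings : CrossingsIn D δ [(S.param 0 (τ 0 1), S.param 1 (τ 1 0)),
    (S.param 0 (τ 0 2), S.param 2 (τ 2 0)), (S.param 1 (τ 1 2), S.param 2 (τ 2 1))]
  type₀₁ : HasType D (S.param 0 (τ 0 1)) (S.param 1 (τ 1 0)) c₀₁
  type₀₂ : HasType D (S.param 0 (τ 0 2)) (S.param 2 (τ 2 0)) c₀₂
  type₁₂ : HasType D (S.param 1 (τ 1 2)) (S.param 2 (τ 2 1)) c₁₂
  position : ∀ i : Fin 3, 0 < κ * (τ i (i + 2) - τ i (i + 1)) *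
    cross (D.vel (S.param (i + 1) (τ (i + 1) (i + 2)))) (D.vel (S.param (i + 2) (τ (i + 2) (i + 1))))

/-- A strand is moved across the crossing of two other strands: a triangle is replaced by the
opposite triangle, with the same crossing types and the same directions of the strands. -/
def TriangleMove {n : ℕ} (c₀₁ c₀₂ c₁₂ : CrossingType) (D D' : VirtualLinkDiagram n) : Prop :=
  ∃ (δ : Set Plane) (S : Strands n 3) (κ : ℝ) (τ τ' : Fin 3 → Fin 3 → ℝ),
    LocalChange D D' δ S ∧ Triangle D δ S c₀₁ c₀₂ c₁₂ κ τ ∧ Triangle D' δ S c₀₁ c₀₂ c₁₂ (-κ) τ' ∧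
    ∀ i j, i ≠ j → 0 < cross (D.vel (S.param i (τ i j))) (D.vel (S.param j (τ j i))) *
      cross (D'.vel (S.param i (τ' i j))) (D'.vel (S.param j (τ' j i)))

/-- The moves generating welded isotopy: plane isotopies, the Reidemeister moves R1, R2, R3,
the virtual moves V1, V2, V3, V4 and the over-crossings commute move OC. -/
inductive WeldedMove {n : ℕ} (D D' : VirtualLinkDiagram n) : Prop
  | plane : PlaneIsotopic D D' → WeldedMove D D'
  | R1 : KinkMove .classical D D' → WeldedMove D D'
  | R2 : BigonMove .classical D D' → WeldedMove D D'
  | R3 : TriangleMove .classical .classical .classical D D' → WeldedMove D D'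
  | V1 : KinkMove .virtual D D' → WeldedMove D D'
  | V2 : BigonMove .virtual D D' → WeldedMove D D'
  | V3 : TriangleMove .virtual .virtual .virtual D D' → WeldedMove D D'
  | V4 : TriangleMove .virtual .virtual .classical D D' → WeldedMove D D'
  | OC : TriangleMove .classical .classical .virtual D D' → WeldedMove D D'

/-- `D'` is obtained from `D` by replacing a classical crossing between two strands of the same
component by a virtual crossing. -/
def SelfCrossingVirtualization {n : ℕ} (D D' : VirtualLinkDiagram n) : Prop :=
  D'.curve = D.curve ∧ ∃ x y : Param n, D.IsOver x y ∧ x.1 = y.1 ∧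
    ∀ z w, D'.IsOver z w ↔ (D.IsOver z w ∧ ¬ (SamePoint x z ∧ SamePoint y w))

/-- Welded isotopy: finite sequences of welded moves, in both directions. -/
def WeldedIsotopic {n : ℕ} (D D' : VirtualLinkDiagram n) : Prop :=
  Relation.EqvGen WeldedMove D D'

/-- The relation generated by self-crossing virtualizations and welded isotopies. -/
def SVWeldedIsotopic {n : ℕ} (D D' : VirtualLinkDiagram n) : Prop :=
  Relation.EqvGen (fun E E' => WeldedMove E E' ∨ SelfCrossingVirtualization E E') D D'

/-- Welded isotopy as a setoid. -/
def weldedSetoid (n : ℕ) : Setoid (VirtualLinkDiagram n) where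
  r := WeldedIsotopic
  iseqv := Relation.EqvGen.is_equivalence WeldedMove

/-- An `n`-component welded link is a class of virtual link diagrams up to welded isotopy. -/
def WeldedLink (n : ℕ) : Type := Quotient (weldedSetoid n)

namespace WeldedLink

variable {n : ℕ}

/-- `D` is a virtual diagram of the welded link `L`. -/
def IsDiagram (D : VirtualLinkDiagram n) (L : WeldedLink n) : Prop :=
  (Quotient.mk (weldedSetoid n) D : WeldedLink n) = L

/-- The residue class `μ̄_L(I)`, read off from some virtual diagram of `L` and some base point
system. -/
noncomputable def milnorBar (L : WeldedLink n) (I : List (Fin n)) : Set ℤ :=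
  (Quotient.out (s := weldedSetoid n) L).milnorClass (Classical.arbitrary _) I

end WeldedLink

end WeldedMilnor

namespace WeldedMilnor

/-! ### Palettes and colourings of arcs -/

/-! The proof replaces Milnor numbers by a colourability question that mentions no base points and
survives every move. Fix a sequence `js i` of distinct indices and an integer `d` dividing all
Milnor numbers that enter the indeterminacy of `js i`. In the series ring keep only the coefficients
at sublists of `js`, modulo `d`. This quotient ring is nilpotent above degree `|js|`, and since `js`
has no repeated letter, `X k * t * X k = 0` in it for every `t`; hence all conjugates of `1 + X k`
commute. Because `i` is not in `js`, the generator of component `i` becomes `1`.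

Colour the components `k ≠ i` by conjugates of `1 + X k`, as in a Wirtinger presentation, and colour
component `i` by its accumulated holonomy, required to change by the central unit `z = 1 + m X_js`
after one turn. Commuting conjugates make self-crossings invisible (`act_self`), so self-crossing
virtualizations, R1 and V1 do not affect colourability. The remaining moves are local: inside the
disk the colours are determined by the incoming ones, and the total jump along each strand is the
same before and after (`LocalChange.colorable_of_hasJumps`).

Two facts tie colourability to the Milnor number. Existence (`exists_isArcColoring`): the maps `η_q`
stabilise in the nilpotent ring and give an exact solution of the crossing relations. The
divisibility by `d` makes each longitude commute with its meridian, which is where the cyclic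
permutations in the indeterminacy are needed, and turns the `i`-th longitude into `1 + μ(js i)
X_js`; so a colouring with `m = μ(js i)` exists. Rigidity (`IsArcColoring.modEq`): any colouring
differs from the standard one by the substitution of conjugates for the variables, which fixes the
top monomial, so its `m` must be congruent to `μ(js i)`.

Transporting a colouring from `D` to `D'` therefore gives the congruence modulo any common divisor
`d` of the two indeterminacies. Induction on the length of the sequence shows that the
indeterminacies themselves agree. Independence of diagram and base points is the same statement for
plain welded isotopy. -/

/-- Colours for diagrams: the over-strand with colour `y'` on the component `k'` acts on the colours
of the under-strand, lying on the component `k`, through `act k _ (overElt k' y')`; going once around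
the component `k` changes the colours by `shift k`. -/
structure Palette (n : ℕ) (Q Y : Type) [Group Q] where
  act : Fin n → Y → Q → Y
  act_one : ∀ k y, act k y 1 = y
  act_mul : ∀ k y g h, act k y (g * h) = act k (act k y g) h
  overElt : Fin n → Y → Q
  -- Equivariance: acting on a colour conjugates the element by which it acts on others. R3 rests on
  -- this axiom.
  overElt_act : ∀ k y g, overElt k (act k y g) = g⁻¹ * overElt k y * g
  shift : Fin n → Equiv.Perm Y
  shift_act : ∀ k y g, shift k (act k y g) = act k (shift k y) g
  overElt_shift : ∀ k y, overElt k (shift k y) = overElt k y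
  valid : Fin n → Y → Prop
  valid_act : ∀ k y g, valid k y → valid k (act k y g)
  valid_shift : ∀ k y, valid k (shift k y) ↔ valid k y
  -- Strands of one component act trivially on each other; this makes self-crossings invisible to
  -- colourings.
  act_self : ∀ k y y', valid k y → valid k y' → act k y (overElt k y') = y

namespace ArcData

variable {n : ℕ}

theorem partialLongitude_zero (G : ArcData n) (i : Fin n) : G.partialLongitude i 0 = 1 := by
  simp [partialLongitude]

theorem partialLongitude_succ (G : ArcData n) (i : Fin n) (j : Fin (G.m i)) :
    G.partialLongitude i (j + 1) =
      G.partialLongitude i j * FreeGroup.of (G.overArc i j) ^ G.sign i j := by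
  unfold partialLongitude
  rw [List.prod_take_succ _ _ (by simp)]
  simp

/-- Colourings of the arcs that are compatible with all crossings. -/
structure IsArcColoring {Q Y : Type} [Group Q] (P : Palette n Q Y) (G : ArcData n)
    (C : G.Arc → Y) : Prop where
  valid : ∀ a, P.valid a.1 (C a)
  step : ∀ k (j : Fin (G.m k)), C ⟨k, j.succ⟩ =
    P.act k (C ⟨k, j.castSucc⟩) (P.overElt (G.overArc k j).1 (C (G.overArc k j)) ^ G.sign k j)
  closed : ∀ k, C ⟨k, Fin.last _⟩ = P.shift k (C ⟨k, 0⟩)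

variable {Q Y : Type} [Group Q] {P : Palette n Q Y} {G : ArcData n}

/-- Composing the crossing rules along a component turns the jumps into the image of the partial
longitude, so a colouring is governed by its base colours and the induced homomorphism. -/
theorem IsArcColoring.eq_act {C : G.Arc → Y} (h : IsArcColoring P G C) (k : Fin n)
    (j : Fin (G.m k + 1)) :
    C ⟨k, j⟩ = P.act k (C ⟨k, 0⟩)
      (FreeGroup.lift (fun a : G.Arc => P.overElt a.1 (C a)) (G.partialLongitude k j)) := by
  induction j using Fin.induction with
  | zero => simp [partialLongitude_zero, P.act_one]
  | succ j ih =>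
    rw [h.step, ih, ← P.act_mul, Fin.val_succ, partialLongitude_succ]
    simp

/-- Converse of `eq_act`: base colours together with a homomorphism that is consistent with the
colours it produces define a colouring; only closing up along each component remains as a condition.
-/
theorem isArcColoring_of_hom (Ω : FreeGroup G.Arc →* Q) (b : Fin n → Y)
    (hb : ∀ k, P.valid k (b k))
    (hΩ : ∀ a : G.Arc, Ω (FreeGroup.of a) =
      P.overElt a.1 (P.act a.1 (b a.1) (Ω (G.partialLongitude a.1 a.2))))
    (hc : ∀ k, P.act k (b k) (Ω (G.partialLongitude k (G.m k))) = P.shift k (b k)) :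
    IsArcColoring P G fun a => P.act a.1 (b a.1) (Ω (G.partialLongitude a.1 a.2)) where
  valid a := P.valid_act _ _ _ (hb a.1)
  step k j := by
    rw [← hΩ, Fin.val_succ, partialLongitude_succ]
    simp [P.act_mul]
  closed k := by
    simp only [Fin.val_last, hc, Fin.val_zero, partialLongitude_zero, map_one, P.act_one]

end ArcData

/-! ### Filtered rings and the stability of `η_q` -/

/-- A multiplicative filtration of a ring. -/
structure IsMulFiltration {T : Type} [Ring T] (J : ℕ → AddSubgroup T) : Prop where
  mem_zero : ∀ x, x ∈ J 0
  mul_mem : ∀ {p q x y}, x ∈ J p → y ∈ J q → x * y ∈ J (p + q)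

namespace IsMulFiltration

variable {T : Type} [Ring T] {J : ℕ → AddSubgroup T}

theorem mul_mem_left (h : IsMulFiltration J) {q : ℕ} (x : T) {y : T} (hy : y ∈ J q) :
    x * y ∈ J q := by
  simpa using h.mul_mem (h.mem_zero x) hy

theorem mul_mem_right (h : IsMulFiltration J) {q : ℕ} {x : T} (y : T) (hx : x ∈ J q) :
    x * y ∈ J q := by
  simpa using h.mul_mem hx (h.mem_zero y)

theorem inv_sub_mem (h : IsMulFiltration J) {q : ℕ} {u v : Tˣ} (huv : (u : T) - v ∈ J q) :
    ((u⁻¹ : Tˣ) : T) - (v⁻¹ : Tˣ) ∈ J q := by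
  have e : ((u⁻¹ : Tˣ) : T) - (v⁻¹ : Tˣ) = -((u⁻¹ : Tˣ) * ((u : T) - v) * (v⁻¹ : Tˣ)) := by
    rw [mul_sub, sub_mul]; simp
  rw [e]
  exact neg_mem (h.mul_mem_right _ (h.mul_mem_left _ huv))

theorem mul_sub_mem (h : IsMulFiltration J) {q : ℕ} {x y x' y' : T} (hx : x - x' ∈ J q)
    (hy : y - y' ∈ J q) : x * y - x' * y' ∈ J q := by
  have e : x * y - x' * y' = (x - x') * y + x' * (y - y') := by noncomm_ring
  rw [e]
  exact add_mem (h.mul_mem_right _ hx) (h.mul_mem_left _ hy)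

/-- Conjugation gains one degree: the difference equals that of the conjugates of `b - 1`, so each
error term contains a factor in `J q` and a factor in `J 1`. -/
theorem conj_sub_mem (h : IsMulFiltration J) {q : ℕ} {u v b : Tˣ} (huv : (u : T) - v ∈ J q)
    (hb : (b : T) - 1 ∈ J 1) :
    ((u⁻¹ * b * u : Tˣ) : T) - (v⁻¹ * b * v : Tˣ) ∈ J (q + 1) := by
  have e : ((u⁻¹ * b * u : Tˣ) : T) - (v⁻¹ * b * v : Tˣ) =
      (((u⁻¹ : Tˣ) : T) - (v⁻¹ : Tˣ)) * ((b : T) - 1) * u +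
        (v⁻¹ : Tˣ) * (((b : T) - 1) * ((u : T) - v)) := by
    push_cast
    have h1 := u.inv_mul
    have h2 := v.inv_mul
    generalize ((u⁻¹ : Tˣ) : T) = u' at *
    generalize ((v⁻¹ : Tˣ) : T) = v' at *
    have : u' * b * u - v' * b * v - ((u' - v') * (b - 1) * u + v' * ((b - 1) * (u - v))) =
      u' * u - v' * v := by noncomm_ring
    rw [← sub_eq_zero, this, h1, h2, sub_self]
  rw [e]
  refine add_mem (h.mul_mem_right _ (h.mul_mem (h.inv_sub_mem huv) hb)) (h.mul_mem_left _ ?_)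
  rw [add_comm]
  exact h.mul_mem hb huv

theorem hom_sub_mem (h : IsMulFiltration J) {q : ℕ} {α : Type} {Φ Ψ : FreeGroup α →* Tˣ}
    (hΦ : ∀ a, (Φ (FreeGroup.of a) : T) - Ψ (FreeGroup.of a) ∈ J q) (x : FreeGroup α) :
    (Φ x : T) - Ψ x ∈ J q := by
  refine FreeGroup.induction_on x (by simp) hΦ (fun a ha => ?_) fun x y hx hy => ?_
  · rw [map_inv, map_inv]
    exact h.inv_sub_mem ha
  · rw [map_mul, map_mul, Units.val_mul, Units.val_mul]
    exact h.mul_sub_mem hx hy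

end IsMulFiltration

namespace ArcData

variable {n : ℕ} {T : Type} [Ring T] {J : ℕ → AddSubgroup T}

theorem eta_one_of (G : ArcData n) (a : G.Arc) : G.eta 1 (FreeGroup.of a) = FreeGroup.of a.1 := by
  simp [eta]

theorem eta_succ_of (G : ArcData n) (q : ℕ) (a : G.Arc) : G.eta (q + 2) (FreeGroup.of a) =
    (G.eta (q + 1) (G.partialLongitude a.1 a.2))⁻¹ * FreeGroup.of a.1 *
        G.eta (q + 1) (G.partialLongitude a.1 a.2) := by
  simp [eta]

theorem eta_of_base (G : ArcData n) (q : ℕ) (i : Fin n) :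
    G.eta (q + 1) (FreeGroup.of ⟨i, 0⟩) = FreeGroup.of i := by
  cases q with
  | zero => exact eta_one_of G _
  | succ q => simp [eta_succ_of, partialLongitude_zero]

/-- The relations in `hΩ` say that `Ω` is a fixed point of the recursion defining `η_q`. By
`conj_sub_mem` each iteration improves the agreement by one degree, so the fixed point is unique up
to the filtration. -/
theorem hom_sub_eta_mem (G : ArcData n) (hJ : IsMulFiltration J) (ρ : FreeGroup (Fin n) →* Tˣ)
    (hρ : ∀ k, (ρ (FreeGroup.of k) : T) - 1 ∈ J 1) (Ω : FreeGroup G.Arc →* Tˣ)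
    (hΩ : ∀ a : G.Arc, Ω (FreeGroup.of a) = (Ω (G.partialLongitude a.1 a.2))⁻¹ *
      ρ (FreeGroup.of a.1) * Ω (G.partialLongitude a.1 a.2)) (q : ℕ) (x : FreeGroup G.Arc) :
    (Ω x : T) - ρ (G.eta (q + 1) x) ∈ J (q + 1) := by
  induction q generalizing x with
  | zero =>
    refine hJ.hom_sub_mem (Φ := Ω) (Ψ := ρ.comp (G.eta 1)) (fun a => ?_) x
    have := hJ.conj_sub_mem (u := Ω (G.partialLongitude a.1 a.2)) (v := 1) (hJ.mem_zero _) (hρ a.1)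
    rw [MonoidHom.comp_apply, eta_one_of, hΩ]
    simpa using this
  | succ q ih =>
    refine hJ.hom_sub_mem (Φ := Ω) (Ψ := ρ.comp (G.eta (q + 2))) (fun a => ?_) x
    rw [MonoidHom.comp_apply, eta_succ_of, hΩ]
    simp only [map_mul, map_inv]
    exact hJ.conj_sub_mem (ih _) (hρ a.1)

/-- Same gain of a degree per iteration, applied to two consecutive iterates: the sequence `η_q`
converges. -/
theorem eta_sub_eta_mem (G : ArcData n) (hJ : IsMulFiltration J) (ρ : FreeGroup (Fin n) →* Tˣ)
    (hρ : ∀ k, (ρ (FreeGroup.of k) : T) - 1 ∈ J 1) (q : ℕ) (x : FreeGroup G.Arc) :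
    (ρ (G.eta (q + 2) x) : T) - ρ (G.eta (q + 1) x) ∈ J (q + 1) := by
  induction q generalizing x with
  | zero =>
    refine hJ.hom_sub_mem (Φ := ρ.comp (G.eta 2)) (Ψ := ρ.comp (G.eta 1)) (fun a => ?_) x
    have := hJ.conj_sub_mem (u := ρ (G.eta 1 (G.partialLongitude a.1 a.2))) (v := 1)
      (hJ.mem_zero _) (hρ a.1)
    rw [MonoidHom.comp_apply, MonoidHom.comp_apply, eta_one_of, eta_succ_of]
    simpa using this
  | succ q ih =>
    refine hJ.hom_sub_mem (Φ := ρ.comp (G.eta (q + 3))) (Ψ := ρ.comp (G.eta (q + 2)))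
      (fun a => ?_) x
    rw [MonoidHom.comp_apply, MonoidHom.comp_apply, eta_succ_of, eta_succ_of]
    simp only [map_mul, map_inv]
    exact hJ.conj_sub_mem (ih _) (hρ a.1)

end ArcData

/-! ### Truncations of the ring of series -/

namespace NCSeries

variable {ι : Type}

theorem coeff_sub (f g : NCSeries ι) (w : List ι) :
    (f - g).coeff w = f.coeff w - g.coeff w := by
  rw [sub_eq_add_neg, coeff_add, coeff_neg, sub_eq_add_neg]

theorem coeff_intCast (m : ℤ) (w : List ι) :
    (m : NCSeries ι).coeff w = if w.isEmpty then m else 0 := by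
  induction m using Int.induction_on with
  | zero => simp [coeff_zero]
  | succ k ih => push_cast at ih ⊢; rw [coeff_add, ih, coeff_one]; split <;> simp
  | pred k ih => push_cast at ih ⊢; rw [coeff_sub, ih, coeff_one]; split <;> simp

/-- The series of order at least `q`. -/
def order (ι : Type) (q : ℕ) : AddSubgroup (NCSeries ι) where
  carrier := {f | ∀ w, w.length < q → f.coeff w = 0}
  zero_mem' _ _ := rfl
  add_mem' hf hg w hw := by rw [coeff_add, hf w hw, hg w hw, add_zero]
  neg_mem' hf w hw := by rw [coeff_neg, hf w hw, neg_zero]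

theorem isMulFiltration_order : IsMulFiltration (order ι) where
  mem_zero f w hw := by simp at hw
  mul_mem {p q f g} hf hg w hw := by
    rw [coeff_mul]
    refine Finset.sum_eq_zero fun k hk => ?_
    have hk' : k ≤ w.length := by simpa [Nat.lt_succ_iff] using hk
    by_cases h : k < p
    · rw [hf _ (by simp; omega), zero_mul]
    · rw [hg _ (by simp; omega), mul_zero]

/-- Congruence modulo `d` of the coefficients of all sublists of the word `js`. -/
def wordCon (js : List ι) (d : ℤ) : RingCon (NCSeries ι) where
  r f g := ∀ w, w.Sublist js → d ∣ f.coeff w - g.coeff w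
  iseqv :=
    ⟨fun f w _ => by simp, fun h w hw => by simpa using (dvd_neg.mpr (h w hw)),
      fun h h' w hw => by simpa using dvd_add (h w hw) (h' w hw)⟩
  add' {f f' g g'} h h' w hw := by
    rw [coeff_add, coeff_add]
    have := dvd_add (h w hw) (h' w hw)
    rwa [add_sub_add_comm]
  mul' {f f' g g'} h h' w hw := by
    -- Prefixes and suffixes of a sublist of `js` are again sublists, so a product involves only
    -- coefficients controlled by the congruence.
    rw [coeff_mul, coeff_mul, ← Finset.sum_sub_distrib]
    refine Finset.dvd_sum fun k _ => ?_
    have h1 := h _ ((List.take_sublist k w).trans hw)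
    have h2 := h' _ ((List.drop_sublist k w).trans hw)
    have e : ∀ a b a' b' : ℤ, a * b - a' * b' = (a - a') * b + a' * (b - b') := by intros; ring
    rw [e]
    exact dvd_add (h1.mul_right _) (h2.mul_left _)

/-- The quotient of the ring of series by `wordCon`. -/
abbrev WordRing (js : List ι) (d : ℤ) : Type := (wordCon js d).Quotient

/-- The projection to the quotient. -/
def toWord (js : List ι) (d : ℤ) : NCSeries ι →+* WordRing js d := (wordCon js d).mk'

theorem toWord_eq_iff {js : List ι} {d : ℤ} {f g : NCSeries ι} :
    toWord js d f = toWord js d g ↔ ∀ w, w.Sublist js → d ∣ f.coeff w - g.coeff w :=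
  (wordCon js d).eq

theorem toWord_eq_zero_iff {js : List ι} {d : ℤ} {f : NCSeries ι} :
    toWord js d f = 0 ↔ ∀ w, w.Sublist js → d ∣ f.coeff w := by
  rw [← map_zero (toWord js d), toWord_eq_iff]
  simp [coeff_zero]

theorem toWord_surjective (js : List ι) (d : ℤ) : Function.Surjective (toWord js d) :=
  (wordCon js d).mk'_surjective

/-- The induced filtration. -/
def wordOrder (js : List ι) (d : ℤ) (q : ℕ) : AddSubgroup (WordRing js d) :=
  (order ι q).map (toWord js d).toAddMonoidHom

theorem toWord_mem_wordOrder {js : List ι} {d : ℤ} {q : ℕ} {f : NCSeries ι} (hf : f ∈ order ι q) :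
    toWord js d f ∈ wordOrder js d q := ⟨f, hf, rfl⟩

theorem isMulFiltration_wordOrder (js : List ι) (d : ℤ) : IsMulFiltration (wordOrder js d) where
  mem_zero x := by
    obtain ⟨f, rfl⟩ := toWord_surjective js d x
    exact toWord_mem_wordOrder (isMulFiltration_order.mem_zero f)
  mul_mem := by
    rintro p q _ _ ⟨f, hf, rfl⟩ ⟨g, hg, rfl⟩
    exact ⟨f * g, isMulFiltration_order.mul_mem hf hg, map_mul (toWord js d) f g⟩

/-- Nilpotency: no sublist of `js` is longer than `js`, so terms of higher order vanish and
approximations in the filtration become equalities. -/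
theorem eq_zero_of_mem_wordOrder {js : List ι} {d : ℤ} {q : ℕ} (hq : js.length < q)
    {x : WordRing js d} (hx : x ∈ wordOrder js d q) : x = 0 := by
  obtain ⟨f, hf, rfl⟩ := hx
  refine toWord_eq_zero_iff.mpr fun w hw => ?_
  rw [hf w (hw.length_le.trans_lt hq)]
  exact dvd_zero d

/-! ### Substitution -/

/-- Substitution of the elements `N j` for the variables `X j`, in a ring in which the products of
these elements vanish along all words that are not sublists of `js`. -/
def subst {T : Type} [Ring T] (N : ι → T) : List ι → NCSeries ι → T
  | [], f => (f.coeff [] : T)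
  | j :: js, f => subst N js f + N j * subst N js (NCSeries.shift j f)

variable {T : Type} [Ring T] {N : ι → T}

theorem subst_add (js : List ι) (f g : NCSeries ι) :
    subst N js (f + g) = subst N js f + subst N js g := by
  induction js generalizing f g with
  | nil => simp [subst, coeff_add]
  | cons j js ih =>
    have : NCSeries.shift j (f + g) = NCSeries.shift j f + NCSeries.shift j g := rfl
    rw [subst, this, ih, ih, subst, subst, mul_add]
    abel

theorem subst_zero (js : List ι) : subst N js 0 = 0 := by
  have := subst_add (N := N) js 0 0
  simpa using this

theorem subst_intMul (js : List ι) (m : ℤ) (f : NCSeries ι) :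
    subst N js (⟨fun w => m * f.coeff w⟩ : NCSeries ι) = m * subst N js f := by
  induction js generalizing f with
  | nil => simp [subst]
  | cons j js ih =>
    rw [subst, subst, ih, mul_add]
    congr 1
    have := ih (NCSeries.shift j f)
    rw [show NCSeries.shift j (⟨fun w => m * f.coeff w⟩ : NCSeries ι) =
      ⟨fun w => m * (NCSeries.shift j f).coeff w⟩ from rfl, this, ← mul_assoc, ← mul_assoc,
      (Int.cast_commute m (N j)).eq]

theorem subst_one (js : List ι) : subst N js 1 = 1 := by
  induction js with
  | nil => simp [subst, coeff_one]
  | cons j js ih =>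
    have : NCSeries.shift j (1 : NCSeries ι) = 0 := by
      ext w; simp [NCSeries.shift, coeff_one, coeff_zero]
    rw [subst, this, ih, subst_zero, mul_zero, add_zero]

/-- Every nonempty word occurring in `subst N js f` ends in a factor `N k` that kills `y`; only the
constant term survives. -/
theorem subst_mul_right {js : List ι} {y : T} (h : ∀ k ∈ js, N k * y = 0) (f : NCSeries ι) :
    subst N js f * y = f.coeff [] * y := by
  induction js generalizing f with
  | nil => rfl
  | cons j js ih =>
    have ih' := ih fun k hk => h k (List.mem_cons_of_mem _ hk)
    rw [subst, add_mul, ih', mul_assoc, ih', ← mul_assoc, (Int.cast_commute _ (N j)).eq.symm,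
      mul_assoc, h j List.mem_cons_self, mul_zero, add_zero]

/-- For sublists `v` and `w` of `js`, the product of the monomials `N_v` and `N_w` vanishes unless
the last letter of `v` precedes the first letter of `w` in `js`, that is, unless `v ++ w` is again a
sublist. Hence truncating to sublists is compatible with products. -/
theorem subst_mul {js : List ι} (h1 : js.Pairwise fun a b => N b * N a = 0)
    (h2 : ∀ a ∈ js, N a * N a = 0) (f g : NCSeries ι) :
    subst N js (f * g) = subst N js f * subst N js g := by
  induction js generalizing f g with
  | nil => simp [subst, coeff_mul_nil]
  | cons j js ih =>
    rw [List.pairwise_cons] at h1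
    have ih' := ih h1.2 fun a ha => h2 a (List.mem_cons_of_mem _ ha)
    have e : NCSeries.shift j (f * g) =
        (⟨fun w => f.coeff [] * (NCSeries.shift j g).coeff w⟩ : NCSeries ι) +
          NCSeries.shift j f * g := by
      ext w
      exact coeff_mul_cons f g j w
    have r := fun f => subst_mul_right (js := js) (y := N j) h1.1 f
    have c : ∀ x : T, N j * (f.coeff [] * x) = f.coeff [] * (N j * x) := fun x => by
      rw [← mul_assoc, ← (Int.cast_commute _ (N j)).eq, mul_assoc]
    -- Between the two factors `N j` only a constant survives, by `subst_mul_right`, and then `N j *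
    -- N j = 0` applies.
    have z : N j * subst N js (NCSeries.shift j f) * (N j * subst N js (NCSeries.shift j g)) = 0 := by
      rw [mul_assoc, ← mul_assoc _ (N j), r, mul_assoc, ← mul_assoc (N j),
        ← (Int.cast_commute _ (N j)).eq, mul_assoc, ← mul_assoc (N j) (N j),
        h2 j List.mem_cons_self, zero_mul, mul_zero]
    simp only [subst]
    rw [e, subst_add, subst_intMul, ih', ih', mul_add, add_mul, mul_add, mul_add, z, c,
      ← mul_assoc (subst N js f) (N j), r, mul_assoc, mul_assoc, add_zero, add_assoc]

/-- Only coefficients at sublists of `js` enter `subst`, so substitution respects the truncation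
whenever `d` vanishes in the target. -/
theorem subst_eq_zero {d : ℤ} (hd : (d : T) = 0) {js : List ι} {f : NCSeries ι}
    (h : ∀ w, w.Sublist js → d ∣ f.coeff w) : subst N js f = 0 := by
  induction js generalizing f with
  | nil =>
    obtain ⟨c, hc⟩ := h [] (List.Sublist.refl _)
    rw [subst, hc, Int.cast_mul, hd, zero_mul]
  | cons j js ih =>
    rw [subst, ih fun w hw => h w (hw.cons j), ih fun w hw => h (j :: w) (hw.cons_cons j), mul_zero,
      add_zero]

/-- Substitution as a ring homomorphism. -/
def substHom (N : ι → T) (js : List ι) (h1 : js.Pairwise fun a b => N b * N a = 0)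
    (h2 : ∀ a ∈ js, N a * N a = 0) : NCSeries ι →+* T where
  toFun := subst N js
  map_one' := subst_one js
  map_mul' := subst_mul h1 h2
  map_zero' := subst_zero js
  map_add' := subst_add js

variable [DecidableEq ι]

theorem X_coeff (i : ι) (w : List ι) : (X i).coeff w = if w = [i] then 1 else 0 := rfl

theorem X_mem_order (i : ι) : X i ∈ order ι 1 := by
  intro w hw
  have : w = [] := by simpa using hw
  simp [X_coeff, this]

theorem coeff_X_mul_nil (i : ι) (f : NCSeries ι) : (X i * f).coeff [] = 0 := by
  simp [coeff_mul_nil, X_coeff]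

theorem shift_X (x i : ι) : shift x (X i) = if x = i then 1 else 0 := by
  ext w
  by_cases hx : x = i
  · subst hx; cases w <;> simp [shift, X_coeff, coeff_one]
  · simp [shift, X_coeff, hx, coeff_zero]

theorem coeff_X_mul_cons (i x : ι) (f : NCSeries ι) (w : List ι) :
    (X i * f).coeff (x :: w) = if x = i then f.coeff w else 0 := by
  rw [coeff_mul_cons, shift_X]
  by_cases hx : x = i <;> simp [hx, X_coeff, coeff_zero]

theorem coeff_mul_X_nil (i : ι) (f : NCSeries ι) : (f * X i).coeff [] = 0 := by
  simp [coeff_mul_nil, X_coeff]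

theorem coeff_mul_X_append (i x : ι) (f : NCSeries ι) (w : List ι) :
    (f * X i).coeff (w ++ [x]) = if x = i then f.coeff w else 0 := by
  induction w generalizing f with
  | nil =>
    rw [List.nil_append, coeff_mul_cons, coeff_mul_nil]
    by_cases hx : x = i <;> simp [X_coeff, hx]
  | cons y w ih =>
    rw [List.cons_append, coeff_mul_cons, ih]
    simp [X_coeff, shift]

/-- The monomial of a word. -/
def mono (w : List ι) : NCSeries ι := ⟨fun v => if v = w then 1 else 0⟩

theorem mono_coeff (w v : List ι) : (mono w).coeff v = if v = w then 1 else 0 := rfl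

theorem mono_nil : mono ([] : List ι) = 1 := by
  ext v; simp [mono_coeff, coeff_one]

theorem mono_cons (x : ι) (w : List ι) : mono (x :: w) = X x * mono w := by
  ext v
  cases v with
  | nil => simp [mono_coeff, coeff_X_mul_nil]
  | cons y v =>
    rw [coeff_X_mul_cons]
    by_cases h : y = x <;> simp [mono_coeff, h]

theorem mono_mem_order (w : List ι) : mono w ∈ order ι w.length := by
  intro v hv
  rw [mono_coeff, if_neg]
  rintro rfl
  exact lt_irrefl _ hv

/-- Up to terms that vanish in the quotient, the top monomial is central. -/
theorem toWord_mul_mono (js : List ι) (d : ℤ) (f : NCSeries ι) :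
    toWord js d (f * mono js) = toWord js d (mono js * f) := by
  have h1 : toWord js d (f * mono js) = toWord js d ((f.coeff [] : ℤ) * mono js) := by
    rw [← sub_eq_zero, ← map_sub, ← sub_mul]
    refine eq_zero_of_mem_wordOrder (q := 1 + js.length) (by omega)
      (toWord_mem_wordOrder (isMulFiltration_order.mul_mem ?_ (mono_mem_order js)))
    intro w hw
    have : w = [] := by simpa using hw
    simp [coeff_sub, coeff_intCast, this]
  have h2 : toWord js d (mono js * f) = toWord js d (mono js * (f.coeff [] : ℤ)) := by
    rw [← sub_eq_zero, ← map_sub, ← mul_sub]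
    refine eq_zero_of_mem_wordOrder (q := js.length + 1) (by omega)
      (toWord_mem_wordOrder (isMulFiltration_order.mul_mem (mono_mem_order js) ?_))
    intro w hw
    have : w = [] := by simpa using hw
    simp [coeff_sub, coeff_intCast, this]
  rw [h1, h2, (Int.cast_commute _ _).eq]

theorem toWord_mono_mul_mono {js : List ι} (hjs : js ≠ []) (d : ℤ) :
    toWord js d (mono js) * toWord js d (mono js) = 0 := by
  rw [← map_mul]
  refine eq_zero_of_mem_wordOrder (q := js.length + js.length) ?_
    (toWord_mem_wordOrder (isMulFiltration_order.mul_mem (mono_mem_order js) (mono_mem_order js)))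
  have := List.length_pos_iff.mpr hjs
  omega

/-- A word with nonzero coefficient in `X k * f * X l` begins with `k` and ends with a further
letter `l`, so it contains `[k, l]` as a sublist. -/
theorem toWord_X_mul_X {js : List ι} {d : ℤ} {k l : ι} (h : ¬ [k, l].Sublist js)
    (f : NCSeries ι) : toWord js d (X k * f * X l) = 0 := by
  refine toWord_eq_zero_iff.mpr fun w hw => ?_
  rcases List.eq_nil_or_concat w with rfl | ⟨v, x, rfl⟩
  · simp [coeff_mul_X_nil]
  rw [List.concat_eq_append, coeff_mul_X_append]
  split_ifs with hx
  · subst hx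
    cases v with
    | nil => simp [coeff_X_mul_nil]
    | cons y v =>
      rw [coeff_X_mul_cons]
      split_ifs with hy
      · subst hy
        exfalso
        apply h
        refine List.Sublist.trans ?_ hw
        simp
      · exact dvd_zero d
  · exact dvd_zero d

theorem toWord_X_eq_zero {js : List ι} {d : ℤ} {k : ι} (h : k ∉ js) :
    toWord js d (X k) = 0 := by
  refine toWord_eq_zero_iff.mpr fun w hw => ?_
  rw [X_coeff, if_neg]
  · exact dvd_zero d
  · rintro rfl
    exact h (List.singleton_sublist.mp hw)

theorem subst_X_of_notMem {js : List ι} {i : ι} (h : i ∉ js) : subst N js (X i) = 0 := by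
  induction js with
  | nil => simp [subst, X_coeff]
  | cons j js ih =>
    rw [List.mem_cons, not_or] at h
    rw [subst, ih h.2, shift_X, if_neg (Ne.symm h.1), subst_zero, mul_zero, add_zero]

theorem subst_X {js : List ι} (hjs : js.Nodup) {i : ι} (h : i ∈ js) : subst N js (X i) = N i := by
  induction js with
  | nil => simp at h
  | cons j js ih =>
    rw [List.nodup_cons] at hjs
    rw [subst, shift_X]
    by_cases hj : j = i
    · subst hj
      rw [if_pos rfl, subst_one, mul_one, subst_X_of_notMem hjs.1, zero_add]
    · have : i ∈ js := by
        rcases List.mem_cons.mp h with rfl | h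
        · exact absurd rfl hj
        · exact h
      rw [if_neg hj, subst_zero, mul_zero, add_zero, ih hjs.2 this]

end NCSeries

/-! ### Cyclic permutations of subsequences -/

theorem mem_properCyclic {n : ℕ} {I J : List (Fin n)} : J ∈ properCyclic I ↔
    ∃ K, K.Sublist I ∧ 2 ≤ K.length ∧ K.length < I.length ∧ J ~r K := by
  simp only [properCyclic, List.mem_toFinset, List.mem_flatMap, List.mem_filter, List.mem_sublists,
    List.mem_cyclicPermutations_iff, decide_eq_true_eq, and_assoc]

/-- Cut the sublist where the rotation cuts the list and exchange the two pieces. -/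
theorem sublist_of_isRotated {α : Type} {K' J K : List α} (h : K'.Sublist J) (hJ : J ~r K) :
    ∃ K'', K''.Sublist K ∧ K' ~r K'' := by
  obtain ⟨m, hm, rfl⟩ := List.isRotated_iff_mod.mp hJ.symm
  rw [List.rotate_eq_drop_append_take hm] at h
  obtain ⟨b, a, rfl, hb, ha⟩ := List.sublist_append_iff.mp h
  refine ⟨a ++ b, ?_, List.isRotated_append⟩
  have := ha.append hb
  rwa [List.take_append_drop] at this

/-- Consequently a divisor of the indeterminacy of `I` also divides that of every `J` entering it,
which drives the induction on length. -/
theorem properCyclic_trans {n : ℕ} {I J J' : List (Fin n)} (hJ : J ∈ properCyclic I)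
    (hJ' : J' ∈ properCyclic J) : J' ∈ properCyclic I := by
  rw [mem_properCyclic] at *
  obtain ⟨K, hK, h2, h3, hr⟩ := hJ
  obtain ⟨K', hK', h2', h3', hr'⟩ := hJ'
  obtain ⟨K'', hs, hr''⟩ := sublist_of_isRotated hK' hr
  have e1 := hr''.perm.length_eq
  have e2 := hr.perm.length_eq
  exact ⟨K'', hs.trans hK, by omega, by omega, hr'.trans hr''⟩

/-! ### Milnor numbers as stable Magnus coefficients -/

namespace ArcData

variable {n : ℕ}

open NCSeries

theorem magnus_of (k : Fin n) : (magnus (FreeGroup.of k)).val = 1 + X k := by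
  simp [magnus, unitX]

theorem magnus_coeff_nil (x : FreeGroup (Fin n)) : (magnus x).val.coeff [] = 1 := by
  have := isMulFiltration_order.hom_sub_mem (q := 1) (Φ := magnus) (Ψ := 1) (fun a : Fin n => by
    rw [magnus_of]; simpa using X_mem_order a) x [] (by simp)
  simpa [coeff_sub, coeff_one, sub_eq_zero] using this

/-- Passing from `η_q` to `η_(q+1)` changes only terms of degree at least `q`, so a coefficient of
degree `s` is settled once `q > s`. -/
theorem magnus_eta_coeff (G : ArcData n) (x : FreeGroup G.Arc) {w : List (Fin n)} {q : ℕ}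
    (hq : w.length < q) : (magnus (G.eta q x)).val.coeff w =
      (magnus (G.eta (w.length + 1) x)).val.coeff w := by
  induction q, hq using Nat.le_induction with
  | base => rfl
  | succ q hq ih =>
    obtain ⟨q, rfl⟩ : ∃ r, q = r + 1 := ⟨q - 1, by omega⟩
    rw [← ih, ← sub_eq_zero, ← coeff_sub]
    exact G.eta_sub_eta_mem isMulFiltration_order magnus
      (fun k => by rw [magnus_of]; simpa using X_mem_order k) q x w (by omega)

theorem milnorNumber_append (G : ArcData n) (w : List (Fin n)) (i : Fin n) {q : ℕ}
    (hq : w.length < q) :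
    (magnus (G.eta q (G.longitude i))).val.coeff w = G.milnorNumber (w ++ [i]) := by
  rw [magnus_eta_coeff G _ hq]
  simp [milnorNumber, milnorNumberAt]

end ArcData

/-! ### The palette attached to a Milnor number -/

section Palette

open NCSeries

variable {n : ℕ}

/-- The homomorphism from the free group to the units of the truncated ring. -/
def wordHom (js : List (Fin n)) (d : ℤ) : FreeGroup (Fin n) →* (WordRing js d)ˣ :=
  (Units.map (toWord js d).toMonoidHom).comp magnus

theorem wordHom_val (js : List (Fin n)) (d : ℤ) (x : FreeGroup (Fin n)) :
    (wordHom js d x).val = toWord js d (magnus x).val := rfl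

theorem wordHom_of (js : List (Fin n)) (d : ℤ) (k : Fin n) :
    (wordHom js d (FreeGroup.of k)).val = 1 + toWord js d (X k) := by
  rw [wordHom_val, ArcData.magnus_of, map_add, map_one]

theorem conj_wordHom_of {js : List (Fin n)} {d : ℤ} (k : Fin n) (u : (WordRing js d)ˣ) :
    (u⁻¹ * wordHom js d (FreeGroup.of k) * u).val =
      1 + (u⁻¹).val * toWord js d (X k) * u.val := by
  rw [Units.val_mul, Units.val_mul, wordHom_of, mul_add, add_mul, mul_one, Units.inv_mul]

theorem wordHom_of_eq_one {js : List (Fin n)} {d : ℤ} {k : Fin n} (h : k ∉ js) :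
    wordHom js d (FreeGroup.of k) = 1 := by
  ext
  rw [wordHom_of, toWord_X_eq_zero h, add_zero, Units.val_one]

theorem toWord_X_mul_mul_X {js : List (Fin n)} {d : ℤ} {k l : Fin n} (h : ¬ [k, l].Sublist js)
    (t : WordRing js d) : toWord js d (X k) * t * toWord js d (X l) = 0 := by
  obtain ⟨f, rfl⟩ := toWord_surjective js d t
  rw [← map_mul, ← map_mul, toWord_X_mul_X h]

/-- The units between the two variables are absorbed into the arbitrary factor of
`toWord_X_mul_mul_X`. -/
theorem conj_X_mul_conj_X {js : List (Fin n)} {d : ℤ} {k l : Fin n} (h : ¬ [k, l].Sublist js)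
    (u v : (WordRing js d)ˣ) : (u⁻¹).val * toWord js d (X k) * u.val *
      ((v⁻¹).val * toWord js d (X l) * v.val) = 0 := by
  have := toWord_X_mul_mul_X h (u.val * (v⁻¹).val)
  calc _ = (u⁻¹).val * (toWord js d (X k) * (u.val * (v⁻¹).val) * toWord js d (X l)) * v.val := by
        noncomm_ring
    _ = 0 := by rw [this, mul_zero, zero_mul]

/-- The relation of Milnor's reduced free group. Without repeated letters in `js`, the two
conjugates of `X k` have product zero in either order, and only symmetric terms are left. -/
theorem commute_conj_wordHom_of {js : List (Fin n)} (hjs : js.Nodup) {d : ℤ} (k : Fin n)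
    (u v : (WordRing js d)ˣ) : Commute (u⁻¹ * wordHom js d (FreeGroup.of k) * u)
      (v⁻¹ * wordHom js d (FreeGroup.of k) * v) := by
  have h : ¬ [k, k].Sublist js := fun h => by simpa using hjs.sublist h
  rw [commute_iff_eq]
  ext
  rw [Units.val_mul (u⁻¹ * _ * u), Units.val_mul (v⁻¹ * _ * v), conj_wordHom_of, conj_wordHom_of]
  have h1 := conj_X_mul_conj_X (d := d) h u v
  have h2 := conj_X_mul_conj_X (d := d) h v u
  rw [mul_add, add_mul, add_mul, mul_add, add_mul, add_mul, h1, h2]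
  simp only [mul_one, one_mul, add_zero]
  abel

theorem intCast_mul_toWord_mono_mul_self {js : List (Fin n)} (hjs : js ≠ []) (d m : ℤ) :
    ((m : WordRing js d) * toWord js d (mono js)) * (m * toWord js d (mono js)) = 0 := by
  rw [((Int.cast_commute m (toWord js d (mono js))).symm).mul_mul_mul_comm,
    toWord_mono_mul_mono hjs, mul_zero]

/-- The unit `1 + m X_js` of the truncated ring. -/
def topUnit {js : List (Fin n)} (hjs : js ≠ []) (d m : ℤ) : (WordRing js d)ˣ where
  val := 1 + m * toWord js d (mono js)
  inv := 1 - m * toWord js d (mono js)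
  val_inv := by
    have h := intCast_mul_toWord_mono_mul_self hjs d m
    rw [add_mul, mul_sub, mul_sub, h]; simp
  inv_val := by
    have h := intCast_mul_toWord_mono_mul_self hjs d m
    rw [sub_mul, mul_add, mul_add, h]; simp

/-- Centrality makes left multiplication by this unit a legitimate `shift`, and lets the holonomy
around component `i` be read off independently of its initial colour. -/
theorem commute_topUnit {js : List (Fin n)} (hjs : js ≠ []) (d m : ℤ) (g : (WordRing js d)ˣ) :
    Commute (topUnit hjs d m) g := by
  rw [commute_iff_eq]
  ext
  obtain ⟨f, hf⟩ := toWord_surjective js d g.val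
  have := toWord_mul_mono js d f
  rw [map_mul, map_mul] at this
  simp only [Units.val_mul, topUnit, ← hf, mul_add, add_mul, one_mul, mul_one]
  rw [mul_assoc, ← this, ← mul_assoc, (Int.cast_commute m _).eq, mul_assoc]

/-- The palette that detects the Milnor number `μ(js i)`: the component `i` is coloured by the
holonomy along it, the components in `js` by conjugates of the images of their generators. -/
def milnorPalette {js : List (Fin n)} (hjs : js.Nodup) (i : Fin n) (d : ℤ)
    (z : (WordRing js d)ˣ) : Palette n (WordRing js d)ˣ (WordRing js d)ˣ where
  act k y g := if k = i then y * g else g⁻¹ * y * g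
  act_one k y := by simp
  act_mul k y g h := by split_ifs <;> simp [mul_assoc]
  -- In the applications `i` is not in `js`, so the meridian of component `i` is trivial in the
  -- truncated ring and its colours are free to record holonomy.
  overElt k y := if k = i then 1 else y
  overElt_act k y g := by split_ifs <;> simp
  shift k := if k = i then Equiv.mulLeft z else 1
  shift_act k y g := by split_ifs <;> simp [mul_assoc]
  overElt_shift k y := by split_ifs <;> simp
  valid k y := k ≠ i → ∃ u, y = u⁻¹ * wordHom js d (FreeGroup.of k) * u
  valid_act k y g h hk := by
    obtain ⟨u, rfl⟩ := h hk
    exact ⟨u * g, by simp [hk, mul_assoc]⟩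
  valid_shift k y := by
    by_cases hk : k = i <;> simp [hk]
  act_self k y y' h h' := by
    by_cases hk : k = i
    · simp [hk]
    · obtain ⟨u, rfl⟩ := h hk
      obtain ⟨v, rfl⟩ := h' hk
      rw [if_neg hk, if_neg hk, mul_assoc, (commute_conj_wordHom_of hjs k u v).eq,
        inv_mul_cancel_left]

theorem wordHom_sub_one_mem (js : List (Fin n)) (d : ℤ) (k : Fin n) :
    (wordHom js d (FreeGroup.of k)).val - 1 ∈ wordOrder js d 1 := by
  rw [wordHom_of, add_sub_cancel_left]
  exact toWord_mem_wordOrder (X_mem_order k)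

end Palette

/-! ### Existence and rigidity of colourings by the Milnor palette -/

namespace ArcData

open NCSeries

variable {n : ℕ}

theorem eta_longitude (G : ArcData n) (q : ℕ) (k : Fin n) : G.eta (q + 1) (G.longitude k) =
    FreeGroup.of k ^ (-G.selfWrithe k) * G.eta (q + 1) (G.partialLongitude k (G.m k)) := by
  rw [longitude, map_mul, map_zpow, eta_of_base]

/-- In the nilpotent quotient `η_q` is stationary from `q = |js| + 1` on, so its defining recursion
becomes an exact crossing relation. -/
theorem wordHom_eta_succ (G : ArcData n) (js : List (Fin n)) (d : ℤ) (x : FreeGroup G.Arc) :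
    wordHom js d (G.eta (js.length + 2) x) = wordHom js d (G.eta (js.length + 1) x) := by
  ext
  rw [← sub_eq_zero]
  exact eq_zero_of_mem_wordOrder (Nat.lt_succ_self _)
    (G.eta_sub_eta_mem (isMulFiltration_wordOrder js d) _ (wordHom_sub_one_mem js d) _ x)

variable {js : List (Fin n)} {i : Fin n} {d : ℤ} {G : ArcData n}

theorem dvd_coeff_longitude_self
    (hd : ∀ J ∈ properCyclic (js ++ [i]), d ∣ G.milnorNumber J) {w : List (Fin n)}
    (hw : w.Sublist js) (h0 : w ≠ []) (h1 : w ≠ js) :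
    d ∣ (magnus (G.eta (js.length + 1) (G.longitude i))).val.coeff w := by
  rw [milnorNumber_append _ _ _ (Nat.lt_succ_of_le hw.length_le)]
  refine hd _ (mem_properCyclic.mpr ⟨_, hw.append (List.Sublist.refl _), ?_, ?_, .refl _⟩)
  · have := List.length_pos_iff.mpr h0
    simp; omega
  · have := lt_of_le_of_ne hw.length_le fun h => h1 (hw.eq_of_length h)
    simp [this]

/-- The word omits the index `i`, so even `K = js` counts as a proper subsequence of `js ++ [i]`;
the rotation is permitted by the cyclic permutations in the indeterminacy. -/
theorem dvd_coeff_longitude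
    (hd : ∀ J ∈ properCyclic (js ++ [i]), d ∣ G.milnorNumber J) {k : Fin n} {w K : List (Fin n)}
    (hK : K.Sublist js) (hr : w ++ [k] ~r K) (h0 : w ≠ []) :
    d ∣ (magnus (G.eta (js.length + 1) (G.longitude k))).val.coeff w := by
  have e := hr.perm.length_eq
  have e' := hK.length_le
  have := List.length_pos_iff.mpr h0
  simp only [List.length_append, List.length_singleton] at e
  rw [milnorNumber_append _ _ _ (by omega)]
  refine hd _ (mem_properCyclic.mpr ⟨K, hK.trans (List.sublist_append_left _ _), ?_, ?_, hr⟩)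
  · omega
  · simp; omega

/-- The coefficient of the left side at `v k`, and of the right side at `k v`, is the Milnor number
`μ(v k)`. As `k v` is a rotation of `v k`, both are divisible by `d` when the respective word is a
sublist of `js`. The only exception is the word `k`, where both coefficients are the constant term
of the longitude. -/
theorem toWord_longitude_mul_X
    (hd : ∀ J ∈ properCyclic (js ++ [i]), d ∣ G.milnorNumber J) (k : Fin n) :
    toWord js d ((magnus (G.eta (js.length + 1) (G.longitude k))).val * X k) =
      toWord js d (X k * (magnus (G.eta (js.length + 1) (G.longitude k))).val) := by
  refine toWord_eq_iff.mpr fun w hw => ?_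
  by_cases hwk : w = [k]
  · subst hwk
    have := coeff_mul_X_append k k (magnus (G.eta (js.length + 1) (G.longitude k))).val []
    rw [List.nil_append, if_pos rfl] at this
    rw [this, coeff_X_mul_cons, if_pos rfl, sub_self]
    exact dvd_zero d
  refine dvd_sub ?_ ?_
  · rcases List.eq_nil_or_concat w with rfl | ⟨v, x, rfl⟩
    · rw [coeff_mul_X_nil]; exact dvd_zero d
    rw [List.concat_eq_append] at *
    rw [coeff_mul_X_append]
    split_ifs with hx
    · subst hx
      exact dvd_coeff_longitude hd hw (.refl _) fun h => hwk (by simp [h])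
    · exact dvd_zero d
  · cases w with
    | nil => rw [coeff_X_mul_nil]; exact dvd_zero d
    | cons x v =>
      rw [coeff_X_mul_cons]
      split_ifs with hx
      · subst hx
        exact dvd_coeff_longitude hd hw (List.isRotated_append (l := v) (l' := [x]))
          fun h => hwk (by simp [h])
      · exact dvd_zero d

/-- The framing correction is a power of the meridian itself, so it can be removed from the
longitude without affecting commutation. -/
theorem commute_wordHom_partialLongitude
    (hd : ∀ J ∈ properCyclic (js ++ [i]), d ∣ G.milnorNumber J) (k : Fin n) :
    Commute (wordHom js d (FreeGroup.of k))
      (wordHom js d (G.eta (js.length + 1) (G.partialLongitude k (G.m k)))) := by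
  have h : Commute (wordHom js d (FreeGroup.of k))
      (wordHom js d (G.eta (js.length + 1) (G.longitude k))) := by
    rw [commute_iff_eq]
    ext
    rw [Units.val_mul, Units.val_mul, wordHom_of, wordHom_val, add_mul, mul_add, one_mul, mul_one,
      ← map_mul, ← map_mul, toWord_longitude_mul_X hd]
  rw [eta_longitude, map_mul, map_zpow] at h
  have h' := (Commute.refl (wordHom js d (FreeGroup.of k))).zpow_right (G.selfWrithe k) |>.mul_right h
  rwa [← mul_assoc, ← zpow_add, add_neg_cancel, zpow_zero, one_mul] at h'

/-- Constant term `1` and divisible intermediate coefficients leave only the top one: in the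
truncated ring `f` equals `1 + m X_js`. -/
theorem toWord_of_dvd {m : ℤ} (hjs : js ≠ []) {f : NCSeries (Fin n)} (h0 : f.coeff [] = 1)
    (hf : ∀ w, w.Sublist js → w ≠ [] → w ≠ js → d ∣ f.coeff w) (hm : d ∣ f.coeff js - m) :
    ∀ w, w.Sublist js → d ∣ (f - (1 + (m : NCSeries (Fin n)) * mono js)).coeff w := by
  intro w hw
  have e : ((m : NCSeries (Fin n)) * mono js).coeff w = if w = js then m else 0 := by
    cases w with
    | nil => simp [coeff_mul_nil, coeff_intCast, mono_coeff]
    | cons x w =>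
      have : NCSeries.shift x (m : NCSeries (Fin n)) = 0 := by
        ext v; simp [NCSeries.shift, coeff_intCast, coeff_zero]
      rw [coeff_mul_cons, this, zero_mul, coeff_zero, coeff_intCast]
      simp [mono_coeff]
  rw [coeff_sub, coeff_add, e, coeff_one]
  by_cases hw0 : w = []
  · subst hw0
    simp [h0, hjs.symm]
  by_cases hw1 : w = js
  · subst hw1
    simpa [hw0] using hm
  · simpa [hw0, hw1] using hf w hw hw0 hw1

/-- If the lower Milnor numbers vanish modulo `d`, the Magnus expansion defines a colouring. -/
theorem exists_isArcColoring (hn : (js ++ [i]).Nodup) (hjs : js ≠ [])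
    (hd : ∀ J ∈ properCyclic (js ++ [i]), d ∣ G.milnorNumber J) :
    ∃ C, IsArcColoring (milnorPalette (List.nodup_append.mp hn).1 i d
      (topUnit hjs d (G.milnorNumber (js ++ [i])))) G C := by
  have hi : i ∉ js := fun h => by
    have := (List.nodup_append.mp hn).2.2 i h i (by simp)
    exact this rfl
  -- Standard base colours: trivial holonomy on component `i`, the meridian itself on the others.
  -- The level `|js| + 1` is the first at which `η_q` is stable in the truncated ring.
  refine ⟨_, isArcColoring_of_hom ((wordHom js d).comp (G.eta (js.length + 1)))
    (fun k => if k = i then 1 else wordHom js d (FreeGroup.of k)) ?_ ?_ ?_⟩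
  · intro k hk
    exact ⟨1, by simp [hk]⟩
  · intro a
    have e : wordHom js d (G.eta (js.length + 1) (FreeGroup.of a)) =
        (wordHom js d (G.eta (js.length + 1) (G.partialLongitude a.1 a.2)))⁻¹ *
        wordHom js d (FreeGroup.of a.1) *
        wordHom js d (G.eta (js.length + 1) (G.partialLongitude a.1 a.2)) := by
      rw [← wordHom_eta_succ, eta_succ_of]
      simp
    simp only [MonoidHom.comp_apply]
    rw [e]
    by_cases ha : a.1 = i
    · simp [milnorPalette, ha, wordHom_of_eq_one hi]
    · simp [milnorPalette, ha]
  · intro k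
    simp only [MonoidHom.comp_apply]
    -- Closing up: on component `i` the framing factor is trivial and the longitude equals the
    -- prescribed unit; on the others the base meridian commutes with the longitude.
    by_cases hk : k = i
    · subst hk
      simp only [milnorPalette, if_true, one_mul, Equiv.coe_mulLeft, mul_one]
      have e := eta_longitude G js.length k
      apply_fun wordHom js d at e
      rw [map_mul, map_zpow, wordHom_of_eq_one hi, one_zpow, one_mul] at e
      rw [← e]
      ext
      rw [wordHom_val, ← sub_eq_zero]
      have := toWord_eq_zero_iff.mpr (toWord_of_dvd (d := d) hjs (magnus_coeff_nil _)
        (fun w => dvd_coeff_longitude_self hd) (m := G.milnorNumber (js ++ [k])) (by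
          rw [milnorNumber_append _ _ _ (Nat.lt_succ_self _), sub_self]; exact dvd_zero d))
      rw [map_sub, map_add, map_one, map_mul, map_intCast] at this
      exact this
    · simp only [milnorPalette, if_neg hk, Equiv.Perm.coe_one, id_eq]
      rw [mul_assoc, (commute_wordHom_partialLongitude hd k).eq, inv_mul_cancel_left]

/-- Conjugating a variable changes it only in degree at least 2, so replacing all letters of a
monomial by conjugates changes it only above its own degree. In particular the top monomial is
fixed. -/
theorem subst_mono_sub_mem (u : Fin n → (WordRing js d)ˣ)
    (φ : NCSeries (Fin n) →+* WordRing js d)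
    (hφ : ∀ k, φ (X k) = (u k)⁻¹.val * toWord js d (X k) * (u k).val) (w : List (Fin n)) :
    φ (mono w) - toWord js d (mono w) ∈ wordOrder js d (w.length + 1) := by
  have hJ := isMulFiltration_wordOrder js d
  have hX : ∀ k, φ (X k) - toWord js d (X k) ∈ wordOrder js d 2 := by
    intro k
    obtain ⟨f, hf⟩ := toWord_surjective js d (u k).val
    have h1 : (u k).val - (f.coeff [] : ℤ) ∈ wordOrder js d 1 := by
      rw [← hf, ← map_intCast (toWord js d), ← map_sub]
      refine toWord_mem_wordOrder fun w hw => ?_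
      have : w = [] := by simpa using hw
      simp [coeff_sub, coeff_intCast, this]
    have h2 := toWord_mem_wordOrder (js := js) (d := d) (X_mem_order k)
    rw [hφ]
    -- The difference is `u⁻¹` times the commutator of `X k` with `u`; integers are central, so the
    -- constant term of `u` may be dropped, leaving degree 2.
    have e : (u k)⁻¹.val * toWord js d (X k) * (u k).val - toWord js d (X k) = (u k)⁻¹.val *
        (toWord js d (X k) * ((u k).val - (f.coeff [] : ℤ)) -
          ((u k).val - (f.coeff [] : ℤ)) * toWord js d (X k)) := by
      rw [mul_sub (toWord js d (X k)), sub_mul _ _ (toWord js d (X k)),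
        (Int.cast_commute (f.coeff []) (toWord js d (X k))).eq]
      simp only [mul_sub, ← mul_assoc, Units.inv_mul, one_mul]
      abel
    rw [e]
    exact hJ.mul_mem_left _ (sub_mem (hJ.mul_mem h2 h1) (hJ.mul_mem h1 h2))
  induction w with
  | nil => rw [mono_nil, map_one, map_one, sub_self]; exact zero_mem _
  | cons x w ih =>
    rw [mono_cons, map_mul, map_mul]
    have e : φ (X x) * φ (mono w) - toWord js d (X x) * toWord js d (mono w) =
        (φ (X x) - toWord js d (X x)) * toWord js d (mono w) +
        φ (X x) * (φ (mono w) - toWord js d (mono w)) := by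
      rw [sub_mul, mul_sub]
      abel
    rw [e, List.length_cons]
    have h2 := toWord_mem_wordOrder (js := js) (d := d) (X_mem_order x)
    have h3 : φ (X x) ∈ wordOrder js d 1 := by
      rw [hφ]; exact hJ.mul_mem_right _ (hJ.mul_mem_left _ h2)
    have a1 := hJ.mul_mem (hX x) (toWord_mem_wordOrder (js := js) (d := d) (mono_mem_order w))
    have a2 := hJ.mul_mem h3 ih
    rw [show w.length + 1 + 1 = 2 + w.length by omega]
    rw [show 1 + (w.length + 1) = 2 + w.length by omega] at a2
    exact add_mem a1 a2

/-- Two distinct letters cannot occur in both orders in a list without repetitions. This supplies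
the vanishing products required by `substHom`. -/
theorem pairwise_not_sublist (hjs : js.Nodup) : js.Pairwise fun a b => ¬ [b, a].Sublist js := by
  rw [List.pairwise_iff_forall_sublist]
  intro a b h h'
  have h1 := hjs.sublist h
  induction js with
  | nil => simp at h
  | cons x l ih =>
    rw [List.nodup_cons] at hjs
    cases h with
    | cons _ h =>
      cases h' with
      | cons _ h' => exact ih hjs.2 h h'
      | cons_cons _ h' => exact hjs.1 (h.subset (by simp))
    | cons_cons _ h =>
      cases h' with
      | cons _ h' => exact hjs.1 (h'.subset (by simp))
      | cons_cons _ h' => simp at h1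

/-- The holonomy of the component `i` in any colouring is given by the Milnor number. -/
theorem IsArcColoring.modEq (hn : (js ++ [i]).Nodup) (hjs : js ≠ [])
    (hd : ∀ J ∈ properCyclic (js ++ [i]), d ∣ G.milnorNumber J) {m : ℤ}
    {C : G.Arc → (WordRing js d)ˣ} (hC : IsArcColoring (milnorPalette (List.nodup_append.mp hn).1 i d
      (topUnit hjs d m)) G C) : G.milnorNumber (js ++ [i]) ≡ m [ZMOD d] := by
  have hi : i ∉ js := fun h => by
    have := (List.nodup_append.mp hn).2.2 i h i (by simp)
    exact this rfl
  have hjs' := (List.nodup_append.mp hn).1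
  have hv : ∀ k, ∃ u, k ≠ i → C ⟨k, 0⟩ = u⁻¹ * wordHom js d (FreeGroup.of k) * u := by
    intro k
    by_cases hk : k = i
    -- The value at `i` is immaterial, since `X i` is zero in the truncated ring.
    · exact ⟨1, fun h => absurd hk h⟩
    · obtain ⟨u, hu⟩ := hC.valid ⟨k, 0⟩ hk
      exact ⟨u, fun _ => hu⟩
  choose u hu using hv
  have hd0 : ((d : ℤ) : WordRing js d) = 0 := by
    rw [← map_intCast (toWord js d), toWord_eq_zero_iff]
    intro w _
    rw [coeff_intCast]
    split_ifs <;> simp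
  -- Substituting these conjugates carries the standard meridians to the base meridians of the given
  -- colouring.
  let N : Fin n → WordRing js d := fun k => (u k)⁻¹.val * toWord js d (X k) * (u k).val
  let φ := substHom N js ((pairwise_not_sublist hjs').imp fun h => conj_X_mul_conj_X h _ _)
    fun a _ => conj_X_mul_conj_X (fun h => by simpa using hjs'.sublist h) _ _
  have hφ : ∀ k, φ (X k) = N k := by
    intro k
    by_cases hk : k ∈ js
    · exact subst_X hjs' hk
    · have : N k = 0 := by simp [N, toWord_X_eq_zero hk]
      rw [this]
      exact subst_X_of_notMem hk
  let ρ : FreeGroup (Fin n) →* (WordRing js d)ˣ := (Units.map φ.toMonoidHom).comp magnus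
  have hρ : ∀ k, ρ (FreeGroup.of k) = (u k)⁻¹ * wordHom js d (FreeGroup.of k) * u k := by
    intro k
    ext
    rw [conj_wordHom_of]
    change φ (magnus (FreeGroup.of k)).val = _
    rw [magnus_of, map_add, map_one, hφ]
  have hJ := isMulFiltration_wordOrder js d
  set P := milnorPalette hjs' i d (topUnit hjs d m) with hP
  set Ω := FreeGroup.lift (fun a : G.Arc => P.overElt a.1 (C a)) with hΩ
  have hbase : ∀ k, P.overElt k (C ⟨k, 0⟩) = ρ (FreeGroup.of k) := by
    intro k
    rw [hρ]
    by_cases hk : k = i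
    · subst hk
      rw [wordHom_of_eq_one hi]
      simp [hP, milnorPalette]
    · simp only [hP, milnorPalette, if_neg hk]
      exact hu k hk
  -- The holonomy of the colouring satisfies the recursion of `η_q` with base `ρ`, so by nilpotency
  -- it is exactly `ρ ∘ η`.
  have key : ∀ x, Ω x = ρ (G.eta (js.length + 1) x) := by
    intro x
    ext
    rw [← sub_eq_zero]
    refine eq_zero_of_mem_wordOrder (Nat.lt_succ_self _) (G.hom_sub_eta_mem hJ ρ ?_ Ω ?_ _ x)
    · intro k
      rw [hρ, conj_wordHom_of, add_sub_cancel_left]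
      exact hJ.mul_mem_right _ (hJ.mul_mem_left _ (toWord_mem_wordOrder (X_mem_order k)))
    · intro a
      rw [← hbase, ← P.overElt_act, ← hC.eq_act a.1 a.2]
      simp [hΩ]
  -- After one turn the base colour is multiplied by the central unit; cancelling it reveals the
  -- longitude. The framing factor is trivial since component `i` acts by `1`.
  have hz : Ω (G.longitude i) = topUnit hjs d m := by
    have h1 := hC.closed i
    rw [hC.eq_act, ← hΩ] at h1
    have h2 : C ⟨i, 0⟩ * Ω (G.partialLongitude i (G.m i)) = topUnit hjs d m * C ⟨i, 0⟩ := by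
      simpa [hP, milnorPalette] using h1
    rw [(commute_topUnit hjs d m _).eq, mul_right_inj] at h2
    rw [longitude, map_mul, map_zpow, h2]
    have : Ω (FreeGroup.of ⟨i, 0⟩) = 1 := by
      rw [hΩ, FreeGroup.lift_apply_of]
      simp [hP, milnorPalette]
    rw [this, one_zpow, one_mul]
  rw [key] at hz
  have hz' : φ (magnus (G.eta (js.length + 1) (G.longitude i))).val =
      1 + m * toWord js d (mono js) := congrArg Units.val hz
  -- The same longitude is also `1 + μ(js i) X_js` after substitution; comparing coefficients at
  -- `js` gives the congruence.
  have hf := subst_eq_zero (N := N) hd0 (toWord_of_dvd (d := d) hjs (magnus_coeff_nil _)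
        (fun w => dvd_coeff_longitude_self hd) (m := G.milnorNumber (js ++ [i])) (by
          rw [milnorNumber_append _ _ _ (Nat.lt_succ_self _), sub_self]; exact dvd_zero d))
  have hf' : φ _ = 0 := hf
  have hmono : φ (mono js) = toWord js d (mono js) := by
    rw [← sub_eq_zero]
    exact eq_zero_of_mem_wordOrder (Nat.lt_succ_self _) (subst_mono_sub_mem u φ hφ js)
  rw [map_sub, hz', map_add, map_one, map_mul, map_intCast, hmono, add_sub_add_left_eq_sub,
    ← sub_mul, ← Int.cast_sub, ← map_intCast (toWord js d), ← map_mul, toWord_eq_zero_iff] at hf'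
  have h3 := hf' js (.refl _)
  have e : (((m - G.milnorNumber (js ++ [i]) : ℤ) : NCSeries (Fin n)) * mono js).coeff js =
      m - G.milnorNumber (js ++ [i]) := by
    cases js with
    | nil => exact absurd rfl hjs
    | cons x w =>
      have : NCSeries.shift x ((m - G.milnorNumber (x :: w ++ [i]) : ℤ) : NCSeries (Fin n)) = 0 := by
        ext v; simp only [NCSeries.shift, coeff_intCast, coeff_zero]; simp
      rw [coeff_mul_cons, this, zero_mul, coeff_zero, coeff_intCast]
      simp [mono_coeff]
  rw [e] at h3
  exact (Int.modEq_iff_dvd).mpr h3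

end ArcData

open Filter Topology

/-! ### Colourings of diagrams -/

section SamePoint

variable {n : ℕ}

theorem SamePoint.refl (x : Param n) : SamePoint x x := ⟨rfl, 0, by simp⟩

theorem SamePoint.symm {x y : Param n} (h : SamePoint x y) : SamePoint y x := by
  obtain ⟨h1, k, hk⟩ := h
  exact ⟨h1.symm, -k, by push_cast; linarith⟩

theorem samePoint_add_int (k : Fin n) (t : ℝ) (m : ℤ) : SamePoint (k, t) (k, t + m) :=
  ⟨rfl, m, rfl⟩

end SamePoint

namespace Palette

variable {n : ℕ} {Q Y : Type} [Group Q] (P : Palette n Q Y)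

theorem shift_symm_act (k : Fin n) (y : Y) (g : Q) :
    (P.shift k).symm (P.act k y g) = P.act k ((P.shift k).symm y) g := by
  rw [Equiv.symm_apply_eq, P.shift_act, Equiv.apply_symm_apply]

theorem zpow_shift_act (k : Fin n) (m : ℤ) (y : Y) (g : Q) :
    (P.shift k ^ m) (P.act k y g) = P.act k ((P.shift k ^ m) y) g := by
  induction m using Int.induction_on generalizing y with
  | zero => simp
  | succ m ih => simp only [zpow_add_one, Equiv.Perm.mul_apply, P.shift_act, ih]
  | pred m ih =>
    simp only [zpow_sub_one, Equiv.Perm.mul_apply, Equiv.Perm.inv_def, P.shift_symm_act, ih]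

theorem overElt_zpow_shift (k : Fin n) (m : ℤ) (y : Y) :
    P.overElt k ((P.shift k ^ m) y) = P.overElt k y := by
  induction m using Int.induction_on generalizing y with
  | zero => simp
  | succ m ih => simp only [zpow_add_one, Equiv.Perm.mul_apply, P.overElt_shift, ih]
  | pred m ih =>
    simp only [zpow_sub_one, Equiv.Perm.mul_apply, Equiv.Perm.inv_def, ih]
    rw [← P.overElt_shift, Equiv.apply_symm_apply]

theorem valid_zpow_shift (k : Fin n) (m : ℤ) (y : Y) :
    P.valid k ((P.shift k ^ m) y) ↔ P.valid k y := by
  induction m using Int.induction_on generalizing y with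
  | zero => simp
  | succ m ih => simp only [zpow_add_one, Equiv.Perm.mul_apply, P.valid_shift, ih]
  | pred m ih =>
    simp only [zpow_sub_one, Equiv.Perm.mul_apply, Equiv.Perm.inv_def, ih]
    rw [← P.valid_shift, Equiv.apply_symm_apply]

theorem act_inv_cancel (k : Fin n) (y : Y) (g : Q) : P.act k (P.act k y g) g⁻¹ = y := by
  rw [← P.act_mul, mul_inv_cancel, P.act_one]

theorem act_zpow_eq {k : Fin n} {y : Y} {g : Q} (h : P.act k y g = y) (m : ℤ) :
    P.act k y (g ^ m) = y := by
  induction m using Int.induction_on with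
  | zero => rw [zpow_zero, P.act_one]
  | succ m ih => rw [zpow_add_one, P.act_mul, ih, h]
  | pred m ih =>
    rw [zpow_sub_one, P.act_mul, ih]
    conv_lhs => rw [← h]
    exact P.act_inv_cancel k y g

end Palette

section Coloring

variable {n : ℕ} {Q Y : Type} [Group Q]

/-- The conditions on a colouring near a point; `R y x ε` says that the strand through `y` passes
over the strand through `x` in a crossing of sign `ε`. -/
structure LocalRule (P : Palette n Q Y) (R : Param n → Param n → ℤ → Prop) (c : Param n → Y)
    (k : Fin n) (t : ℝ) : Prop where
  valid : P.valid k (c (k, t))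
  -- Colours are left-continuous: the parameter of an under-crossing carries the colour of the
  -- incoming arc.
  left : ∀ᶠ s in 𝓝[<] t, c (k, s) = c (k, t)
  right : (∀ y ε, ¬ R y (k, t) ε) → ∀ᶠ s in 𝓝[>] t, c (k, s) = c (k, t)
  under : ∀ y ε, R y (k, t) ε →
    ∀ᶠ s in 𝓝[>] t, c (k, s) = P.act k (c (k, t)) (P.overElt y.1 (c y) ^ ε)

/-- Colourings of the points of the components. -/
structure IsColoring (P : Palette n Q Y) (R : Param n → Param n → ℤ → Prop) (c : Param n → Y) :
    Prop where
  shift : ∀ k t, c (k, t + 1) = P.shift k (c (k, t))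
  rule : ∀ k t, LocalRule P R c k t

variable {P : Palette n Q Y} {R : Param n → Param n → ℤ → Prop} {c : Param n → Y}

theorem shift_int (h : ∀ k t, c (k, t + 1) = P.shift k (c (k, t))) (k : Fin n) (t : ℝ) (m : ℤ) :
    c (k, t + m) = (P.shift k ^ m) (c (k, t)) := by
  induction m using Int.induction_on with
  | zero => simp
  | succ m ih =>
    push_cast at ih ⊢
    rw [← add_assoc, h, ih, add_comm (m : ℤ), zpow_one_add, Equiv.Perm.mul_apply]
  | pred m ih =>
    push_cast at ih ⊢
    have := h k (t + (-m - 1))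
    rw [show t + (-(m : ℝ) - 1) + 1 = t + -m by ring, ih] at this
    rw [show (-(m : ℤ) - 1) = -1 + -(m : ℤ) by ring, zpow_add, zpow_neg_one, Equiv.Perm.mul_apply, this, Equiv.Perm.inv_def,
      Equiv.symm_apply_apply]

theorem overElt_samePoint (h : ∀ k t, c (k, t + 1) = P.shift k (c (k, t))) {x y : Param n}
    (hxy : SamePoint x y) : P.overElt x.1 (c x) = P.overElt y.1 (c y) := by
  obtain ⟨k, t⟩ := x
  obtain ⟨l, s⟩ := y
  obtain ⟨h1, m, h2⟩ := hxy
  simp only at h1 h2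
  subst h1 h2
  simp only [shift_int h, P.overElt_zpow_shift]

/-- All conditions are equivariant under `shift`, so they need checking only in one period. -/
theorem LocalRule.of_add_int (h : ∀ k t, c (k, t + 1) = P.shift k (c (k, t)))
    (hR : ∀ y x x' ε, SamePoint x x' → R y x ε → R y x' ε) {k : Fin n} {t : ℝ} {m : ℤ}
    (hr : LocalRule P R c k (t + m)) : LocalRule P R c k t := by
  have hs := shift_int h k
  have h1 : Tendsto (fun s : ℝ => s + m) (𝓝[<] t) (𝓝[<] (t + m)) := by
    refine tendsto_nhdsWithin_of_tendsto_nhds_of_eventually_within _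
      ((continuous_add_const (m : ℝ)).tendsto t |>.mono_left nhdsWithin_le_nhds) ?_
    filter_upwards [self_mem_nhdsWithin] with s hs
    simpa using hs
  have h2 : Tendsto (fun s : ℝ => s + m) (𝓝[>] t) (𝓝[>] (t + m)) := by
    refine tendsto_nhdsWithin_of_tendsto_nhds_of_eventually_within _
      ((continuous_add_const (m : ℝ)).tendsto t |>.mono_left nhdsWithin_le_nhds) ?_
    filter_upwards [self_mem_nhdsWithin] with s hs
    simpa using hs
  refine ⟨?_, ?_, fun hn => ?_, fun y ε hy => ?_⟩
  · have := hr.valid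
    rwa [hs, P.valid_zpow_shift] at this
  · filter_upwards [h1.eventually hr.left] with s h
    rw [hs, hs] at h
    exact (P.shift k ^ m).injective h
  · have := hr.right fun y ε hy => hn y ε (hR _ _ _ _ (samePoint_add_int k t m).symm hy)
    filter_upwards [h2.eventually this] with s h
    rw [hs, hs] at h
    exact (P.shift k ^ m).injective h
  · have := hr.under y ε (hR _ _ _ _ (samePoint_add_int k t m) hy)
    filter_upwards [h2.eventually this] with s h
    rw [hs, hs, ← P.zpow_shift_act] at h
    exact (P.shift k ^ m).injective h

/-- A crossing at `b` itself is harmless because colours are left-continuous, hence the half-open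
interval. -/
theorem IsColoring.const (h : IsColoring P R c) {k : Fin n} {a b : ℝ} (hab : a ≤ b)
    (hn : ∀ t ∈ Set.Ico a b, ∀ y ε, ¬ R y (k, t) ε) : c (k, b) = c (k, a) := by
  -- With discrete colours, local constancy is continuity, and the interval is connected.
  let _ : TopologicalSpace Y := ⊥
  have : DiscreteTopology Y := ⟨rfl⟩
  refine (isPreconnected_Icc (a := a) (b := b)).constant (f := fun t => c (k, t)) ?_
    (Set.right_mem_Icc.mpr hab) (Set.left_mem_Icc.mpr hab)
  intro t ht
  have hl := (h.rule k t).left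
  have hl' : ∀ᶠ s in 𝓝[≤] t, c (k, s) = c (k, t) := by
    rw [← Set.Iio_insert, nhdsWithin_insert, eventually_sup]
    exact ⟨by simp, hl⟩
  have key : ∀ᶠ s in 𝓝[Set.Icc a b] t, c (k, s) = c (k, t) := by
    rcases ht.2.eq_or_lt with rfl | htb
    · exact hl'.filter_mono (nhdsWithin_mono _ Set.Icc_subset_Iic_self)
    · have hr := (h.rule k t).right (hn t ⟨ht.1, htb⟩)
      have : ∀ᶠ s in 𝓝 t, c (k, s) = c (k, t) := by
        rw [← nhdsLE_sup_nhdsGT, eventually_sup]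
        exact ⟨hl', hr⟩
      exact this.filter_mono nhdsWithin_le_nhds
  exact continuousWithinAt_const.congr_of_eventuallyEq key rfl

theorem IsColoring.jump (h : IsColoring P R c) {k : Fin n} {a t b : ℝ} (hat : a ≤ t) (htb : t < b)
    {y : Param n} {ε : ℤ} (hy : R y (k, t) ε)
    (hn : ∀ s ∈ Set.Ico a b, s ≠ t → ∀ y ε, ¬ R y (k, s) ε) :
    c (k, b) = P.act k (c (k, a)) (P.overElt y.1 (c y) ^ ε) := by
  rw [← h.const hat fun s hs => hn s ⟨hs.1, hs.2.trans htb⟩ hs.2.ne]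
  obtain ⟨s, hs, hts, hsb⟩ := (((h.rule k t).under y ε hy).and (Ioo_mem_nhdsGT htb)).exists
  rw [← hs]
  exact h.const hsb.le fun r hr => hn r ⟨hat.trans (hts.le.trans hr.1), hr.2⟩
    (hts.trans_le hr.1).ne'

end Coloring

namespace VirtualLinkDiagram

variable {n : ℕ}

/-- The strand through `y` passes over the strand through `x` in a crossing of sign `ε`. -/
def Under (D : VirtualLinkDiagram n) (y x : Param n) (ε : ℤ) : Prop :=
  D.IsOver y x ∧ ε = SignType.sign (cross (D.vel y) (D.vel x))

/-- The diagram has a colouring by the palette. -/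
def Colorable {Q Y : Type} [Group Q] (P : Palette n Q Y) (D : VirtualLinkDiagram n) : Prop :=
  ∃ c, IsColoring P D.Under c

theorem vel_samePoint (D : VirtualLinkDiagram n) {x y : Param n} (h : SamePoint x y) :
    D.vel x = D.vel y := by
  obtain ⟨k, t⟩ := x
  obtain ⟨l, s⟩ := y
  obtain ⟨h1, m, h2⟩ := h
  simp only at h1 h2
  subst h1 h2
  have : D.curve k = fun s => D.curve k (s + m) :=
    funext fun s => by simpa using ((D.periodic k).int_mul m s).symm
  simp only [vel]
  conv_lhs => rw [this, deriv_comp_add_const]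

theorem meets_symm {D : VirtualLinkDiagram n} {x y : Param n} (h : Meets D.curve x y) :
    Meets D.curve y x := ⟨h.1.symm, fun h' => h.2 h'.symm⟩

theorem Under.congr {D : VirtualLinkDiagram n} {y x y' x' : Param n} {ε : ℤ} (h : D.Under y x ε)
    (hy : SamePoint y y') (hx : SamePoint x x') : D.Under y' x' ε :=
  ⟨D.over_congr _ _ _ _ hy hx h.1, by rw [h.2, D.vel_samePoint hy, D.vel_samePoint hx]⟩

theorem arcAt_samePoint (D : VirtualLinkDiagram n) (p : BasePointSystem D) {x y : Param n}
    (h : SamePoint x y) : D.arcAt p x = D.arcAt p y := by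
  obtain ⟨k, t⟩ := x
  obtain ⟨l, s⟩ := y
  obtain ⟨h1, m, h2⟩ := h
  simp only at h1 h2
  subst h1 h2
  have := toIcoMod_add_zsmul (one_pos (α := ℝ)) (p.point k) t m
  simp only [zsmul_eq_mul, mul_one] at this
  simp [arcAt, this]

end VirtualLinkDiagram

/-! ### Counting under-crossings before a parameter -/

section Counting

theorem orderEmbOfFin_lt_iff (s : Finset ℝ) (t : ℝ) (i : Fin s.card) :
    s.orderEmbOfFin rfl i < t ↔ (i : ℕ) < {u ∈ s | u < t}.card := by
  constructor
  · intro h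
    have : (Finset.Iic i).map (s.orderEmbOfFin rfl).toEmbedding ⊆ {u ∈ s | u < t} := by
      intro u hu
      obtain ⟨j, hj, rfl⟩ := Finset.mem_map.mp hu
      refine Finset.mem_filter.mpr ⟨s.orderEmbOfFin_mem rfl j, ?_⟩
      exact ((s.orderEmbOfFin rfl).monotone (Finset.mem_Iic.mp hj)).trans_lt h
    simpa [Nat.succ_le_iff] using Finset.card_le_card this
  · intro h
    by_contra hc
    have : {u ∈ s | u < t} ⊆ (Finset.Iio i).map (s.orderEmbOfFin rfl).toEmbedding := by
      intro u hu
      obtain ⟨hu, hut⟩ := Finset.mem_filter.mp hu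
      obtain ⟨j, rfl⟩ : u ∈ Set.range (s.orderEmbOfFin rfl) := by simpa using hu
      refine Finset.mem_map.mpr ⟨j, Finset.mem_Iio.mpr ?_, rfl⟩
      exact (s.orderEmbOfFin rfl).lt_iff_lt.mp (hut.trans_le (not_lt.mp hc))
    have := Finset.card_le_card this
    simp only [Finset.card_map, Fin.card_Iio] at this
    omega

theorem card_filter_lt_eq {s : Finset ℝ} {t : ℝ} {N : ℕ} (hN : N ≤ s.card)
    (h : ∀ i, s.orderEmbOfFin rfl i < t ↔ (i : ℕ) < N) : {u ∈ s | u < t}.card = N := by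
  have hle := Finset.card_filter_le s fun u => u < t
  rcases lt_trichotomy {u ∈ s | u < t}.card N with hlt | heq | hgt
  · have := (orderEmbOfFin_lt_iff s t ⟨_, hlt.trans_le hN⟩).mp ((h _).mpr hlt)
    exact absurd this (lt_irrefl _)
  · exact heq
  · have := (h ⟨N, hgt.trans_le hle⟩).mp ((orderEmbOfFin_lt_iff s t _).mpr hgt)
    exact absurd this (lt_irrefl _)

theorem eventually_nhdsLT_filter_lt (s : Finset ℝ) (t : ℝ) :
    ∀ᶠ r in 𝓝[<] t, {u ∈ s | u < r} = {u ∈ s | u < t} := by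
  have : ∀ᶠ r in 𝓝[<] t, ∀ u ∈ s, (u < r ↔ u < t) := by
    rw [eventually_all_finset]
    intro u _
    by_cases h : u < t
    · filter_upwards [Ioo_mem_nhdsLT h] with r hr
      exact iff_of_true hr.1 h
    · filter_upwards [self_mem_nhdsWithin] with r hr
      exact iff_of_false (fun h' => h (h'.trans hr)) h
  filter_upwards [this] with r hr
  exact Finset.filter_congr hr

theorem eventually_nhdsGT_filter_lt (s : Finset ℝ) (t : ℝ) :
    ∀ᶠ r in 𝓝[>] t, {u ∈ s | u < r} = {u ∈ s | u ≤ t} := by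
  have : ∀ᶠ r in 𝓝[>] t, ∀ u ∈ s, (u < r ↔ u ≤ t) := by
    rw [eventually_all_finset]
    intro u _
    by_cases h : u ≤ t
    · filter_upwards [self_mem_nhdsWithin] with r hr
      exact iff_of_true (h.trans_lt hr) h
    · filter_upwards [Ioo_mem_nhdsGT (not_le.mp h)] with r hr
      exact iff_of_false (fun h' => lt_asymm h' hr.2) h
  filter_upwards [this] with r hr
  exact Finset.filter_congr hr

end Counting

/-! ### Colourings of arcs versus colourings of points -/

namespace VirtualLinkDiagram

variable {n : ℕ} {Q Y : Type} [Group Q] {P : Palette n Q Y} {D : VirtualLinkDiagram n}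

theorem mem_underParams {p : BasePointSystem D} {k : Fin n} {t : ℝ} :
    t ∈ D.underParams p k ↔
      t ∈ Set.Ioo (p.point k) (p.point k + 1) ∧ ∃ y, D.IsOver y (k, t) :=
  (D.finite_under p k).mem_toFinset

theorem mem_underParams_of_under {p : BasePointSystem D} {k : Fin n} {t : ℝ} {y : Param n} {ε : ℤ}
    (ht : t ∈ Set.Ico (p.point k) (p.point k + 1)) (h : D.Under y (k, t) ε) :
    t ∈ D.underParams p k := by
  refine mem_underParams.mpr ⟨⟨lt_of_le_of_ne ht.1 ?_, ht.2⟩, y, h.1⟩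
  rintro rfl
  exact p.not_crossing k y (meets_symm (D.over_meets _ _ h.1))

theorem exists_underParam {p : BasePointSystem D} {k : Fin n} {t : ℝ}
    (h : t ∈ D.underParams p k) : ∃ j, t = D.underParam p k j := by
  obtain ⟨j, hj⟩ : t ∈ Set.range ((D.underParams p k).orderEmbOfFin rfl) := by simpa using h
  exact ⟨j, hj.symm⟩

theorem underParam_mem (p : BasePointSystem D) (k : Fin n) (j) :
    D.underParam p k j ∈ Set.Ioo (p.point k) (p.point k + 1) :=
  (mem_underParams.mp ((D.underParams p k).orderEmbOfFin_mem rfl j)).1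

theorem under_underParam (p : BasePointSystem D) (k : Fin n) (j : Fin (D.underParams p k).card) :
    D.Under (D.overParam p k j) (k, D.underParam p k j) ((D.arcData p).sign k j) :=
  ⟨(D.exists_over p k j).choose_spec, rfl⟩

theorem underParam_lt_iff (p : BasePointSystem D) (k : Fin n) (i j) :
    D.underParam p k i < D.underParam p k j ↔ i < j :=
  ((D.underParams p k).orderEmbOfFin rfl).lt_iff_lt

theorem underParam_lt (p : BasePointSystem D) (k : Fin n) (i) (t : ℝ) :
    D.underParam p k i < t ↔ (i : ℕ) < {u ∈ D.underParams p k | u < t}.card :=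
  orderEmbOfFin_lt_iff _ _ _

/-- The last parameter of an arc. -/
noncomputable def arcEnd (D : VirtualLinkDiagram n) (p : BasePointSystem D)
    (a : (D.arcData p).Arc) : ℝ :=
  if h : (a.2 : ℕ) < (D.underParams p a.1).card then D.underParam p a.1 ⟨a.2, h⟩
  else p.point a.1 + 1

theorem arcEnd_castSucc (p : BasePointSystem D) (k : Fin n) (j : Fin (D.underParams p k).card) :
    D.arcEnd p ⟨k, j.castSucc⟩ = D.underParam p k j := by
  simp [arcEnd]

theorem arcEnd_le (p : BasePointSystem D) (a : (D.arcData p).Arc) :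
    D.arcEnd p a ≤ p.point a.1 + 1 := by
  unfold arcEnd
  split_ifs with h
  · exact (underParam_mem p _ _).2.le
  · exact le_rfl

/-- Between a parameter and the end of its arc there is no under-crossing, so the colour at the end
represents the whole arc. -/
theorem coloring_arcEnd (p : BasePointSystem D) {c : Param n → Y} (hc : IsColoring P D.Under c)
    {k : Fin n} {t : ℝ} (ht : t ∈ Set.Icc (p.point k) (p.point k + 1))
    (j : Fin ((D.underParams p k).card + 1))
    (hj : (j : ℕ) = {u ∈ D.underParams p k | u < t}.card) :
    c (k, D.arcEnd p ⟨k, j⟩) = c (k, t) := by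
  have hle : t ≤ D.arcEnd p ⟨k, j⟩ := by
    unfold arcEnd
    split_ifs with h
    · rw [← not_lt, underParam_lt, ← hj]
      exact lt_irrefl _
    · exact ht.2
  refine hc.const hle fun r hr y ε hy => ?_
  have hr2 := hr.2.trans_le (arcEnd_le p _)
  obtain ⟨i, rfl⟩ := exists_underParam (mem_underParams_of_under ⟨ht.1.trans hr.1, hr2⟩ hy)
  have h1 : ¬ D.underParam p k i < t := not_lt.mpr hr.1
  rw [underParam_lt, ← hj, not_lt] at h1
  have h2 := hr.2
  rw [arcEnd, dif_pos (h1.trans_lt i.2), underParam_lt_iff] at h2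
  exact absurd h2 (not_lt.mpr h1)

theorem filter_lt_point (p : BasePointSystem D) (k : Fin n) :
    {u ∈ D.underParams p k | u < p.point k} = ∅ :=
  Finset.filter_eq_empty_iff.mpr fun _ hu h => lt_asymm h (mem_underParams.mp hu).1.1

/-- Each arc receives the colour at its last parameter, which by left-continuity is the colour just
before the next crossing. Any base point system may be used here. -/
theorem Colorable.exists_isArcColoring (h : Colorable P D) (p : BasePointSystem D) :
    ∃ C, ArcData.IsArcColoring P (D.arcData p) C := by
  obtain ⟨c, hc⟩ := h
  have h0 : ∀ k, c (k, D.arcEnd p ⟨k, 0⟩) = c (k, p.point k) := fun k =>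
    coloring_arcEnd p hc (by simp) 0 (by rw [filter_lt_point]; rfl)
  refine ⟨fun a => c (a.1, D.arcEnd p a), fun a => (hc.rule _ _).valid, fun k j => ?_, fun k => ?_⟩
  · have ho : P.overElt ((D.arcData p).overArc k j).1 (c (((D.arcData p).overArc k j).1,
        D.arcEnd p ((D.arcData p).overArc k j))) =
        P.overElt (D.overParam p k j).1 (c (D.overParam p k j)) := by
      set y := D.overParam p k j with hy
      have hm := toIcoMod_mem_Ico (one_pos (α := ℝ)) (p.point y.1) y.2
      have e : (D.arcData p).overArc k j = D.arcAt p y := rfl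
      rw [e]
      have := coloring_arcEnd p hc (Set.Ico_subset_Icc_self hm) (D.arcAt p y).2 rfl
      refine (congrArg (P.overElt y.1) this).trans (overElt_samePoint hc.shift
        (x := (y.1, toIcoMod (one_pos (α := ℝ)) (p.point y.1) y.2)) (y := y) ?_)
      refine ⟨rfl, toIcoDiv (one_pos (α := ℝ)) (p.point y.1) y.2, ?_⟩
      have := toIcoMod_add_toIcoDiv_zsmul (one_pos (α := ℝ)) (p.point y.1) y.2
      simpa using this.symm
    change c (k, D.arcEnd p ⟨k, j.succ⟩) = P.act k (c (k, D.arcEnd p ⟨k, j.castSucc⟩)) _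
    have e := congrArg (fun t => c (k, t)) (arcEnd_castSucc p k j)
    refine Eq.trans ?_ (congrArg₂ (P.act k) e.symm
      (congrArg (fun g => g ^ (D.arcData p).sign k j) ho.symm))
    have hlt : D.underParam p k j < D.arcEnd p ⟨k, j.succ⟩ := by
      unfold arcEnd
      split_ifs with h
      · exact (underParam_lt_iff p k j _).mpr (Nat.lt_succ_self _)
      · exact (underParam_mem p _ _).2
    refine hc.jump le_rfl hlt (under_underParam p k j) fun s hs hne y ε hy => ?_
    have hs2 := hs.2.trans_le (arcEnd_le p _)
    have hs1 := (underParam_mem p k j).1.le.trans hs.1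
    obtain ⟨i, rfl⟩ := exists_underParam (mem_underParams_of_under ⟨hs1, hs2⟩ hy)
    have h1 : (j : ℕ) < i := (underParam_lt_iff p k j i).mp (lt_of_le_of_ne hs.1 hne.symm)
    have h2 := hs.2
    have h3 : (j.succ : ℕ) < (D.underParams p k).card := (Nat.succ_le_of_lt h1).trans_lt i.2
    rw [arcEnd, dif_pos h3] at h2
    have h4 : (i : ℕ) < j + 1 := (underParam_lt_iff p k i _).mp h2
    omega
  · dsimp only
    rw [h0, ← hc.shift]
    congr 2
    rw [arcEnd, dif_neg]
    exact lt_irrefl _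

theorem colorable_of_isArcColoring (p : BasePointSystem D) {C : (D.arcData p).Arc → Y}
    (hC : ArcData.IsArcColoring P (D.arcData p) C) : Colorable P D := by
  -- One period from the base point takes its colours from the arcs; each further turn applies
  -- `shift`.
  let c : Param n → Y := fun x =>
    (P.shift x.1 ^ toIcoDiv (one_pos (α := ℝ)) (p.point x.1) x.2) (C (D.arcAt p x))
  have hshift : ∀ k t, c (k, t + 1) = P.shift k (c (k, t)) := by
    intro k t
    have h1 : D.arcAt p (k, t + 1) = D.arcAt p (k, t) :=
      (D.arcAt_samePoint p (x := (k, t)) (y := (k, t + 1)) ⟨rfl, 1, by simp⟩).symm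
    simp only [c, h1, toIcoDiv_add_right]
    rw [add_comm, zpow_one_add, Equiv.Perm.mul_apply]
  have hR : ∀ y x x' ε, SamePoint x x' → D.Under y x ε → D.Under y x' ε :=
    fun y x x' ε h h' => h'.congr (.refl _) h
  refine ⟨c, hshift, fun k t => ?_⟩
  suffices h : ∀ t ∈ Set.Ico (p.point k) (p.point k + 1), LocalRule P D.Under c k t by
    refine LocalRule.of_add_int hshift hR (m := -toIcoDiv (one_pos (α := ℝ)) (p.point k) t) (h _ ?_)
    have := toIcoMod_mem_Ico (one_pos (α := ℝ)) (p.point k) t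
    rw [toIcoMod] at this
    simpa [sub_eq_add_neg] using this
  clear t
  have hcnt : ∀ r ∈ Set.Ico (p.point k) (p.point k + 1), ∀ j : Fin ((D.underParams p k).card + 1),
      (j : ℕ) = {u ∈ D.underParams p k | u < r}.card → c (k, r) = C ⟨k, j⟩ := by
    intro r hr j hj
    have h1 : toIcoMod (one_pos (α := ℝ)) (p.point k) r = r := (toIcoMod_eq_self _).mpr hr
    have h2 : toIcoDiv (one_pos (α := ℝ)) (p.point k) r = 0 :=
      toIcoDiv_eq_of_sub_zsmul_mem_Ico _ (by simpa using hr)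
    have h3 : D.arcAt p (k, r) = ⟨k, j⟩ := by
      simp only [arcAt, h1]
      congr 1
      exact Fin.ext hj.symm
    simp only [c, h2, h3, zpow_zero, Equiv.Perm.coe_one, id_eq]
    rfl
  have hcnt' : ∀ r ∈ Set.Ico (p.point k) (p.point k + 1), ∀ r' ∈ Set.Ico (p.point k) (p.point k + 1),
      {u ∈ D.underParams p k | u < r}.card = {u ∈ D.underParams p k | u < r'}.card →
      c (k, r) = c (k, r') := by
    intro r hr r' hr' h
    rw [hcnt r hr ⟨_, Nat.lt_succ_of_le (Finset.card_filter_le _ _)⟩ rfl,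
      hcnt r' hr' ⟨_, Nat.lt_succ_of_le (Finset.card_filter_le _ _)⟩ h]
  have hright : ∀ t ∈ Set.Ico (p.point k) (p.point k + 1),
      ∀ᶠ r in 𝓝[>] t, r ∈ Set.Ico (p.point k) (p.point k + 1) := by
    intro t ht
    filter_upwards [Ioo_mem_nhdsGT ht.2] with r hr
    exact ⟨ht.1.trans hr.1.le, hr.2⟩
  intro t ht
  refine ⟨?_, ?_, fun hn => ?_, fun y ε hy => ?_⟩
  · rw [hcnt t ht ⟨_, Nat.lt_succ_of_le (Finset.card_filter_le _ _)⟩ rfl]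
    exact hC.valid ⟨k, _⟩
  -- To the left of the base point lies the last arc of the previous turn; the condition `closed`
  -- matches it with the first arc.
  · rcases ht.1.eq_or_lt with rfl | hpt
    · have h1 : ∀ᶠ r in 𝓝[<] (p.point k), ∀ u ∈ D.underParams p k, u < r + 1 := by
        rw [eventually_all_finset]
        intro u hu
        have : u - 1 < p.point k := by linarith [(mem_underParams.mp hu).1.2]
        filter_upwards [Ioo_mem_nhdsLT this] with r hr
        linarith [hr.1]
      have h2 : p.point k - 1 < p.point k := by linarith
      filter_upwards [h1, Ioo_mem_nhdsLT h2] with r hr hr'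
      have h3 : r + 1 ∈ Set.Ico (p.point k) (p.point k + 1) :=
        ⟨by linarith [hr'.1], by linarith [hr'.2]⟩
      have h4 := hcnt _ h3 (Fin.last _) (by rw [Finset.filter_true_of_mem hr]; rfl)
      rw [hshift] at h4
      refine (P.shift k).injective (h4.trans ((hC.closed k).trans ?_))
      rw [hcnt _ ht 0 (by rw [filter_lt_point]; rfl)]
      rfl
    · filter_upwards [eventually_nhdsLT_filter_lt (D.underParams p k) t, Ioo_mem_nhdsLT hpt]
        with r hr hr'
      exact hcnt' _ ⟨hr'.1.le, hr'.2.trans ht.2⟩ _ ht (by rw [hr])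
  · filter_upwards [eventually_nhdsGT_filter_lt (D.underParams p k) t, hright t ht] with r hr hr'
    refine hcnt' _ hr' _ ht ?_
    rw [hr]
    congr 1
    refine Finset.filter_congr fun u hu => ⟨fun h => lt_of_le_of_ne h ?_, le_of_lt⟩
    rintro rfl
    obtain ⟨y, hy⟩ := (mem_underParams.mp hu).2
    exact hn y _ ⟨hy, rfl⟩
  · obtain ⟨j, rfl⟩ := exists_underParam (mem_underParams_of_under ht hy)
    have hu := under_underParam p k j
    have hs : SamePoint (D.overParam p k j) y :=
      D.double _ _ _ (meets_symm (D.over_meets _ _ hu.1)) (meets_symm (D.over_meets _ _ hy.1))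
    have hε : ε = (D.arcData p).sign k j := by
      rw [hu.2, hy.2, D.vel_samePoint hs]
    have ho : P.overElt y.1 (c y) = P.overElt ((D.arcData p).overArc k j).1
        (C ((D.arcData p).overArc k j)) := by
      have e : (D.arcData p).overArc k j = D.arcAt p y := D.arcAt_samePoint p hs
      rw [e]
      simp only [c, P.overElt_zpow_shift]
      rfl
    rw [ho, hε]
    have h1 : c (k, D.underParam p k j) = C ⟨k, j.castSucc⟩ := by
      refine hcnt _ ht _ (card_filter_lt_eq j.2.le fun i => ?_).symm
      exact underParam_lt_iff p k i j
    rw [h1]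
    filter_upwards [eventually_nhdsGT_filter_lt (D.underParams p k) (D.underParam p k j),
      hright _ ht, self_mem_nhdsWithin] with r hr hr' hjr
    refine Eq.trans ?_ (hC.step k j)
    refine hcnt _ hr' j.succ (card_filter_lt_eq (Nat.succ_le_of_lt j.2) fun i => ?_).symm
    have hm := (D.underParams p k).orderEmbOfFin_mem rfl i
    have h2 : D.underParam p k i < r ↔ D.underParam p k i ≤ D.underParam p k j := by
      have := Finset.ext_iff.mp hr (D.underParam p k i)
      simpa [show D.underParam p k i ∈ D.underParams p k from hm] using this
    refine h2.trans ?_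
    rw [← not_lt, underParam_lt_iff, not_lt, Fin.le_def, Nat.lt_succ_iff]

end VirtualLinkDiagram

/-! ### Moves that do not change the classical crossings between different components -/

/-- By `act_self` the jump at a self-crossing is trivial, so adding or deleting self-crossings
leaves the same map a colouring. Uniqueness of the over-component excludes a point that is under
both its own and another component. -/
theorem IsColoring.of_inter {n : ℕ} {Q Y : Type} [Group Q] {P : Palette n Q Y}
    {R R' : Param n → Param n → ℤ → Prop} {c : Param n → Y} (h : IsColoring P R c)
    (hR : ∀ y x ε, y.1 ≠ x.1 → (R y x ε ↔ R' y x ε))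
    (hu : ∀ y y' x ε ε', R' y x ε → R' y' x ε' → y.1 = y'.1) : IsColoring P R' c := by
  refine ⟨h.shift, fun k t => ?_⟩
  have hr := h.rule k t
  have self : ∀ (y : Param n) (ε : ℤ), y.1 = k →
      P.act k (c (k, t)) (P.overElt y.1 (c y) ^ ε) = c (k, t) := by
    rintro ⟨l, s⟩ ε rfl
    exact P.act_zpow_eq (P.act_self _ _ _ hr.valid (h.rule l s).valid) ε
  have inter : (∀ y ε, R' y (k, t) ε → y.1 = k) → ∀ᶠ s in 𝓝[>] t, c (k, s) = c (k, t) := by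
    intro hn
    by_cases hy : ∃ y ε, R y (k, t) ε
    · obtain ⟨y, ε, hy⟩ := hy
      have hk : y.1 = k := by
        by_contra hk
        exact hk (hn y ε ((hR y (k, t) ε hk).mp hy))
      have := hr.under y ε hy
      rwa [self y ε hk] at this
    · exact hr.right fun y ε h' => hy ⟨y, ε, h'⟩
  refine ⟨hr.valid, hr.left, fun hn => inter fun y ε hy => absurd hy (hn y ε), fun y ε hy => ?_⟩
  by_cases hk : y.1 = k
  · rw [self y ε hk]
    exact inter fun y' ε' hy' => (hu _ _ _ _ _ hy' hy).trans hk
  · exact hr.under y ε ((hR y (k, t) ε hk).mpr hy)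

namespace VirtualLinkDiagram

variable {n : ℕ} {Q Y : Type} [Group Q] {P : Palette n Q Y} {D D' : VirtualLinkDiagram n}

theorem Under.meets {y x : Param n} {ε : ℤ} (h : D.Under y x ε) : Meets D.curve y x :=
  D.over_meets _ _ h.1

theorem Under.samePoint {y y' x : Param n} {ε ε' : ℤ} (h : D.Under y x ε) (h' : D.Under y' x ε') :
    SamePoint y y' := D.double _ _ _ (meets_symm h.meets) (meets_symm h'.meets)

theorem Colorable.of_inter (h : Colorable P D)
    (hR : ∀ y x ε, y.1 ≠ x.1 → (D.Under y x ε ↔ D'.Under y x ε)) : Colorable P D' := by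
  obtain ⟨c, hc⟩ := h
  exact ⟨c, hc.of_inter hR fun y y' x ε ε' hy hy' => (hy.samePoint hy').1⟩

theorem colorable_iff_of_inter
    (hR : ∀ y x ε, y.1 ≠ x.1 → (D.Under y x ε ↔ D'.Under y x ε)) :
    Colorable P D ↔ Colorable P D' :=
  ⟨fun h => h.of_inter hR, fun h => h.of_inter fun y x ε hne => (hR y x ε hne).symm⟩

end VirtualLinkDiagram

open VirtualLinkDiagram

section Moves

variable {n : ℕ} {Q Y : Type} [Group Q] {P : Palette n Q Y} {D D' : VirtualLinkDiagram n}

theorem SelfCrossingVirtualization.colorable_iff (h : SelfCrossingVirtualization D D') :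
    Colorable P D ↔ Colorable P D' := by
  obtain ⟨hc, a, b, -, hab, ho⟩ := h
  refine colorable_iff_of_inter fun y x ε hne => ?_
  have hn : ¬ (SamePoint a y ∧ SamePoint b x) := fun h =>
    hne (h.1.1.symm.trans (hab.trans h.2.1))
  simp only [Under, ho, vel, hc, hn, not_false_eq_true, and_true]

/-! ### Local changes -/

theorem IsDisk.isClosed {δ : Set Plane} (h : IsDisk δ) : IsClosed δ := by
  obtain ⟨e, rfl⟩ := h
  exact ((isCompact_closedBall _ _).image e.continuous).isClosed

variable {k : ℕ} {δ : Set Plane} {S : Strands n k}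

theorem LocalChange.symm (h : LocalChange D D' δ S) : LocalChange D' D δ S :=
  ⟨h.disk, h.right, h.left, fun x hx => (h.same_curve x hx).symm,
    fun x y hx hy => (h.same_crossings x y hx hy).symm⟩

/-- The disk is closed, so the curves agree on a neighbourhood of the parameter and have the same
derivative; crossing signs outside are unchanged. -/
theorem LocalChange.vel_eq (h : LocalChange D D' δ S) {x : Param n} (hx : ¬ S.Contains x) :
    D.vel x = D'.vel x := by
  obtain ⟨i, t⟩ := x
  have ho : IsOpen (D.curve i ⁻¹' δᶜ) :=
    h.disk.isClosed.isOpen_compl.preimage (D.smooth i).continuous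
  have ht : t ∈ D.curve i ⁻¹' δᶜ := fun h' => hx ((h.left (i, t)).mp h')
  refine Filter.EventuallyEq.deriv_eq ?_
  filter_upwards [ho.mem_nhds ht] with s hs
  exact h.same_curve (i, s) fun h' => hs ((h.left (i, s)).mpr h')

theorem LocalChange.contains_of_under (h : LocalChange D D' δ S) {y x : Param n} {ε : ℤ}
    (hu : D.Under y x ε) : S.Contains y ↔ S.Contains x := by
  rw [← h.left, ← h.left, pt, pt, hu.meets.1]

theorem LocalChange.under_of_under (h : LocalChange D D' δ S) {y x : Param n} {ε : ℤ}
    (hx : ¬ S.Contains x) (hu : D.Under y x ε) : D'.Under y x ε := by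
  have hy : ¬ S.Contains y := fun hy => hx ((h.contains_of_under hu).mp hy)
  exact ⟨(h.same_crossings y x hy hx).mp hu.1, by rw [hu.2, h.vel_eq hy, h.vel_eq hx]⟩

theorem LocalChange.under_iff (h : LocalChange D D' δ S) {y x : Param n} {ε : ℤ}
    (hx : ¬ S.Contains x) : D.Under y x ε ↔ D'.Under y x ε :=
  ⟨h.under_of_under hx, h.symm.under_of_under hx⟩

theorem CrossingsIn.eq_of_under {l : List (Param n × Param n)} (h : CrossingsIn D δ l)
    (hl : ∀ z ∈ l, z.1.1 = z.2.1 ∨ D.IsVirtual z.1 z.2) {y x : Param n} {ε : ℤ}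
    (hu : D.Under y x ε) (hx : D.pt x ∈ δ) : y.1 = x.1 := by
  obtain ⟨z, hz, hxy⟩ := h.2 x y (meets_symm hu.meets) hx
  rcases hl z hz with h1 | h1
  · rcases hxy with ⟨h2, h3⟩ | ⟨h2, h3⟩
    · rw [h2.1, h3.1, h1]
    · rw [h2.1, h3.1, h1]
  · exfalso
    rcases hxy with ⟨h2, h3⟩ | ⟨h2, h3⟩
    · exact h1.2.2 (D.over_congr _ _ _ _ h3 h2 hu.1)
    · exact h1.2.1 (D.over_congr _ _ _ _ h3 h2 hu.1)

/-- When the disk contains only self-crossings and virtual crossings, before and after, nothing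
visible to colourings has changed. -/
theorem LocalChange.colorable_iff_of_crossingsIn (h : LocalChange D D' δ S)
    {l l' : List (Param n × Param n)} (hD : CrossingsIn D δ l) (hD' : CrossingsIn D' δ l')
    (hl : ∀ z ∈ l, z.1.1 = z.2.1 ∨ D.IsVirtual z.1 z.2)
    (hl' : ∀ z ∈ l', z.1.1 = z.2.1 ∨ D'.IsVirtual z.1 z.2) : Colorable P D ↔ Colorable P D' := by
  refine colorable_iff_of_inter fun y x ε hne => ?_
  by_cases hx : S.Contains x
  · exact iff_of_false (fun hu => hne (hD.eq_of_under hl hu ((h.left x).mpr hx)))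
      fun hu => hne (hD'.eq_of_under hl' hu ((h.right x).mpr hx))
  · exact h.under_iff hx

theorem KinkMove.colorable_iff {c : CrossingType} (h : KinkMove c D D') :
    Colorable P D ↔ Colorable P D' := by
  obtain ⟨δ, S, hL, hD, t, u, -, -, hD', -⟩ := h
  exact hL.colorable_iff_of_crossingsIn hD hD' (by simp) (by simp [Strands.param])

theorem BigonMove.colorable_iff_of_virtual (h : BigonMove .virtual D D') :
    Colorable P D ↔ Colorable P D' := by
  obtain ⟨δ, S, hL, hD, t₁, t₂, u₁, u₂, -, -, -, -, -, -, hD', h1, h2, -⟩ := h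
  refine hL.colorable_iff_of_crossingsIn hD hD' (by simp) ?_
  simp only [List.mem_cons, List.not_mem_nil, or_false, forall_eq_or_imp, forall_eq]
  exact ⟨.inr h1, .inr h2⟩

/-! ### Plane isotopies -/

theorem cross_map (A : Plane →L[ℝ] Plane) (v w : Plane) :
    cross (A v) (A w) = A.det * cross v w := by
  have hdet : A.det = (A (1, 0)).1 * (A (0, 1)).2 - (A (0, 1)).1 * (A (1, 0)).2 := by
    rw [ContinuousLinearMap.det, ← LinearMap.det_toMatrix (Module.Basis.finTwoProd ℝ),
      Matrix.det_fin_two]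
    simp [LinearMap.toMatrix_apply]
  have hA : ∀ v : Plane, A v = v.1 • A (1, 0) + v.2 • A (0, 1) := by
    intro v
    rw [← map_smul, ← map_smul, ← map_add]
    simp
  rw [hdet, hA v, hA w]
  simp only [cross, Prod.fst_add, Prod.snd_add, Prod.smul_fst, Prod.smul_snd, smul_eq_mul]
  ring

theorem cross_smul_smul (a b : ℝ) (v w : Plane) : cross (a • v) (b • w) = a * b * cross v w := by
  simp only [cross, Prod.smul_fst, Prod.smul_snd, smul_eq_mul]
  ring

theorem VirtualLinkDiagram.Colorable.reparam (h : Colorable P D) (e : Fin n → ℝ ≃o ℝ)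
    (he : ∀ i t, e i (t + 1) = e i t + 1)
    (hR : ∀ y x ε, D'.Under y x ε ↔ D.Under (y.1, e y.1 y.2) (x.1, e x.1 x.2) ε) :
    Colorable P D' := by
  obtain ⟨c, hc⟩ := h
  refine ⟨fun x => c (x.1, e x.1 x.2), fun k t => ?_, fun k t => ?_⟩
  · simp only [he, hc.shift]
  have hl : Tendsto (e k) (𝓝[<] t) (𝓝[<] (e k t)) :=
    (e k).continuous.continuousAt.continuousWithinAt.tendsto_nhdsWithin fun s hs =>
      (e k).lt_iff_lt.mpr hs
  have hr : Tendsto (e k) (𝓝[>] t) (𝓝[>] (e k t)) :=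
    (e k).continuous.continuousAt.continuousWithinAt.tendsto_nhdsWithin fun s hs =>
      (e k).lt_iff_lt.mpr hs
  have hk := hc.rule k (e k t)
  refine ⟨hk.valid, hl.eventually hk.left, fun hn => hr.eventually (hk.right fun y ε hy => ?_),
    fun y ε hy => hr.eventually (hk.under _ ε ((hR _ _ _).mp hy))⟩
  refine hn (y.1, (e y.1).symm y.2) ε ((hR _ _ _).mpr ?_)
  simpa using hy

theorem PlaneIsotopic.colorable_iff (h : PlaneIsotopic D D') :
    Colorable P D ↔ Colorable P D' := by
  obtain ⟨h, φ, hh, -, hdet, hφ, hφ', hφ1, hcurve, hover⟩ := h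
  have hmono : ∀ i, StrictMono (φ i) := fun i => strictMono_of_deriv_pos (hφ' i)
  have hint : ∀ i t (m : ℕ), φ i (t + m) = φ i t + m := by
    intro i t m
    induction m with
    | zero => simp
    | succ m ih => push_cast; rw [← add_assoc, hφ1, ih, add_assoc]
  have htop : ∀ i, Tendsto (φ i) atTop atTop := by
    intro i
    refine tendsto_atTop.mpr fun b => ?_
    obtain ⟨m, hm⟩ := exists_nat_ge (b - φ i 0)
    filter_upwards [eventually_ge_atTop (m : ℝ)] with t ht
    have := (hmono i).monotone ht
    have h2 := hint i 0 m
    rw [zero_add] at h2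
    linarith
  have hbot : ∀ i, Tendsto (φ i) atBot atBot := by
    intro i
    refine tendsto_atBot.mpr fun b => ?_
    obtain ⟨m, hm⟩ := exists_nat_ge (φ i 0 - b)
    filter_upwards [eventually_le_atBot (-m : ℝ)] with t ht
    have := (hmono i).monotone ht
    have h2 := hint i (-m) m
    rw [neg_add_cancel] at h2
    linarith
  have hsurj : ∀ i, Function.Surjective (φ i) := fun i =>
    (hφ i).continuous.surjective (htop i) (hbot i)
  let e : Fin n → ℝ ≃o ℝ := fun i => (hmono i).orderIsoOfSurjective _ (hsurj i)
  have hvel : ∀ x, D'.vel x = fderiv ℝ h (D.pt (x.1, φ x.1 x.2))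
      (deriv (φ x.1) x.2 • D.vel (x.1, φ x.1 x.2)) := by
    intro x
    have h1 : HasDerivAt (φ x.1) (deriv (φ x.1) x.2) x.2 :=
      ((hφ x.1).differentiable (by simp) x.2).hasDerivAt
    have h2 : HasDerivAt (D.curve x.1) (D.vel (x.1, φ x.1 x.2)) (φ x.1 x.2) :=
      ((D.smooth x.1).differentiable (by simp) _).hasDerivAt
    have h3 : HasFDerivAt h (fderiv ℝ h (D.pt (x.1, φ x.1 x.2))) (D.curve x.1 (φ x.1 x.2)) :=
      (hh.differentiable (by simp) _).hasFDerivAt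
    have h4 := h3.comp_hasDerivAt x.2 (h2.scomp x.2 h1)
    have h5 : D'.curve x.1 = fun t => h (D.curve x.1 (φ x.1 t)) := funext (hcurve x.1)
    rw [vel, h5]
    exact h4.deriv
  have hR : ∀ y x ε, D'.Under y x ε ↔ D.Under (y.1, e y.1 y.2) (x.1, e x.1 x.2) ε := by
    intro y x ε
    refine and_congr_right_iff.mpr ?_ |>.trans (and_congr_left fun _ => hover y x)
    intro ho
    -- Both strands pass through one point, so one derivative of `h` acts on both velocities and its
    -- positive determinant preserves the sign.
    have hm : D.pt (y.1, φ y.1 y.2) = D.pt (x.1, φ x.1 x.2) :=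
      (D.over_meets _ _ ((hover y x).mp ho)).1
    rw [hvel, hvel, hm, cross_map, cross_smul_smul]
    have hpos : 0 < deriv (φ y.1) y.2 * deriv (φ x.1) x.2 := mul_pos (hφ' _ _) (hφ' _ _)
    rw [sign_mul, sign_mul, sign_pos (hdet _), sign_pos hpos, one_mul, one_mul]
    rfl
  refine ⟨fun hc => hc.reparam e hφ1 hR, fun hc => hc.reparam (fun i => (e i).symm) ?_ ?_⟩
  · intro i t
    rw [OrderIso.symm_apply_eq]
    change t + 1 = φ i _
    rw [hφ1]
    congr 1
    exact ((e i).apply_symm_apply t).symm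
  · intro y x ε
    rw [hR]
    simp

end Moves

/-! ### Recolouring the strands of a local change -/

namespace Strands

variable {n k : ℕ} (S : Strands n k)

/-- The point `x` lies on the part of a strand `s` with parameters from `α s` to `β s`. -/
def Within (α β : Fin k → ℝ) (x : Param n) : Prop :=
  ∃ s t, t ∈ Set.Icc (α s) (β s) ∧ SamePoint x (S.param s t)

theorem Inside.mem_Icc {S : Strands n k} {s : Fin k} {t : ℝ} (h : S.Inside s t) :
    t ∈ Set.Icc (S.lo s) (S.hi s) := Set.Ioo_subset_Icc_self h

/-- A strand is shorter than a full turn, so it meets no integer translate of itself. -/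
theorem eq_of_samePoint {s s' : Fin k} {t t' : ℝ} (ht : t ∈ Set.Icc (S.lo s) (S.hi s))
    (ht' : t' ∈ Set.Icc (S.lo s') (S.hi s')) (h : SamePoint (S.param s t) (S.param s' t')) :
    s = s' ∧ t = t' := by
  have hs := S.disjoint s s' t t' ht ht' h
  subst hs
  refine ⟨rfl, ?_⟩
  obtain ⟨-, m, hm⟩ := h
  simp only [param] at hm
  have h1 := S.hi_lt s
  have h2 : (m : ℝ) < 1 := by linarith [ht.1, ht'.2]
  have h3 : (-1 : ℝ) < m := by linarith [ht.2, ht'.1]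
  have h4 : m = 0 := by
    have h2' : m < 1 := by exact_mod_cast h2
    have h3' : -1 < m := by exact_mod_cast h3
    omega
  rw [hm, h4]
  simp

/-- On the circle the set is a finite union of images of compact intervals. -/
theorem isClosed_within (α β : Fin k → ℝ) (i : Fin n) :
    IsClosed {t : ℝ | S.Within α β (i, t)} := by
  have h : {t : ℝ | S.Within α β (i, t)} = ⋃ s : Fin k, {t : ℝ | S.comp s = i ∧
      (t : AddCircle (1 : ℝ)) ∈ ((↑) : ℝ → AddCircle (1 : ℝ)) '' Set.Icc (α s) (β s)} := by
    ext t
    simp only [Within, Set.mem_ofPred_eq, Set.mem_iUnion, Set.mem_image]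
    refine exists_congr fun s => ⟨?_, ?_⟩
    · rintro ⟨r, hr, h1, m, h2⟩
      refine ⟨h1.symm, r, hr, ?_⟩
      simp only [param] at h2
      rw [h2]
      simp
    · rintro ⟨h1, r, hr, h2⟩
      rw [QuotientAddGroup.eq_iff_sub_mem, AddSubgroup.mem_zmultiples_iff] at h2
      obtain ⟨m, hm⟩ := h2
      refine ⟨r, hr, h1.symm, m, ?_⟩
      simp only [param]
      simp at hm
      linarith
  rw [h]
  refine isClosed_iUnion_of_finite fun s => ?_
  by_cases hs : S.comp s = i
  · simp only [hs, true_and]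
    exact ((isCompact_Icc.image (AddCircle.continuous_mk' 1)).isClosed).preimage
      (AddCircle.continuous_mk' 1)
  · simp [hs]

end Strands

section Surgery

variable {n k : ℕ} {Q Y : Type} [Group Q] {P : Palette n Q Y} {D D' : VirtualLinkDiagram n}
  {δ : Set Plane} {S : Strands n k}

/-- Gluing: the old colouring is kept outside the strands and replaced by `φ` on them. All classical
crossings lie in the cores `[α s, β s]`; on the margins between core and ends the two colourings
agree, so every point has a neighbourhood governed by only one of them. -/
theorem LocalChange.colorable_of_recoloring (hL : LocalChange D D' δ S) {c : Param n → Y}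
    (hc : IsColoring P D.Under c) {α β : Fin k → ℝ} (hα : ∀ s, S.lo s < α s)
    (hβ : ∀ s, β s < S.hi s)
    (hD : ∀ y x ε, D.Under y x ε → S.Contains x → S.Within α β x)
    (hD' : ∀ y x ε, D'.Under y x ε → S.Contains x → S.Within α β y ∧ S.Within α β x)
    {φ : Fin k → ℝ → Y}
    (hφ : ∀ s t, S.Inside s t → t ∉ Set.Icc (α s) (β s) → φ s t = c (S.param s t))
    (hvalid : ∀ s t, S.Inside s t → P.valid (S.comp s) (φ s t))
    (hleft : ∀ s t, S.Inside s t → ∀ᶠ r in 𝓝[<] t, φ s r = φ s t)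
    (hright : ∀ s t, S.Inside s t → (∀ y ε, ¬ D'.Under y (S.param s t) ε) →
      ∀ᶠ r in 𝓝[>] t, φ s r = φ s t)
    (hunder : ∀ s t s' t' ε, S.Inside s t → S.Inside s' t' →
      D'.Under (S.param s' t') (S.param s t) ε → ∀ᶠ r in 𝓝[>] t,
        φ s r = P.act (S.comp s) (φ s t) (P.overElt (S.comp s') (φ s' t') ^ ε)) :
    Colorable P D' := by
  classical
  have hins : ∀ {s t}, t ∈ Set.Icc (α s) (β s) → S.Inside s t := fun {s t} ht =>
    ⟨(hα s).trans_le ht.1, ht.2.trans_lt (hβ s)⟩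
  have hcont : ∀ {x}, S.Within α β x → S.Contains x := by
    rintro x ⟨s, t, ht, hx⟩
    exact ⟨s, t, (hins ht).mem_Icc, hx⟩
  -- The pair records a strand and the number of turns by which the parameter is translated from it;
  -- it is unique when it exists.
  let p : Param n → Fin k × ℤ → Prop := fun x q => S.comp q.1 = x.1 ∧ S.Inside q.1 (x.2 - q.2)
  let c' : Param n → Y := fun x => if h : ∃ q, p x q then
    (P.shift x.1 ^ h.choose.2) (φ h.choose.1 (x.2 - h.choose.2)) else c x
  have huniq : ∀ {x q q'}, p x q → p x q' → q = q' := by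
    rintro ⟨i, t⟩ ⟨s, m⟩ ⟨s', m'⟩ ⟨h1, h2⟩ ⟨h1', h2'⟩
    have := S.eq_of_samePoint h2.mem_Icc h2'.mem_Icc
      ⟨h1.trans h1'.symm, m - m', by simp only [Strands.param]; push_cast; ring⟩
    have e : (m : ℝ) = m' := by linarith [this.2]
    exact Prod.ext this.1 (by exact_mod_cast e)
  have hin : ∀ {x q}, p x q → c' x = (P.shift x.1 ^ q.2) (φ q.1 (x.2 - q.2)) := by
    intro x q hq
    have h : ∃ q, p x q := ⟨q, hq⟩
    simp only [c', dif_pos h, huniq h.choose_spec hq]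
  have hin0 : ∀ {s t}, S.Inside s t → c' (S.param s t) = φ s t := by
    intro s t ht
    have : p (S.param s t) (s, 0) := ⟨rfl, by simpa [Strands.param] using ht⟩
    rw [hin this]
    simp [Strands.param]
  have hout : ∀ {x}, ¬ S.Within α β x → c' x = c x := by
    intro x hx
    by_cases h : ∃ q, p x q
    · obtain ⟨q, hq⟩ := h
      rw [hin hq, hφ _ _ hq.2 fun hm => hx ⟨q.1, _, hm, hq.1.symm, -q.2, by
        simp only [Strands.param]; push_cast; ring⟩]
      have := shift_int hc.shift (S.comp q.1) (x.2 - q.2) q.2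
      rw [sub_add_cancel, hq.1] at this
      rw [Strands.param, hq.1]
      exact this.symm
    · simp only [c', dif_neg h]
  have hshift : ∀ i t, c' (i, t + 1) = P.shift i (c' (i, t)) := by
    intro i t
    by_cases h : ∃ q, p (i, t) q
    · obtain ⟨q, hq⟩ := h
      have e : t + 1 - ((q.2 + 1 : ℤ) : ℝ) = t - q.2 := by push_cast; ring
      have hq' : p (i, t + 1) (q.1, q.2 + 1) := ⟨hq.1, by dsimp only; rw [e]; exact hq.2⟩
      rw [hin hq, hin hq']
      dsimp only
      rw [e, add_comm, zpow_one_add, Equiv.Perm.mul_apply]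
    · have h' : ¬ ∃ q, p (i, t + 1) q := by
        rintro ⟨q, hq⟩
        refine h ⟨(q.1, q.2 - 1), hq.1, ?_⟩
        have e : t - ((q.2 - 1 : ℤ) : ℝ) = t + 1 - q.2 := by push_cast; ring
        dsimp only
        rw [e]
        exact hq.2
      simp only [c', dif_neg h, dif_neg h', hc.shift]
  refine ⟨c', hshift, fun i t => ?_⟩
  by_cases hM : S.Within α β (i, t)
  · obtain ⟨s, r, hr, h1, m, hm⟩ := hM
    simp only [Strands.param] at h1 hm
    subst h1
    refine LocalRule.of_add_int hshift (fun y x x' ε h h' => h'.congr (.refl _) h) (m := m) ?_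
    rw [← hm]
    clear hm
    have hri := hins hr
    have hnear : ∀ᶠ u in 𝓝 r, c' (S.comp s, u) = φ s u := by
      filter_upwards [Ioo_mem_nhds hri.1 hri.2] with u hu
      exact hin0 hu
    have e0 : c' (S.comp s, r) = φ s r := hin0 hri
    refine ⟨?_, ?_, fun hn => ?_, fun y ε hy => ?_⟩
    · rw [e0]
      exact hvalid s r hri
    · filter_upwards [hnear.filter_mono nhdsWithin_le_nhds, hleft s r hri] with u h1 h2
      rw [h1, h2, e0]
    · filter_upwards [hnear.filter_mono nhdsWithin_le_nhds, hright s r hri hn] with u h1 h2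
      rw [h1, h2, e0]
    · obtain ⟨⟨s', r', hr', hy'⟩, -⟩ := hD' _ _ _ hy ⟨s, r, hri.mem_Icc, .refl _⟩
      have := hunder s r s' r' ε hri (hins hr') (hy.congr hy' (.refl _))
      rw [overElt_samePoint hshift hy', hin0 (hins hr')]
      filter_upwards [hnear.filter_mono nhdsWithin_le_nhds, this] with u h1 h2
      rw [h1, h2, e0]
      rfl
  · have hnear : ∀ᶠ u in 𝓝 t, c' (i, u) = c (i, u) := by
      filter_upwards [(S.isClosed_within α β i).isOpen_compl.mem_nhds hM] with u hu
      exact hout hu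
    have e0 := hout hM
    have hr := hc.rule i t
    have hun : ∀ y ε, D'.Under y (i, t) ε → ¬ S.Contains (i, t) := fun y ε hy hx =>
      hM (hD' _ _ _ hy hx).2
    refine ⟨?_, ?_, fun hn => ?_, fun y ε hy => ?_⟩
    · rw [e0]
      exact hr.valid
    · filter_upwards [hnear.filter_mono nhdsWithin_le_nhds, hr.left] with u h1 h2
      rw [h1, h2, e0]
    · have := hr.right fun y ε hy => by
        by_cases hx : S.Contains (i, t)
        · exact hM (hD _ _ _ hy hx)
        · exact hn y ε ((hL.under_iff hx).mp hy)
      filter_upwards [hnear.filter_mono nhdsWithin_le_nhds, this] with u h1 h2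
      rw [h1, h2, e0]
    · have hx := hun y ε hy
      have hyM : ¬ S.Within α β y := fun h =>
        hx ((hL.symm.contains_of_under hy).mp (hcont h))
      have := hr.under y ε ((hL.under_iff hx).mpr hy)
      rw [hout hyM]
      filter_upwards [hnear.filter_mono nhdsWithin_le_nhds, this] with u h1 h2
      rw [h1, h2, e0]

/-! ### Strands with at most two under-crossings -/

/-- The holonomy along a strand with the jumps `g` at `a` and `h` at `b`. -/
noncomputable def twoStep (a b : ℝ) (g h : Q) (t : ℝ) : Q :=
  (if a < t then g else 1) * (if b < t then h else 1)

theorem twoStep_left (a b : ℝ) (g h : Q) (t : ℝ) :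
    ∀ᶠ r in 𝓝[<] t, twoStep a b g h r = twoStep a b g h t := by
  have key : ∀ a : ℝ, ∀ᶠ r in 𝓝[<] t, (a < r ↔ a < t) := by
    intro a
    by_cases h : a < t
    · filter_upwards [Ioo_mem_nhdsLT h] with r hr
      exact iff_of_true hr.1 h
    · filter_upwards [self_mem_nhdsWithin] with r hr
      exact iff_of_false (fun h' => h (h'.trans hr)) h
  filter_upwards [key a, key b] with r h1 h2
  simp only [twoStep, h1, h2]

theorem twoStep_right (a b : ℝ) (g h : Q) (t : ℝ) : ∀ᶠ r in 𝓝[>] t,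
    twoStep a b g h r = (if a ≤ t then g else 1) * (if b ≤ t then h else 1) := by
  have key : ∀ a : ℝ, ∀ᶠ r in 𝓝[>] t, (a < r ↔ a ≤ t) := by
    intro a
    by_cases h : a ≤ t
    · filter_upwards [self_mem_nhdsWithin] with r hr
      exact iff_of_true (h.trans_lt hr) h
    · filter_upwards [Ioo_mem_nhdsGT (not_le.mp h)] with r hr
      exact iff_of_false (fun h' => lt_asymm h' hr.2) h
  filter_upwards [key a, key b] with r h1 h2
  simp only [twoStep, h1, h2]

theorem twoStep_of_le {a b : ℝ} (hab : a < b) {g h : Q} {t : ℝ} (ht : t ≤ a) :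
    twoStep a b g h t = 1 := by
  simp [twoStep, not_lt.mpr ht, not_lt.mpr (ht.trans hab.le)]

theorem twoStep_of_lt {a b : ℝ} (hab : a < b) {g h : Q} {t : ℝ} (ht : b < t) :
    twoStep a b g h t = g * h := by
  simp [twoStep, ht, hab.trans ht]

/-- The colour of a point of a strand. -/
noncomputable def strandColor (P : Palette n Q Y) (S : Strands n k) (y₀ : Fin k → Y)
    (a b : Fin k → ℝ) (g h : Fin k → Q) (s : Fin k) (t : ℝ) : Y :=
  P.act (S.comp s) (y₀ s) (twoStep (a s) (b s) (g s) (h s) t)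

/-- The jumps at the parameters `a s` and `b s` of the strand `s` are `g s` and `h s`, if the
strands are coloured by `y₀` at the beginning. -/
structure HasJumps (P : Palette n Q Y) (D : VirtualLinkDiagram n) (S : Strands n k)
    (y₀ : Fin k → Y) (a b : Fin k → ℝ) (g h : Fin k → Q) : Prop where
  lt : ∀ s, a s < b s
  left_inside : ∀ s, S.Inside s (a s)
  right_inside : ∀ s, S.Inside s (b s)
  -- The strands are numbered from top to bottom; `s' < s` makes it possible to determine their
  -- colours recursively.
  under : ∀ s t s' t' ε, S.Inside s t → S.Inside s' t' → D.Under (S.param s' t') (S.param s t) ε →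
    s' < s ∧
    ((t = a s ∧ g s = P.overElt (S.comp s') (strandColor P S y₀ a b g h s' t') ^ ε) ∨
      (t = b s ∧ h s = P.overElt (S.comp s') (strandColor P S y₀ a b g h s' t') ^ ε))
  -- A jump parameter need not be a crossing, provided its jump is trivial; this pads strands with
  -- fewer than two crossings.
  left_jump : ∀ s, g s = 1 ∨ ∃ y ε, D.Under y (S.param s (a s)) ε
  right_jump : ∀ s, h s = 1 ∨ ∃ y ε, D.Under y (S.param s (b s)) ε

/-- All classical crossings on the strands lie at the parameters in `F`. -/
def CrossingsAt (D : VirtualLinkDiagram n) (S : Strands n k) (F : Fin k → Finset ℝ) : Prop :=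
  (∀ s, ∀ t ∈ F s, S.Inside s t) ∧
  ∀ y x ε, D.Under y x ε → S.Contains x → (∃ s, ∃ t ∈ F s, SamePoint y (S.param s t)) ∧
    ∃ s, ∃ t ∈ F s, SamePoint x (S.param s t)

theorem HasJumps.rule {y₀ : Fin k → Y} {a b : Fin k → ℝ} {g h : Fin k → Q}
    (hJ : HasJumps P D S y₀ a b g h) :
    (∀ s t, S.Inside s t → ∀ᶠ r in 𝓝[<] t,
      strandColor P S y₀ a b g h s r = strandColor P S y₀ a b g h s t) ∧
    (∀ s t, (∀ y ε, ¬ D.Under y (S.param s t) ε) → ∀ᶠ r in 𝓝[>] t,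
      strandColor P S y₀ a b g h s r = strandColor P S y₀ a b g h s t) ∧
    (∀ s t s' t' ε, S.Inside s t → S.Inside s' t' → D.Under (S.param s' t') (S.param s t) ε →
      ∀ᶠ r in 𝓝[>] t, strandColor P S y₀ a b g h s r =
        P.act (S.comp s) (strandColor P S y₀ a b g h s t)
          (P.overElt (S.comp s') (strandColor P S y₀ a b g h s' t') ^ ε)) := by
  refine ⟨fun s t _ => ?_, fun s t hn => ?_, fun s t s' t' ε ht ht' hu => ?_⟩
  · filter_upwards [twoStep_left (a s) (b s) (g s) (h s) t] with r hr
    rw [strandColor, strandColor, hr]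
  · filter_upwards [twoStep_right (a s) (b s) (g s) (h s) t] with r hr
    rw [strandColor, strandColor, hr, twoStep]
    have h1 : (if a s ≤ t then g s else 1) = (if a s < t then g s else 1) := by
      rcases lt_trichotomy (a s) t with h | rfl | h
      · simp [h, h.le]
      · rcases hJ.left_jump s with h | ⟨y, ε, h⟩
        · simp [h]
        · exact absurd h (hn y ε)
      · simp [not_le.mpr h, not_lt.mpr h.le]
    have h2 : (if b s ≤ t then h s else 1) = (if b s < t then h s else 1) := by
      rcases lt_trichotomy (b s) t with h | rfl | h
      · simp [h, h.le]
      · rcases hJ.right_jump s with h | ⟨y, ε, h⟩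
        · simp [h]
        · exact absurd h (hn y ε)
      · simp [not_le.mpr h, not_lt.mpr h.le]
    rw [h1, h2]
  · have hlt := hJ.lt s
    filter_upwards [twoStep_right (a s) (b s) (g s) (h s) t] with r hr
    rcases (hJ.under s t s' t' ε ht ht' hu).2 with ⟨rfl, h1⟩ | ⟨rfl, h1⟩
    · rw [← h1]
      simp only [strandColor, hr]
      rw [← P.act_mul, twoStep_of_le hlt le_rfl]
      simp [not_le.mpr hlt]
    · rw [← h1]
      simp only [strandColor, hr]
      rw [← P.act_mul]
      simp [twoStep, hlt, hlt.le]

/-- Induction from the top strand down: once the higher strands are known, the jumps of a strand are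
forced, so the initial colours determine everything in the disk. -/
theorem HasJumps.color_eq {F : Fin k → Finset ℝ} {c : Param n → Y} {y₀ : Fin k → Y}
    {a b : Fin k → ℝ} {g h : Fin k → Q} (hJ : HasJumps P D S y₀ a b g h) (hF : CrossingsAt D S F)
    (hc : IsColoring P D.Under c) (hy₀ : ∀ s, y₀ s = c (S.param s (S.lo s))) (s : Fin k) :
    ∀ t ∈ Set.Icc (S.lo s) (S.hi s), c (S.param s t) = strandColor P S y₀ a b g h s t := by
  induction s using WellFoundedLT.induction with
  | ind s ih =>
  have hcr : ∀ t ∈ Set.Icc (S.lo s) (S.hi s), ∀ y ε, D.Under y (S.param s t) ε → S.Inside s t ∧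
      ((t = a s ∧ g s = P.overElt y.1 (c y) ^ ε) ∨ (t = b s ∧ h s = P.overElt y.1 (c y) ^ ε)) := by
    intro t ht y ε hy
    obtain ⟨⟨s', t', ht', hys⟩, ⟨s'', t'', ht'', hxs⟩⟩ := hF.2 _ _ _ hy ⟨s, t, ht, .refl _⟩
    obtain ⟨rfl, rfl⟩ := S.eq_of_samePoint ht (hF.1 _ _ ht'').mem_Icc hxs
    have h1 := hF.1 _ _ ht'
    have h2 := hF.1 _ _ ht''
    obtain ⟨h3, h4⟩ := hJ.under _ _ _ _ ε h2 h1 (hy.congr hys (.refl _))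
    rw [overElt_samePoint hc.shift hys]
    rw [← ih s' h3 _ h1.mem_Icc] at h4
    exact ⟨h2, h4⟩
  have hlt := hJ.lt s
  have ha := hJ.left_inside s
  have hb := hJ.right_inside s
  have step1 : ∀ t ∈ Set.Icc (S.lo s) (a s), c (S.param s t) = y₀ s := by
    intro t ht
    rw [hy₀]
    refine hc.const ht.1 fun r hr y ε hy => ?_
    have hra : r < a s := hr.2.trans_le ht.2
    rcases (hcr r ⟨hr.1, (hra.trans ha.2).le⟩ y ε hy).2 with ⟨h1, -⟩ | ⟨h1, -⟩ <;> linarith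
  have step2 : ∀ t ∈ Set.Ioc (a s) (b s), c (S.param s t) = P.act (S.comp s) (y₀ s) (g s) := by
    intro t ht
    have hno : ∀ r ∈ Set.Ico (a s) t, r ≠ a s → ∀ y ε, ¬ D.Under y (S.param s r) ε := by
      intro r hr hne y ε hy
      have hrb : r < b s := hr.2.trans_le ht.2
      rcases (hcr r ⟨ha.1.le.trans hr.1, (hrb.trans hb.2).le⟩ y ε hy).2 with ⟨h1, -⟩ | ⟨h1, -⟩
      · exact hne h1
      · linarith
    rw [← step1 (a s) ⟨ha.1.le, le_rfl⟩]
    by_cases hu : ∃ y ε, D.Under y (S.param s (a s)) ε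
    · obtain ⟨y, ε, hy⟩ := hu
      have hj := hc.jump le_rfl ht.1 hy hno
      rcases (hcr _ ha.mem_Icc y ε hy).2 with ⟨-, h1⟩ | ⟨h1, -⟩
      · rw [h1]; exact hj
      · linarith
    · rw [(hJ.left_jump s).resolve_right hu, P.act_one]
      refine hc.const ht.1.le fun r hr y ε hy => ?_
      by_cases hra : r = a s
      · subst hra; exact hu ⟨y, ε, hy⟩
      · exact hno r hr hra y ε hy
  have step3 : ∀ t ∈ Set.Ioc (b s) (S.hi s),
      c (S.param s t) = P.act (S.comp s) (y₀ s) (g s * h s) := by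
    intro t ht
    have hno : ∀ r ∈ Set.Ico (b s) t, r ≠ b s → ∀ y ε, ¬ D.Under y (S.param s r) ε := by
      intro r hr hne y ε hy
      rcases (hcr r ⟨hb.1.le.trans hr.1, hr.2.le.trans ht.2⟩ y ε hy).2 with ⟨h1, -⟩ | ⟨h1, -⟩
      · linarith [hr.1]
      · exact hne h1
    rw [P.act_mul, ← step2 (b s) ⟨hlt, le_rfl⟩]
    by_cases hu : ∃ y ε, D.Under y (S.param s (b s)) ε
    · obtain ⟨y, ε, hy⟩ := hu
      have hj := hc.jump le_rfl ht.1 hy hno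
      rcases (hcr _ hb.mem_Icc y ε hy).2 with ⟨h1, -⟩ | ⟨-, h1⟩
      · linarith
      · rw [h1]; exact hj
    · rw [(hJ.right_jump s).resolve_right hu, P.act_one]
      refine hc.const ht.1.le fun r hr y ε hy => ?_
      by_cases hra : r = b s
      · subst hra; exact hu ⟨y, ε, hy⟩
      · exact hno r hr hra y ε hy
  intro t ht
  rw [strandColor]
  rcases le_or_gt t (a s) with h1 | h1
  · rw [step1 t ⟨ht.1, h1⟩, twoStep_of_le hlt h1, P.act_one]
  · rcases le_or_gt t (b s) with h2 | h2
    · rw [step2 t ⟨h1, h2⟩]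
      simp [twoStep, h1, not_lt.mpr h2]
    · rw [step3 t ⟨h2, ht.2⟩, twoStep_of_lt hlt h2]

theorem exists_Icc_of_finset {lo hi : ℝ} (h : lo < hi) (F : Finset ℝ)
    (hF : ∀ t ∈ F, t ∈ Set.Ioo lo hi) : ∃ α β, lo < α ∧ β < hi ∧ ∀ t ∈ F, t ∈ Set.Icc α β := by
  rcases F.eq_empty_or_nonempty with rfl | hne
  · exact ⟨(lo + hi) / 2, (lo + hi) / 2, by linarith, by linarith, by simp⟩
  · exact ⟨F.min' hne, F.max' hne, (hF _ (F.min'_mem hne)).1, (hF _ (F.max'_mem hne)).2,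
      fun t ht => ⟨F.min'_le t ht, F.le_max' t ht⟩⟩

/-- A local change extends to colourings if the total jumps along the strands agree. -/
theorem LocalChange.colorable_of_hasJumps (hL : LocalChange D D' δ S) {F F' : Fin k → Finset ℝ}
    (hF : CrossingsAt D S F) (hF' : CrossingsAt D' S F')
    (hJ : ∀ y₀ : Fin k → Y, ∃ a b g h a' b' g' h', HasJumps P D S y₀ a b g h ∧
      HasJumps P D' S y₀ a' b' g' h' ∧ ∀ s, g s * h s = g' s * h' s)
    (hc : Colorable P D) : Colorable P D' := by
  classical
  obtain ⟨c, hc⟩ := hc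
  obtain ⟨a, b, g, h, a', b', g', h', hJ, hJ', heq⟩ := hJ fun s => c (S.param s (S.lo s))
  have hcol := hJ.color_eq hF hc fun s => rfl
  have hfin : ∀ s, ∃ α β, S.lo s < α ∧ β < S.hi s ∧
      ∀ t ∈ F s ∪ F' s ∪ {a s, b s, a' s, b' s}, t ∈ Set.Icc α β := by
    intro s
    refine exists_Icc_of_finset (S.lo_lt s) _ fun t ht => ?_
    simp only [Finset.mem_union, Finset.mem_insert, Finset.mem_singleton] at ht
    rcases ht with (ht | ht) | rfl | rfl | rfl | rfl
    · exact hF.1 s t ht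
    · exact hF'.1 s t ht
    · exact hJ.left_inside s
    · exact hJ.right_inside s
    · exact hJ'.left_inside s
    · exact hJ'.right_inside s
  choose α β hα hβ hαβ using hfin
  obtain ⟨r1, r2, r3⟩ := hJ'.rule
  refine hL.colorable_of_recoloring hc hα hβ ?_ ?_ ?_ ?_ r1 (fun s t _ => r2 s t) r3
  · intro y x ε hu hx
    obtain ⟨-, s, t, ht, h⟩ := hF.2 y x ε hu hx
    exact ⟨s, t, hαβ s t (by simp [ht]), h⟩
  · intro y x ε hu hx
    obtain ⟨⟨s', t', ht', h'⟩, s, t, ht, h⟩ := hF'.2 y x ε hu hx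
    exact ⟨⟨s', t', hαβ s' t' (by simp [ht']), h'⟩, s, t, hαβ s t (by simp [ht]), h⟩
  · intro s t hst ht
    rw [hcol s t hst.mem_Icc, strandColor, strandColor]
    congr 1
    have ha := hαβ s (a s) (by simp)
    have hb := hαβ s (b s) (by simp)
    have ha' := hαβ s (a' s) (by simp)
    have hb' := hαβ s (b' s) (by simp)
    rcases lt_or_ge t (α s) with h1 | h1
    · rw [twoStep_of_le (hJ.lt s) (h1.le.trans ha.1), twoStep_of_le (hJ'.lt s) (h1.le.trans ha'.1)]
    · have h2 : β s < t := by
        by_contra h2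
        exact ht ⟨h1, not_lt.mp h2⟩
      rw [twoStep_of_lt (hJ.lt s) (hb.2.trans_lt h2), twoStep_of_lt (hJ'.lt s) (hb'.2.trans_lt h2),
        heq]
  · intro s t _
    exact P.valid_act _ _ _ (hc.rule _ _).valid

theorem CrossingsIn.crossingsAt {l : List (Param n × Param n)} (hl : CrossingsIn D δ l)
    (hδ : ∀ x, D.pt x ∈ δ ↔ S.Contains x) {F : Fin k → Finset ℝ}
    (hF : ∀ s, ∀ t ∈ F s, S.Inside s t)
    (h : ∀ z ∈ l, ∃ s t s' t', t ∈ F s ∧ t' ∈ F s' ∧ z = (S.param s t, S.param s' t')) :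
    CrossingsAt D S F := by
  refine ⟨hF, fun y x ε hu hx => ?_⟩
  obtain ⟨z, hz, hxy⟩ := hl.2 x y (meets_symm hu.meets) ((hδ x).mpr hx)
  obtain ⟨s, t, s', t', ht, ht', rfl⟩ := h z hz
  rcases hxy with ⟨h1, h2⟩ | ⟨h1, h2⟩
  · exact ⟨⟨s', t', ht', h2⟩, s, t, ht, h1⟩
  · exact ⟨⟨s, t, ht, h2⟩, s', t', ht', h1⟩

/-- The crossings of `D` in `δ` at interior points of the strands, if the first strand of each
classical crossing is the over-strand. -/
theorem CrossingsIn.exists_of_under {l : List (Param n × Param n)} (hl : CrossingsIn D δ l)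
    (hδ : ∀ x, D.pt x ∈ δ ↔ S.Contains x)
    (ho : ∀ z ∈ l, ¬ D.IsOver z.2 z.1) {s s' : Fin k} {t t' : ℝ} {ε : ℤ} (ht : S.Inside s t)
    (hu : D.Under (S.param s' t') (S.param s t) ε) :
    ∃ z ∈ l, SamePoint (S.param s t) z.2 ∧ SamePoint (S.param s' t') z.1 ∧
      D.IsOver z.1 z.2 ∧ ε = SignType.sign (cross (D.vel z.1) (D.vel z.2)) := by
  obtain ⟨z, hz, ⟨h1, h2⟩ | ⟨h1, h2⟩⟩ := hl.2 _ _ (meets_symm hu.meets)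
    ((hδ _).mpr ⟨s, t, ht.mem_Icc, .refl _⟩)
  · exact absurd (D.over_congr _ _ _ _ h2 h1 hu.1) (ho z hz)
  · exact ⟨z, hz, h1, h2, hu.congr h2 h1⟩

end Surgery

/-! ### Bigon moves -/

section Bigon

variable {n k : ℕ} {Q Y : Type} [Group Q] {P : Palette n Q Y} {D D' : VirtualLinkDiagram n}
  {δ : Set Plane}

theorem Strands.exists_inside (S : Strands n k) (s : Fin k) :
    ∃ a b, a < b ∧ S.Inside s a ∧ S.Inside s b := by
  have := S.lo_lt s
  exact ⟨(2 * S.lo s + S.hi s) / 3, (S.lo s + 2 * S.hi s) / 3, by linarith,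
    ⟨by linarith, by linarith⟩, ⟨by linarith, by linarith⟩⟩

theorem strandColor_eq {S : Strands n k} {y₀ : Fin k → Y} {a b : Fin k → ℝ} {g h : Fin k → Q}
    {s : Fin k} (hg : g s = 1) (hh : h s = 1) (t : ℝ) :
    strandColor P S y₀ a b g h s t = y₀ s := by
  simp [strandColor, twoStep, hg, hh, P.act_one]

theorem strandColor_eq_act {S : Strands n k} {y₀ : Fin k → Y} {a b : Fin k → ℝ}
    {g h : Fin k → Q} {s : Fin k} (hh : h s = 1) (t : ℝ) :
    strandColor P S y₀ a b g h s t = P.act (S.comp s) (y₀ s) (if a s < t then g s else 1) := by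
  simp [strandColor, twoStep, hh]

theorem exists_hasJumps_of_not_under {S : Strands n k} (y₀ : Fin k → Y)
    (h : ∀ s t y ε, S.Inside s t → ¬ D.Under y (S.param s t) ε) :
    ∃ a b g h, HasJumps P D S y₀ a b g h ∧ ∀ s, g s * h s = 1 := by
  choose a b hab ha hb using S.exists_inside
  exact ⟨a, b, fun _ => 1, fun _ => 1, ⟨hab, ha, hb,
    fun s t s' t' ε ht _ hu => absurd hu (h s t _ ε ht), fun _ => .inl rfl, fun _ => .inl rfl⟩,
    fun _ => mul_one 1⟩

/-- The lower strand passes twice under a strand of constant colour with opposite signs, and the two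
jumps cancel. -/
theorem exists_hasJumps_bigon {S : Strands n 2} (y₀ : Fin 2 → Y) {u₁ u₂ : ℝ} {e₁ e₂ : ℤ}
    (h₁ : S.Inside 1 u₁) (h₂ : S.Inside 1 u₂) (hlt : u₁ < u₂) (he : e₂ = -e₁)
    (hu : ∀ s t s' t' ε, S.Inside s t → S.Inside s' t' → D.Under (S.param s' t') (S.param s t) ε →
      s' = 0 ∧ s = 1 ∧ (t = u₁ ∧ ε = e₁ ∨ t = u₂ ∧ ε = e₂))
    (hu₁ : ∃ y ε, D.Under y (S.param 1 u₁) ε) (hu₂ : ∃ y ε, D.Under y (S.param 1 u₂) ε) :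
    ∃ a b g h, HasJumps P D S y₀ a b g h ∧ ∀ s, g s * h s = 1 := by
  obtain ⟨a₀, b₀, hab, ha, hb⟩ := S.exists_inside 0
  set x := P.overElt (S.comp 0) (y₀ 0) with hx
  refine ⟨![a₀, u₁], ![b₀, u₂], ![1, x ^ e₁], ![1, x ^ e₂], ⟨?_, ?_, ?_, ?_, ?_, ?_⟩, ?_⟩
  · simp [Fin.forall_fin_two, hab, hlt]
  · simp [Fin.forall_fin_two, ha, h₁]
  · simp [Fin.forall_fin_two, hb, h₂]
  · intro s t s' t' ε ht ht' h
    obtain ⟨rfl, rfl, h'⟩ := hu s t s' t' ε ht ht' h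
    refine ⟨by simp, ?_⟩
    rw [strandColor_eq rfl rfl, ← hx]
    rcases h' with ⟨rfl, rfl⟩ | ⟨rfl, rfl⟩
    · exact .inl ⟨rfl, rfl⟩
    · exact .inr ⟨rfl, rfl⟩
  · intro s; fin_cases s
    exacts [.inl rfl, .inr hu₁]
  · intro s; fin_cases s
    exacts [.inl rfl, .inr hu₂]
  · simp [Fin.forall_fin_two, he]

theorem sign_eq_neg_of_mul_neg {a b : ℝ} (h : a * b < 0) :
    ((SignType.sign b : SignType) : ℤ) = -((SignType.sign a : SignType) : ℤ) := by
  rcases mul_neg_iff.mp h with ⟨h1, h2⟩ | ⟨h1, h2⟩ <;> simp [h1, h2]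

theorem sign_eq_of_mul_pos {a b : ℝ} (h : 0 < a * b) :
    SignType.sign a = SignType.sign b := by
  rcases mul_pos_iff.mp h with ⟨h1, h2⟩ | ⟨h1, h2⟩ <;> simp [h1, h2]

theorem BigonMove.colorable_iff (h : BigonMove .classical D D') :
    Colorable P D ↔ Colorable P D' := by
  classical
  obtain ⟨δ, S, hL, hD, t₁, t₂, u₁, u₂, ht₁, ht₂, hu₁, hu₂, -, hne, hD', h1, h2, hsign⟩ := h
  have hF : CrossingsAt D S fun _ => ∅ := hD.crossingsAt hL.left (by simp) (by simp)
  have hF' : CrossingsAt D' S ![{t₁, t₂}, {u₁, u₂}] := by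
    refine hD'.crossingsAt hL.right ?_ ?_
    · simp [Fin.forall_fin_two, ht₁, ht₂, hu₁, hu₂]
    · simp only [List.mem_cons, List.not_mem_nil, or_false, forall_eq_or_imp, forall_eq]
      exact ⟨⟨0, t₁, 1, u₁, by simp⟩, ⟨0, t₂, 1, u₂, by simp⟩⟩
  have hJ : ∀ y₀ : Fin 2 → Y, ∃ a b g h, HasJumps P D S y₀ a b g h ∧ ∀ s, g s * h s = 1 := by
    refine fun y₀ => exists_hasJumps_of_not_under y₀ fun s t y ε ht hu => ?_
    obtain ⟨z, hz, -⟩ := hD.2 _ _ (meets_symm hu.meets)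
      ((hL.left _).mpr ⟨s, t, ht.mem_Icc, .refl _⟩)
    simp at hz
  have hJ' : ∀ y₀ : Fin 2 → Y, ∃ a b g h, HasJumps P D' S y₀ a b g h ∧ ∀ s, g s * h s = 1 := by
    intro y₀
    have hu : ∀ s t s' t' ε, S.Inside s t → S.Inside s' t' →
        D'.Under (S.param s' t') (S.param s t) ε → s' = 0 ∧ s = 1 ∧
          (t = u₁ ∧ ε = SignType.sign (cross (D'.vel (S.param 0 t₁)) (D'.vel (S.param 1 u₁))) ∨
          t = u₂ ∧ ε = SignType.sign (cross (D'.vel (S.param 0 t₂)) (D'.vel (S.param 1 u₂)))) := by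
      intro s t s' t' ε ht ht' hu
      obtain ⟨z, hz, hs, hs', -, hε⟩ := hD'.exists_of_under hL.right (by
        simp only [List.mem_cons, List.not_mem_nil, or_false, forall_eq_or_imp, forall_eq]
        exact ⟨D'.over_asymm _ _ h1, D'.over_asymm _ _ h2⟩) ht hu
      simp only [List.mem_cons, List.not_mem_nil, or_false] at hz
      rcases hz with rfl | rfl
      · obtain ⟨rfl, rfl⟩ := S.eq_of_samePoint ht.mem_Icc hu₁.mem_Icc hs
        obtain ⟨rfl, rfl⟩ := S.eq_of_samePoint ht'.mem_Icc ht₁.mem_Icc hs'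
        exact ⟨rfl, rfl, .inl ⟨rfl, hε⟩⟩
      · obtain ⟨rfl, rfl⟩ := S.eq_of_samePoint ht.mem_Icc hu₂.mem_Icc hs
        obtain ⟨rfl, rfl⟩ := S.eq_of_samePoint ht'.mem_Icc ht₂.mem_Icc hs'
        exact ⟨rfl, rfl, .inr ⟨rfl, hε⟩⟩
    have he := sign_eq_neg_of_mul_neg hsign
    have he' := neg_eq_iff_eq_neg.mp he.symm
    -- The lower strand may meet the two crossings in either order; the hypotheses are symmetric
    -- under exchanging them.
    rcases hne.lt_or_gt with hlt | hlt
    · exact exists_hasJumps_bigon y₀ hu₁ hu₂ hlt he hu ⟨_, _, h1, rfl⟩ ⟨_, _, h2, rfl⟩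
    · refine exists_hasJumps_bigon y₀ hu₂ hu₁ hlt he' (fun s t s' t' ε ht ht' h => ?_)
        ⟨_, _, h2, rfl⟩ ⟨_, _, h1, rfl⟩
      obtain ⟨h3, h4, h5⟩ := hu s t s' t' ε ht ht' h
      exact ⟨h3, h4, h5.symm⟩
  constructor
  · refine hL.colorable_of_hasJumps hF hF' fun y₀ => ?_
    obtain ⟨a, b, g, h, h3, h4⟩ := hJ y₀
    obtain ⟨a', b', g', h', h3', h4'⟩ := hJ' y₀
    exact ⟨a, b, g, h, a', b', g', h', h3, h3', fun s => (h4 s).trans (h4' s).symm⟩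
  · refine hL.symm.colorable_of_hasJumps hF' hF fun y₀ => ?_
    obtain ⟨a, b, g, h, h3, h4⟩ := hJ y₀
    obtain ⟨a', b', g', h', h3', h4'⟩ := hJ' y₀
    exact ⟨a', b', g', h', a, b, g, h, h3', h3, fun s => (h4' s).trans (h4 s).symm⟩

end Bigon

/-! ### Triangle moves -/

/-- The exponent of a crossing of the given type in the holonomy of the lower strand. -/
noncomputable def CrossingType.exponent : CrossingType → ℝ → ℤ
  | .classical, r => SignType.sign r
  | .virtual, _ => 0

open scoped Classical in
/-- The holonomy along the lowest strand of a triangle: `x` and `y` are the colours of the upper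
and of the middle strand, `p` says that the middle strand meets the upper one before the lower one,
and `q` that the lowest strand meets the upper one before the middle one. -/
noncomputable def triangleHolonomy {Q : Type} [Group Q] (x y : Q) (e₀₁ e₀₂ e₁₂ : ℤ) (p q : Prop) :
    Q :=
  if q then x ^ e₀₂ * (if p then (x ^ e₀₁)⁻¹ * y * x ^ e₀₁ else y) ^ e₁₂
  else (if p then (x ^ e₀₁)⁻¹ * y * x ^ e₀₁ else y) ^ e₁₂ * x ^ e₀₂

section Triangle

variable {n : ℕ} {Q Y : Type} [Group Q] {P : Palette n Q Y} {D D' : VirtualLinkDiagram n}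
  {δ : Set Plane} {S : Strands n 3} {c₀₁ c₀₂ c₁₂ : CrossingType} {κ : ℝ} {τ : Fin 3 → Fin 3 → ℝ}

theorem conj_inv_zpow (g y : Q) (m : ℤ) : (g⁻¹ * y * g) ^ m = g⁻¹ * y ^ m * g := by
  have := conj_zpow (a := g⁻¹) (b := y) (i := m)
  rwa [inv_inv] at this

/-- The move reverses both orders. With equal signs the identity is `x^e (x^(-e) y x^e)^f = y^f
x^e`; with opposite signs it is `x^(-e) y^f = (x^(-e) y x^e)^f x^(-e)`. The hypothesis `h` says that
the geometry produces exactly these combinations. -/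
theorem triangleHolonomy_eq (x y : Q) {e₀₁ e₀₂ : ℤ} (e₁₂ : ℤ) {p q p' q' : Prop} (hp : p' ↔ ¬ p)
    (hq : q' ↔ ¬ q) (h : (e₀₂ = e₀₁ ∧ (p ↔ q)) ∨ (e₀₂ = -e₀₁ ∧ (p ↔ ¬ q))) :
    triangleHolonomy x y e₀₁ e₀₂ e₁₂ p q = triangleHolonomy x y e₀₁ e₀₂ e₁₂ p' q' := by
  unfold triangleHolonomy
  rcases h with ⟨rfl, h⟩ | ⟨rfl, h⟩ <;> by_cases hq0 : q <;>
    simp only [hp, hq, h, hq0, not_true, not_false_iff, if_true, if_false, conj_inv_zpow, zpow_neg] <;>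
    simp [mul_assoc]

/-- The crossing vectors of a triangle. -/
noncomputable def triangleCross (D : VirtualLinkDiagram n) (S : Strands n 3)
    (τ : Fin 3 → Fin 3 → ℝ) (i j : Fin 3) : ℝ :=
  cross (D.vel (S.param i (τ i j))) (D.vel (S.param j (τ j i)))

theorem HasType.not_isOver {x y : Param n} {c : CrossingType} (h : HasType D x y c) :
    ¬ D.IsOver y x := by
  cases c with
  | classical => exact D.over_asymm _ _ h
  | virtual => exact h.2.2

theorem HasType.exponent {x y : Param n} {c : CrossingType} (h : HasType D x y c)
    (ho : D.IsOver x y) (r : ℝ) : c.exponent r = SignType.sign r := by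
  cases c with
  | classical => rfl
  | virtual => exact absurd ho h.2.1

theorem HasType.exponent_eq_zero_or {x y : Param n} {c : CrossingType} (h : HasType D x y c)
    (r : ℝ) : c.exponent r = 0 ∨ ∃ z ε, D.Under z y ε := by
  cases c with
  | classical => exact .inr ⟨x, _, h, rfl⟩
  | virtual => exact .inl rfl

theorem Triangle.cases_of_under (h : Triangle D δ S c₀₁ c₀₂ c₁₂ κ τ)
    (hδ : ∀ x, D.pt x ∈ δ ↔ S.Contains x) {s s' : Fin 3} {t t' : ℝ} {ε : ℤ} (ht : S.Inside s t)
    (ht' : S.Inside s' t') (hu : D.Under (S.param s' t') (S.param s t) ε) :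
    (s' = 0 ∧ s = 1 ∧ t' = τ 0 1 ∧ t = τ 1 0 ∧ ε = c₀₁.exponent (triangleCross D S τ 0 1)) ∨
    (s' = 0 ∧ s = 2 ∧ t' = τ 0 2 ∧ t = τ 2 0 ∧ ε = c₀₂.exponent (triangleCross D S τ 0 2)) ∨
    (s' = 1 ∧ s = 2 ∧ t' = τ 1 2 ∧ t = τ 2 1 ∧ ε = c₁₂.exponent (triangleCross D S τ 1 2)) := by
  obtain ⟨z, hz, hs, hs', ho, hε⟩ := h.crossings.exists_of_under hδ (by
    simp only [List.mem_cons, List.not_mem_nil, or_false, forall_eq_or_imp, forall_eq]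
    exact ⟨h.type₀₁.not_isOver, h.type₀₂.not_isOver, h.type₁₂.not_isOver⟩) ht hu
  have hi := fun i j hij => (h.inside i j hij).mem_Icc
  simp only [List.mem_cons, List.not_mem_nil, or_false] at hz
  rcases hz with rfl | rfl | rfl
  · obtain ⟨rfl, rfl⟩ := S.eq_of_samePoint ht.mem_Icc (hi 1 0 (by decide)) hs
    obtain ⟨rfl, rfl⟩ := S.eq_of_samePoint ht'.mem_Icc (hi 0 1 (by decide)) hs'
    exact .inl ⟨rfl, rfl, rfl, rfl, by rw [h.type₀₁.exponent ho, hε]; rfl⟩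
  · obtain ⟨rfl, rfl⟩ := S.eq_of_samePoint ht.mem_Icc (hi 2 0 (by decide)) hs
    obtain ⟨rfl, rfl⟩ := S.eq_of_samePoint ht'.mem_Icc (hi 0 2 (by decide)) hs'
    exact .inr (.inl ⟨rfl, rfl, rfl, rfl, by rw [h.type₀₂.exponent ho, hε]; rfl⟩)
  · obtain ⟨rfl, rfl⟩ := S.eq_of_samePoint ht.mem_Icc (hi 2 1 (by decide)) hs
    obtain ⟨rfl, rfl⟩ := S.eq_of_samePoint ht'.mem_Icc (hi 1 2 (by decide)) hs'
    exact .inr (.inr ⟨rfl, rfl, rfl, rfl, by rw [h.type₁₂.exponent ho, hε]; rfl⟩)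

/-- Equal parameters would create a triple point on the lowest strand. -/
theorem Triangle.ne (h : Triangle D δ S c₀₁ c₀₂ c₁₂ κ τ) : τ 2 0 ≠ τ 2 1 := by
  intro he
  have h1 := h.crossings.1 (S.param 0 (τ 0 2), S.param 2 (τ 2 0)) (by simp)
  have h2 := h.crossings.1 (S.param 1 (τ 1 2), S.param 2 (τ 2 1)) (by simp)
  rw [← he] at h2
  have := (S.eq_of_samePoint (h.inside 0 2 (by decide)).mem_Icc (h.inside 1 2 (by decide)).mem_Icc
    (D.double _ _ _ (meets_symm h1) (meets_symm h2))).1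
  exact absurd this (by decide)

theorem Triangle.exists_hasJumps (h : Triangle D δ S c₀₁ c₀₂ c₁₂ κ τ)
    (hδ : ∀ x, D.pt x ∈ δ ↔ S.Contains x) (y₀ : Fin 3 → Y) :
    ∃ a b g g', HasJumps P D S y₀ a b g g' ∧ g 0 * g' 0 = 1 ∧
      g 1 * g' 1 = P.overElt (S.comp 0) (y₀ 0) ^ c₀₁.exponent (triangleCross D S τ 0 1) ∧
      g 2 * g' 2 = triangleHolonomy (P.overElt (S.comp 0) (y₀ 0)) (P.overElt (S.comp 1) (y₀ 1))
        (c₀₁.exponent (triangleCross D S τ 0 1)) (c₀₂.exponent (triangleCross D S τ 0 2))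
        (c₁₂.exponent (triangleCross D S τ 1 2)) (τ 1 0 < τ 1 2) (τ 2 0 < τ 2 1) := by
  classical
  set x := P.overElt (S.comp 0) (y₀ 0) with hx
  set e₀₁ := c₀₁.exponent (triangleCross D S τ 0 1) with h01
  set e₀₂ := c₀₂.exponent (triangleCross D S τ 0 2) with h02
  set e₁₂ := c₁₂.exponent (triangleCross D S τ 1 2) with h12
  set w := if τ 1 0 < τ 1 2 then (x ^ e₀₁)⁻¹ * P.overElt (S.comp 1) (y₀ 1) * x ^ e₀₁
    else P.overElt (S.comp 1) (y₀ 1) with hw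
  obtain ⟨a₀, b₀, hab, ha, hb⟩ := S.exists_inside 0
  have i10 := h.inside 1 0 (by decide)
  have i20 := h.inside 2 0 (by decide)
  have i21 := h.inside 2 1 (by decide)
  have z02 : x ^ e₀₂ = 1 ∨ ∃ y ε, D.Under y (S.param 2 (τ 2 0)) ε :=
    (h.type₀₂.exponent_eq_zero_or _).imp_left fun h => by rw [h02, h, zpow_zero]
  have z12 : w ^ e₁₂ = 1 ∨ ∃ y ε, D.Under y (S.param 2 (τ 2 1)) ε :=
    (h.type₁₂.exponent_eq_zero_or _).imp_left fun h => by rw [h12, h, zpow_zero]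
  have z01 : x ^ e₀₁ = 1 ∨ ∃ y ε, D.Under y (S.param 1 (τ 1 0)) ε :=
    (h.type₀₁.exponent_eq_zero_or _).imp_left fun h => by rw [h01, h, zpow_zero]
  -- The two jumps of the lowest strand, sorted by parameter.
  obtain ⟨a₂, b₂, g₂, g₂', k1, k2, k3, k4, k5, k6, k7, k8⟩ : ∃ a₂ b₂ g₂ g₂', a₂ < b₂ ∧
      S.Inside 2 a₂ ∧ S.Inside 2 b₂ ∧
      ((τ 2 0 = a₂ ∧ g₂ = x ^ e₀₂) ∨ (τ 2 0 = b₂ ∧ g₂' = x ^ e₀₂)) ∧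
      ((τ 2 1 = a₂ ∧ g₂ = w ^ e₁₂) ∨ (τ 2 1 = b₂ ∧ g₂' = w ^ e₁₂)) ∧
      (g₂ = 1 ∨ ∃ y ε, D.Under y (S.param 2 a₂) ε) ∧ (g₂' = 1 ∨ ∃ y ε, D.Under y (S.param 2 b₂) ε) ∧
      g₂ * g₂' = triangleHolonomy x (P.overElt (S.comp 1) (y₀ 1)) e₀₁ e₀₂ e₁₂ (τ 1 0 < τ 1 2)
        (τ 2 0 < τ 2 1) := by
    rcases h.ne.lt_or_gt with hlt | hlt
    · refine ⟨_, _, x ^ e₀₂, w ^ e₁₂, hlt, i20, i21, .inl ⟨rfl, rfl⟩, .inr ⟨rfl, rfl⟩, z02, z12, ?_⟩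
      rw [triangleHolonomy, if_pos hlt, hw]
    · refine ⟨_, _, w ^ e₁₂, x ^ e₀₂, hlt, i21, i20, .inr ⟨rfl, rfl⟩, .inl ⟨rfl, rfl⟩, z12, z02, ?_⟩
      rw [triangleHolonomy, if_neg (not_lt.mpr hlt.le), hw]
  -- The middle strand has only one jump; the midpoint serves as a second parameter with trivial
  -- jump.
  have hi1 : τ 1 0 < (τ 1 0 + S.hi 1) / 2 := by linarith [i10.2]
  have hi2 : (τ 1 0 + S.hi 1) / 2 < S.hi 1 := by linarith [i10.2]
  refine ⟨![a₀, τ 1 0, a₂], ![b₀, (τ 1 0 + S.hi 1) / 2, b₂], ![1, x ^ e₀₁, g₂], ![1, 1, g₂'],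
    ⟨?_, ?_, ?_, ?_, ?_, ?_⟩, ?_, ?_, ?_⟩
  · intro s; fin_cases s
    exacts [hab, hi1, k1]
  · intro s; fin_cases s
    exacts [ha, i10, k2]
  · intro s; fin_cases s
    exacts [hb, ⟨i10.1.trans hi1, hi2⟩, k3]
  · intro s t s' t' ε ht ht' hu
    rcases h.cases_of_under hδ ht ht' hu with ⟨rfl, rfl, rfl, rfl, rfl⟩ |
      ⟨rfl, rfl, rfl, rfl, rfl⟩ | ⟨rfl, rfl, rfl, rfl, rfl⟩
    · refine ⟨by decide, .inl ⟨rfl, ?_⟩⟩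
      rw [strandColor_eq rfl rfl, ← hx, ← h01]
      rfl
    · refine ⟨by decide, ?_⟩
      rw [strandColor_eq rfl rfl, ← hx, ← h02]
      exact k4
    · refine ⟨by decide, ?_⟩
      have : P.overElt (S.comp 1) (strandColor P S y₀ ![a₀, τ 1 0, a₂]
          ![b₀, (τ 1 0 + S.hi 1) / 2, b₂] ![1, x ^ e₀₁, g₂] ![1, 1, g₂'] 1 (τ 1 2)) = w := by
        rw [strandColor_eq_act rfl, P.overElt_act, hw]
        by_cases hlt : τ 1 0 < τ 1 2 <;> simp [hlt]
      rw [this]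
      exact k5
  · intro s; fin_cases s
    exacts [.inl rfl, z01, k6]
  · intro s; fin_cases s
    exacts [.inl rfl, .inl rfl, k7]
  · simp
  · simp
  · exact k8

theorem Triangle.crossingsAt (h : Triangle D δ S c₀₁ c₀₂ c₁₂ κ τ)
    (hδ : ∀ x, D.pt x ∈ δ ↔ S.Contains x) :
    CrossingsAt D S fun i => (Finset.univ.erase i).image (τ i) := by
  have hmem : ∀ i j, i ≠ j → τ i j ∈ (Finset.univ.erase i).image (τ i) := fun i j hij =>
    Finset.mem_image_of_mem _ (Finset.mem_erase.mpr ⟨hij.symm, Finset.mem_univ _⟩)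
  refine h.crossings.crossingsAt hδ ?_ ?_
  · intro s t ht
    obtain ⟨j, hj, rfl⟩ := Finset.mem_image.mp ht
    exact h.inside s j (Finset.ne_of_mem_erase hj).symm
  · simp only [List.mem_cons, List.not_mem_nil, or_false, forall_eq_or_imp, forall_eq]
    exact ⟨⟨0, _, 1, _, hmem 0 1 (by decide), hmem 1 0 (by decide), rfl⟩,
      ⟨0, _, 2, _, hmem 0 2 (by decide), hmem 2 0 (by decide), rfl⟩,
      ⟨1, _, 2, _, hmem 1 2 (by decide), hmem 2 1 (by decide), rfl⟩⟩

theorem cross_swap (v w : Plane) : cross v w = -cross w v := by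
  simp only [cross]
  ring

/-- The case `i = 1` of `position`, with indices modulo 3. Together with `order_lower` it expresses
both orders through `κ` and the signs of the crossings `02` and `01`, so they agree exactly when
these signs do, and both flip with `κ`. -/
theorem Triangle.order_middle (h : Triangle D δ S c₀₁ c₀₂ c₁₂ κ τ) :
    τ 1 0 < τ 1 2 ↔ 0 < κ * triangleCross D S τ 0 2 := by
  have h1 : 0 < κ * (τ 1 0 - τ 1 2) * cross (D.vel (S.param 2 (τ 2 0))) (D.vel (S.param 0 (τ 0 2))) :=
    h.position 1
  rw [cross_swap] at h1
  change 0 < κ * (τ 1 0 - τ 1 2) * -triangleCross D S τ 0 2 at h1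
  have h2 : 0 < (τ 1 2 - τ 1 0) * (κ * triangleCross D S τ 0 2) := by linarith
  rw [← pos_iff_pos_of_mul_pos h2, sub_pos]

theorem Triangle.order_lower (h : Triangle D δ S c₀₁ c₀₂ c₁₂ κ τ) :
    τ 2 0 < τ 2 1 ↔ 0 < κ * triangleCross D S τ 0 1 := by
  have h1 : 0 < κ * (τ 2 1 - τ 2 0) * triangleCross D S τ 0 1 := h.position 2
  have h2 : 0 < (τ 2 1 - τ 2 0) * (κ * triangleCross D S τ 0 1) := by linarith
  rw [← pos_iff_pos_of_mul_pos h2, sub_pos]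

theorem Triangle.kappa_ne_zero (h : Triangle D δ S c₀₁ c₀₂ c₁₂ κ τ) : κ ≠ 0 := by
  rintro rfl
  have := h.position 0
  simp at this

theorem pos_neg_mul_iff {κ a b : ℝ} (hκ : κ ≠ 0) (hab : 0 < a * b) :
    0 < -κ * b ↔ ¬ 0 < κ * a := by
  rcases hκ.lt_or_gt with hk | hk <;> rcases mul_pos_iff.mp hab with ⟨ha, hb⟩ | ⟨ha, hb⟩
  · exact iff_of_true (mul_pos (neg_pos.mpr hk) hb) (not_lt.mpr (mul_neg_of_neg_of_pos hk ha).le)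
  · exact iff_of_false (not_lt.mpr (mul_neg_of_pos_of_neg (neg_pos.mpr hk) hb).le)
      (not_not.mpr (mul_pos_of_neg_of_neg hk ha))
  · exact iff_of_false (not_lt.mpr (mul_neg_of_neg_of_pos (neg_neg_of_pos hk) hb).le)
      (not_not.mpr (mul_pos hk ha))
  · exact iff_of_true (mul_pos_of_neg_of_neg (neg_neg_of_pos hk) hb)
      (not_lt.mpr (mul_neg_of_pos_of_neg hk ha).le)

theorem sign_cases {κ a b : ℝ} (hκ : κ ≠ 0) (ha : a ≠ 0) (hb : b ≠ 0) :
    ((SignType.sign b : ℤ) = SignType.sign a ∧ (0 < κ * b ↔ 0 < κ * a)) ∨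
      ((SignType.sign b : ℤ) = -(SignType.sign a : ℤ) ∧ (0 < κ * b ↔ ¬ 0 < κ * a)) := by
  rcases hκ.lt_or_gt with hk | hk <;> rcases ha.lt_or_gt with ha | ha <;>
    rcases hb.lt_or_gt with hb | hb <;>
    simp [sign_neg, sign_pos, hk, ha, hb, mul_pos_iff, hk.not_gt, ha.not_gt, hb.not_gt]

theorem TriangleMove.symm (h : TriangleMove c₀₁ c₀₂ c₁₂ D D') :
    TriangleMove c₀₁ c₀₂ c₁₂ D' D := by
  obtain ⟨δ, S, κ, τ, τ', hL, hD, hD', hsign⟩ := h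
  refine ⟨δ, S, -κ, τ', τ, hL.symm, hD', by rwa [neg_neg], fun i j hij => ?_⟩
  rw [mul_comm]
  exact hsign i j hij

theorem TriangleMove.colorable (h : TriangleMove c₀₁ c₀₂ c₁₂ D D')
    (hc : c₁₂ = .virtual ∨ (c₀₁ = .virtual ∧ c₀₂ = .virtual) ∨
      (c₀₁ = .classical ∧ c₀₂ = .classical)) (hcol : Colorable P D) : Colorable P D' := by
  obtain ⟨δ, S, κ, τ, τ', hL, hD, hD', hsign⟩ := h
  refine hL.colorable_of_hasJumps (hD.crossingsAt hL.left) (hD'.crossingsAt hL.right)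
    (fun y₀ => ?_) hcol
  obtain ⟨a, b, g, g', hJ, h0, h1, h2⟩ := hD.exists_hasJumps (P := P) hL.left y₀
  obtain ⟨a', b', f, f', hJ', h0', h1', h2'⟩ := hD'.exists_hasJumps (P := P) hL.right y₀
  have s01 := hsign 0 1 (by decide)
  have s02 := hsign 0 2 (by decide)
  have s12 := hsign 1 2 (by decide)
  have hexp : ∀ (c : CrossingType) {a b : ℝ}, 0 < a * b → c.exponent a = c.exponent b := by
    intro c a b hab
    cases c with
    | classical => exact congrArg (fun s : SignType => (s : ℤ)) (sign_eq_of_mul_pos hab)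
    | virtual => rfl
  have e01 : c₀₁.exponent (triangleCross D' S τ' 0 1) = c₀₁.exponent (triangleCross D S τ 0 1) :=
    (hexp c₀₁ s01).symm
  have e02 : c₀₂.exponent (triangleCross D' S τ' 0 2) = c₀₂.exponent (triangleCross D S τ 0 2) :=
    (hexp c₀₂ s02).symm
  have e12 : c₁₂.exponent (triangleCross D' S τ' 1 2) = c₁₂.exponent (triangleCross D S τ 1 2) :=
    (hexp c₁₂ s12).symm
  refine ⟨a, b, g, g', a', b', f, f', hJ, hJ', fun s => ?_⟩
  fin_cases s
  · exact h0.trans h0'.symm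
  · exact h1.trans (by rw [← e01]; exact h1'.symm)
  · refine h2.trans (Eq.trans ?_ h2'.symm)
    rw [e01, e02, e12]
    -- If `12` is virtual only the jump from the upper strand remains, and if `01` and `02` are
    -- virtual only that from the unmodified middle strand; order is then irrelevant. The last case
    -- needs the conjugation identity.
    rcases hc with rfl | ⟨rfl, rfl⟩ | ⟨rfl, rfl⟩
    · simp [triangleHolonomy, CrossingType.exponent]
    · simp [triangleHolonomy, CrossingType.exponent]
    · have hκ := hD.kappa_ne_zero
      have n01 : triangleCross D S τ 0 1 ≠ 0 := fun h => by
        change 0 < triangleCross D S τ 0 1 * _ at s01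
        simp [h] at s01
      have n02 : triangleCross D S τ 0 2 ≠ 0 := fun h => by
        change 0 < triangleCross D S τ 0 2 * _ at s02
        simp [h] at s02
      refine triangleHolonomy_eq _ _ _ ?_ ?_ ?_
      · rw [hD.order_middle, hD'.order_middle]
        exact pos_neg_mul_iff hκ s02
      · rw [hD.order_lower, hD'.order_lower]
        exact pos_neg_mul_iff hκ s01
      · rw [hD.order_middle, hD.order_lower]
        exact sign_cases hκ n01 n02

theorem TriangleMove.colorable_iff (h : TriangleMove c₀₁ c₀₂ c₁₂ D D')
    (hc : c₁₂ = .virtual ∨ (c₀₁ = .virtual ∧ c₀₂ = .virtual) ∨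
      (c₀₁ = .classical ∧ c₀₂ = .classical)) : Colorable P D ↔ Colorable P D' :=
  ⟨h.colorable hc, h.symm.colorable hc⟩

end Triangle

/-! ### Invariance of colourability and of Milnor numbers -/

section Invariance

variable {n : ℕ} {Q Y : Type} [Group Q] {P : Palette n Q Y} {D D' : VirtualLinkDiagram n}

theorem WeldedMove.colorable_iff (h : WeldedMove D D') : Colorable P D ↔ Colorable P D' := by
  cases h with
  | plane h => exact h.colorable_iff
  | R1 h => exact h.colorable_iff
  | R2 h => exact h.colorable_iff
  | R3 h => exact h.colorable_iff (.inr (.inr ⟨rfl, rfl⟩))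
  | V1 h => exact h.colorable_iff
  | V2 h => exact h.colorable_iff_of_virtual
  | V3 h => exact h.colorable_iff (.inl rfl)
  | V4 h => exact h.colorable_iff (.inr (.inl ⟨rfl, rfl⟩))
  | OC h => exact h.colorable_iff (.inl rfl)

theorem SVWeldedIsotopic.colorable_iff (h : SVWeldedIsotopic D D') :
    Colorable P D ↔ Colorable P D' := by
  induction h with
  | rel D D' h => exact h.elim WeldedMove.colorable_iff SelfCrossingVirtualization.colorable_iff
  | refl => exact Iff.rfl
  | symm _ _ _ ih => exact ih.symm
  | trans _ _ _ _ _ ih ih' => exact ih.trans ih'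

theorem WeldedIsotopic.sv (h : WeldedIsotopic D D') : SVWeldedIsotopic D D' :=
  Relation.EqvGen.mono (fun _ _ => Or.inl) _ _ h

/-! ### Invariance of the residue classes -/

theorem indeterminacy_dvd_iff (G : ArcData n) (I : List (Fin n)) (d : ℤ) :
    d ∣ G.indeterminacy I ↔ ∀ J ∈ properCyclic I, d ∣ G.milnorNumber J := Finset.dvd_gcd_iff

theorem nodup_of_mem_properCyclic {I J : List (Fin n)} (hI : I.Nodup) (hJ : J ∈ properCyclic I) :
    J.Nodup ∧ 2 ≤ J.length ∧ J.length < I.length := by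
  obtain ⟨K, hK, h2, h3, hr⟩ := mem_properCyclic.mp hJ
  have e := hr.perm.length_eq
  exact ⟨hr.perm.nodup_iff.mpr (hI.sublist hK), by omega, by omega⟩

/-- Existence on `D` for the palette with `m` its own Milnor number, transport of colourability,
then rigidity on `D'`. Divisibility on `D` is needed for existence, on `D'` for rigidity. -/
theorem SVWeldedIsotopic.milnorNumber_modEq (h : SVWeldedIsotopic D D') (p : BasePointSystem D)
    (p' : BasePointSystem D') {I : List (Fin n)} (hlen : 2 ≤ I.length) (hI : I.Nodup) {d : ℤ}
    (hd : d ∣ D.indeterminacy p I) (hd' : d ∣ D'.indeterminacy p' I) :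
    D'.milnorNumber p' I ≡ D.milnorNumber p I [ZMOD d] := by
  rcases List.eq_nil_or_concat I with rfl | ⟨js, i, rfl⟩
  · simp at hlen
  rw [List.concat_eq_append] at *
  have hjs : js ≠ [] := by
    rintro rfl
    simp at hlen
  obtain ⟨C, hC⟩ := ArcData.exists_isArcColoring hI hjs ((indeterminacy_dvd_iff _ _ _).mp hd)
  obtain ⟨C', hC'⟩ := Colorable.exists_isArcColoring
    (h.colorable_iff.mp (colorable_of_isArcColoring p hC)) p'
  exact hC'.modEq hI hjs ((indeterminacy_dvd_iff _ _ _).mp hd')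

/-- Let `d` be the indeterminacy of `D` at `I`. For each shorter `J` entering it, `d` divides the
indeterminacy of `D` at `J`, hence by induction that of `D'`. The Milnor numbers at `J` are then
congruent modulo `d`, and that of `D` is zero modulo `d`. -/
theorem SVWeldedIsotopic.indeterminacy_dvd (h : SVWeldedIsotopic D D') (p : BasePointSystem D)
    (p' : BasePointSystem D') {I : List (Fin n)} (hI : I.Nodup) :
    D.indeterminacy p I ∣ D'.indeterminacy p' I := by
  induction hm : I.length using Nat.strong_induction_on generalizing I with
  | _ m ih =>
  subst hm
  refine (indeterminacy_dvd_iff _ _ _).mpr fun J hJ => ?_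
  obtain ⟨h1, h2, h3⟩ := nodup_of_mem_properCyclic hI hJ
  have hd := (indeterminacy_dvd_iff _ _ _).mp (dvd_refl (D.indeterminacy p I))
  have hdJ : D.indeterminacy p I ∣ D.indeterminacy p J :=
    (indeterminacy_dvd_iff _ _ _).mpr fun J' hJ' => hd J' (properCyclic_trans hJ hJ')
  have := h.milnorNumber_modEq p p' h2 h1 hdJ (hdJ.trans (ih _ h3 h1 rfl))
  exact this.dvd_iff.mpr (hd J hJ)

theorem SVWeldedIsotopic.milnorClass_eq (h : SVWeldedIsotopic D D') (p : BasePointSystem D)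
    (p' : BasePointSystem D') {I : List (Fin n)} (hlen : 2 ≤ I.length) (hI : I.Nodup) :
    D.milnorClass p I = D'.milnorClass p' I := by
  have h1 := h.indeterminacy_dvd p p' hI
  have h2 := SVWeldedIsotopic.indeterminacy_dvd (Relation.EqvGen.symm _ _ h) p' p hI
  have h3 := h.milnorNumber_modEq p p' hlen hI (dvd_refl _) h1
  ext m
  exact ⟨fun hm => (Int.ModEq.trans hm h3.symm).of_dvd h2,
    fun hm => (Int.ModEq.of_dvd h1 hm).trans h3⟩

end Invariance

end WeldedMilnor

theorem mainTheorem3 {n : ℕ} (L L' : WeldedMilnor.WeldedLink n)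
    (D D' : WeldedMilnor.VirtualLinkDiagram n)
    (hD : WeldedMilnor.WeldedLink.IsDiagram D L) (hD' : WeldedMilnor.WeldedLink.IsDiagram D' L')
    (h : WeldedMilnor.SVWeldedIsotopic D D')
    (I : List (Fin n)) (hlen : 2 ≤ I.length) (hI : I.Nodup) :
    (∀ (E : WeldedMilnor.VirtualLinkDiagram n) (p : WeldedMilnor.BasePointSystem E),
      WeldedMilnor.WeldedLink.IsDiagram E L → E.milnorClass p I = L.milnorBar I) ∧
    (∀ (E : WeldedMilnor.VirtualLinkDiagram n) (p : WeldedMilnor.BasePointSystem E),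
      WeldedMilnor.WeldedLink.IsDiagram E L' → E.milnorClass p I = L'.milnorBar I) ∧
    L.milnorBar I = L'.milnorBar I := by
  -- Every diagram of the link is welded isotopic to the representative chosen in `milnorBar`, and
  -- the invariance result allows arbitrary base points on both sides.
  have key : ∀ (L : WeldedMilnor.WeldedLink n) (E : WeldedMilnor.VirtualLinkDiagram n)
      (p : WeldedMilnor.BasePointSystem E), WeldedMilnor.WeldedLink.IsDiagram E L →
      E.milnorClass p I = L.milnorBar I := by
    intro L E p hE
    have h1 : WeldedMilnor.WeldedIsotopic E (Quotient.out (s := WeldedMilnor.weldedSetoid n) L) :=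
      Quotient.exact (s := WeldedMilnor.weldedSetoid n)
        (hE.trans (Quotient.out_eq (s := WeldedMilnor.weldedSetoid n) L).symm)
    exact h1.sv.milnorClass_eq p _ hlen hI
  refine ⟨key L, key L', ?_⟩
  rw [← key L D (Classical.arbitrary _) hD, ← key L' D' (Classical.arbitrary _) hD']
  exact h.milnorClass_eq _ _ hlen hI
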